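/- **Setting.** Let $k$ be a field and let $H$ be a finite-dimensional weak Hopf algebra over $k$: a $k$-algebra and $k$-coalgebra with a linear map $S:H\to H$ such that, for all $x,y,z\in H$, $\Delta(xy)=\Delta(x)\Delta(y)$; $(\mathrm{id}\otimes\Delta)\Delta(1)=(\Delta(1)\otimes1)(1\otimes\Delta(1))=(1\otimes\Delta(1))(\Delta(1)\otimes1)$; $\varepsilon(xyz)=\varepsilon(xy_{(1)})\varepsilon(y_{(2)}z)=\varepsilon(xy_{(2)})\varepsilon(y_{(1)}z)$; $x_{(1)}S(x_{(2)})=\varepsilon_t(x):=\varepsilon(1_{(1)}x)1_{(2)}$; $S(x_{(1)})x_{(2)}=\varepsilon_s(x):=1_{(1)}\varepsilon(x1_{(2)})$; $S(x_{(1)})x_{(2)}S(x_{(3)})=S(x)$. Put $H_t=\varepsilon_t(H)$ and $H_s=\varepsilon_s(H)$, and assume that $H$ is regular, i.e. $S^2$ is the identity on $H_tH_s$. Assume that $H$ is quasi-triangular with $R$-matrix $R=R^1\otimes R^2\in\Delta^{op}(1)(H\otimes_k H)\Delta(1)$: $R\Delta(h)=\Delta^{op}(h)R$ for all $h\in H$,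 $(\mathrm{id}\otimes\Delta)R=R_{13}R_{12}$, $(\Delta\otimes\mathrm{id})R=R_{13}R_{23}$, and there is $\bar R\in\Delta(1)(H\otimes_k H)\Delta^{op}(1)$ with $R\bar R=\Delta^{op}(1)$ and $\bar RR=\Delta(1)$. Let $\mathcal C={}_H\mathcal M$ be the braided monoidal category of finite-dimensional left $H$-modules: the tensor product is $M\otimes_tN=\Delta(1)(M\otimes_kN)$ with the diagonal action; the unit object $1$ is $H_t$ with $h\cdot z=\varepsilon_t(hz)$; the unit isomorphisms are $l_X(1_{(1)}z\otimes1_{(2)}x)=zx$ and $r_X(1_{(1)}x\otimes1_{(2)}z)=S(z)x$; the braiding is $c_{M,N}(1_{(1)}m\otimes1_{(2)}n)=R^2n\otimes R^1m$. Every $X\in\mathcal C$ has the left dual $X^*=\mathrm{Hom}_k(X,k)$, with $(h\cdot f)(x)=f(S(h)x)$, $ev_X(1_{(1)}f\otimes1_{(2)}x)=f(1_{(1)}x)1_{(2)}$ and $coev_X(z)=\sum_iz_{(1)}x_i\otimes z_{(2)}x_i^*$, where $(x_i,x_i^*)_i$ is a dual basis of $X$. **Automorphism braided groups.** A braided monoidal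 category $\mathcal C$ satisfies the *representability assumption for modules* if there are an object $U$ and bijections $\theta_V:\mathrm{Hom}_{\mathcal C}(V,U)\to\mathrm{Nat}(V\otimes\mathrm{id}_{\mathcal C},\mathrm{id}_{\mathcal C})$, natural in $V$, such that with $\alpha=\theta_U(\mathrm{id}_U)$ the maps $$\theta^2_V:\mathrm{Hom}_{\mathcal C}(V,U^{\otimes2})\to\mathrm{Nat}(V\otimes\mathrm{id}^{\otimes2},\mathrm{id}^{\otimes2}),\quad \theta^2_V(t)_{X,Y}=(\alpha_X\otimes\alpha_Y)(\mathrm{id}\otimes c_{U,X}\otimes\mathrm{id})(t\otimes\mathrm{id}),$$ and, formed in the same way, $\theta^3_V:\mathrm{Hom}_{\mathcal C}(V,U^{\otimes3})\to\mathrm{Nat}(V\otimes\mathrm{id}^{\otimes3},\mathrm{id}^{\otimes3})$ (use $c$ to move $X,Y,Z$ next to the three factors $U$, then apply $\alpha_X\otimes\alpha_Y\otimes\alpha_Z$) are bijective for all $V$. If every object $X$ of $\mathcal C$ has a left dual $X^*$, the *automorphism braided group* of $\mathcal C$ is the object $U$ with the structure of a Hopf algebra in $\mathcal C$ determined, for all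 $X,Y\in\mathcal C$, by $$\alpha_X(m\otimes\mathrm{id}_X)=\alpha_X(\mathrm{id}_U\otimes\alpha_X),\quad \alpha_X(u\otimes\mathrm{id}_X)=\mathrm{id}_X,\quad \theta^2_U(\Delta)_{X,Y}=\alpha_{X\otimes Y},\quad \varepsilon=\alpha_1,$$ $$\alpha_X(S\otimes\mathrm{id}_X)=(\mathrm{id}_X\otimes ev_X)(\mathrm{id}_X\otimes\alpha_{X^*}\otimes\mathrm{id}_X)(c_{U,X}\otimes\mathrm{id}_{X^*}\otimes\mathrm{id}_X)(\mathrm{id}_U\otimes coev_X\otimes\mathrm{id}_X)$$ (unit and associativity isomorphisms suppressed). **Theorem.** The category $\mathcal C={}_H\mathcal M$ satisfies the representability assumption for modules. Its automorphism braided group is the object $B=C_H(H_s)$, the centralizer of $H_s$ in $H$, with the adjoint action $h\cdot_{ad}b=h_{(1)}bS(h_{(2)})$, and with canonical action $\alpha_X(1_{(1)}\cdot_{ad}b\otimes1_{(2)}x)=bx$ for $X\in\mathcal C$, $x\in X$, $b\in B$. Its Hopf algebra structure in $\mathcal C$ is given, for $a,b\in B$ and $z\in H_t$, by 1. $m_B(1_{(1)}\cdot_{ad}a\otimes1_{(2)}\cdot_{ad}b)=ab$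 and $u_B(z)=z$; 2. $\Delta_B(b)=b_{(1)}S(R^2)\otimes R^1\cdot_{ad}b_{(2)}\in B\otimes_tB\subseteq H\otimes_kH$ and $\varepsilon_B(b)=\varepsilon_t(b)$; 3. $S_B(b)=R^2S(R^1\cdot_{ad}b)$. -/

import Mathlib

open CategoryTheory TensorProduct Coalgebra
universe u

set_option linter.unusedSectionVars false
set_option linter.unusedSimpArgs false

section Counital
variable (k H : Type u) [Field k] [Ring H] [Algebra k H] [Coalgebra k H]

/-- The target counital map `ε_t(x) = ε(1₍₁₎ x) 1₍₂₎`. -/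
noncomputable def targetCounit : H →ₗ[k] H :=
  (TensorProduct.lid k H).toLinearMap ∘ₗ (counit (R := k) (A := H)).rTensor H ∘ₗ
    LinearMap.mulLeft k (comul (R := k) (1 : H)) ∘ₗ (TensorProduct.mk k H H).flip 1

/-- The source counital map `ε_s(x) = 1₍₁₎ ε(x 1₍₂₎)`. -/
noncomputable def sourceCounit : H →ₗ[k] H :=
  (TensorProduct.rid k H).toLinearMap ∘ₗ (counit (R := k) (A := H)).lTensor H ∘ₗ
    LinearMap.mulRight k (comul (R := k) (1 : H)) ∘ₗ TensorProduct.mk k H H 1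

/-- A weak Hopf algebra over a field `k`. -/
class WeakHopfAlgebra where
  /-- the antipode `S` -/
  antipode : H →ₗ[k] H
  /-- `Δ(xy) = Δ(x)Δ(y)` -/
  comul_mul : ∀ x y : H, comul (R := k) (x * y) = comul (R := k) x * comul (R := k) y
  /-- `(id ⊗ Δ)Δ(1) = (Δ(1) ⊗ 1)(1 ⊗ Δ(1))` -/
  comul_comul_one : (comul (R := k) (A := H)).lTensor H (comul (R := k) (1 : H)) =
    TensorProduct.assoc k H H H (comul (R := k) (1 : H) ⊗ₜ[k] (1 : H)) *
      ((1 : H) ⊗ₜ[k] comul (R := k) (1 : H))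
  /-- `(id ⊗ Δ)Δ(1) = (1 ⊗ Δ(1))(Δ(1) ⊗ 1)` -/
  comul_comul_one' : (comul (R := k) (A := H)).lTensor H (comul (R := k) (1 : H)) =
    ((1 : H) ⊗ₜ[k] comul (R := k) (1 : H)) *
      TensorProduct.assoc k H H H (comul (R := k) (1 : H) ⊗ₜ[k] (1 : H))
  /-- `ε(xyz) = ε(x y₍₁₎) ε(y₍₂₎ z)` -/
  counit_mul_mul : ∀ x y z : H, counit (R := k) (x * y * z) =
    LinearMap.mul' k k (TensorProduct.map (counit (R := k) (A := H) ∘ₗ LinearMap.mulLeft k x)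
      (counit (R := k) (A := H) ∘ₗ LinearMap.mulRight k z) (comul (R := k) y))
  /-- `ε(xyz) = ε(x y₍₂₎) ε(y₍₁₎ z)` -/
  counit_mul_mul' : ∀ x y z : H, counit (R := k) (x * y * z) =
    LinearMap.mul' k k (TensorProduct.map (counit (R := k) (A := H) ∘ₗ LinearMap.mulRight k z)
      (counit (R := k) (A := H) ∘ₗ LinearMap.mulLeft k x) (comul (R := k) y))
  /-- `x₍₁₎ S(x₍₂₎) = ε_t(x)` -/
  mul_antipode : ∀ x : H,
    LinearMap.mul' k H (antipode.lTensor H (comul (R := k) x)) = targetCounit k H x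
  /-- `S(x₍₁₎) x₍₂₎ = ε_s(x)` -/
  antipode_mul : ∀ x : H,
    LinearMap.mul' k H (antipode.rTensor H (comul (R := k) x)) = sourceCounit k H x
  /-- `S(x₍₁₎) x₍₂₎ S(x₍₃₎) = S(x)` -/
  antipode_mul_antipode : ∀ x : H,
    LinearMap.mul' k H (TensorProduct.map antipode
      (LinearMap.mul' k H ∘ₗ antipode.lTensor H ∘ₗ comul (R := k) (A := H)) (comul (R := k) x)) =
    antipode x

/-- A weak Hopf algebra is regular if `S²` restricts to the identity on `H_t H_s`. -/
class WeakHopfAlgebra.IsRegular [WeakHopfAlgebra k H] : Prop where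
  antipode_antipode : ∀ x y : H,
    antipode (k := k) (antipode (k := k) (targetCounit k H x * sourceCounit k H y)) =
      targetCounit k H x * sourceCounit k H y

end Counital

namespace WeakHopfAlgebra
section Lemmas
variable {k H : Type u} [Field k] [Ring H] [Algebra k H] [Coalgebra k H]

local notation "Δ" => comul (R := k) (A := H)
local notation "ε" => counit (R := k) (A := H)
local notation "εt" => targetCounit k H
local notation "εs" => sourceCounit k H
local notation "S" => antipode (k := k) (H := H)


theorem targetCounit_apply (x : H) : εt x =
    TensorProduct.lid k H ((ε).rTensor H (Δ 1 * (x ⊗ₜ[k] 1))) := rfl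

theorem sourceCounit_apply (x : H) : εs x =
    TensorProduct.rid k H ((ε).lTensor H ((1 ⊗ₜ[k] x) * Δ 1)) := rfl

theorem exists_rep (t : H ⊗[k] H) : ∃ s : Finset (H × H), t = ∑ i ∈ s, i.1 ⊗ₜ[k] i.2 :=
  TensorProduct.exists_finset t

theorem targetCounit_rep {s : Finset (H × H)} (hs : Δ 1 = ∑ i ∈ s, i.1 ⊗ₜ[k] i.2) (x : H) :
    εt x = ∑ i ∈ s, ε (i.1 * x) • i.2 := by
  simp [targetCounit_apply, hs, Finset.sum_mul, map_sum]

theorem sourceCounit_rep {s : Finset (H × H)} (hs : Δ 1 = ∑ i ∈ s, i.1 ⊗ₜ[k] i.2) (x : H) :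
    εs x = ∑ i ∈ s, ε (x * i.2) • i.1 := by
  simp [sourceCounit_apply, hs, Finset.mul_sum, map_sum]

theorem rep_counit_left {s : Finset (H × H)} {x : H} (hs : Δ x = ∑ i ∈ s, i.1 ⊗ₜ[k] i.2) :
    ∑ i ∈ s, ε i.1 • i.2 = x := by
  have := congrArg (TensorProduct.lid k H) (rTensor_counit_comul (R := k) x)
  simpa [hs, map_sum] using this

theorem rep_counit_right {s : Finset (H × H)} {x : H} (hs : Δ x = ∑ i ∈ s, i.1 ⊗ₜ[k] i.2) :
    ∑ i ∈ s, ε i.2 • i.1 = x := by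
  have := congrArg (TensorProduct.rid k H) (lTensor_counit_comul (R := k) x)
  simpa [hs, map_sum] using this

variable [WeakHopfAlgebra k H]

theorem one_mul_comul (x : H) : Δ 1 * Δ x = Δ x := by rw [← comul_mul, one_mul]
theorem comul_mul_one (x : H) : Δ x * Δ 1 = Δ x := by rw [← comul_mul, mul_one]

theorem counit_rep {s : Finset (H × H)} {y : H} (hs : Δ y = ∑ i ∈ s, i.1 ⊗ₜ[k] i.2) (x z : H) :
    ε (x * y * z) = ∑ i ∈ s, ε (x * i.1) * ε (i.2 * z) := by
  simp [counit_mul_mul, hs, map_sum]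

theorem counit_rep' {s : Finset (H × H)} {y : H} (hs : Δ y = ∑ i ∈ s, i.1 ⊗ₜ[k] i.2) (x z : H) :
    ε (x * y * z) = ∑ i ∈ s, ε (x * i.2) * ε (i.1 * z) := by
  simp [counit_mul_mul', hs, map_sum, mul_comm]

theorem counit_mul_target (x y : H) : ε (x * εt y) = ε (x * y) := by
  obtain ⟨s, hs⟩ := exists_rep (Δ 1)
  have := counit_rep' hs x y
  rw [mul_one] at this
  simp [targetCounit_rep hs, Finset.mul_sum, map_sum, this, mul_comm]

theorem counit_source_mul (x y : H) : ε (εs x * y) = ε (x * y) := by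
  obtain ⟨s, hs⟩ := exists_rep (Δ 1)
  have := counit_rep' hs x y
  rw [mul_one] at this
  simp [sourceCounit_rep hs, Finset.sum_mul, map_sum, this]


theorem slot_one {s : Finset (H × H)} (hs : Δ 1 = ∑ i ∈ s, i.1 ⊗ₜ[k] i.2) (φ : H →ₗ[k] k) :
    (∑ i ∈ s, φ i.1 • Δ i.2 = ∑ i ∈ s, ∑ j ∈ s, φ i.1 • ((i.2 * j.1) ⊗ₜ[k] j.2)) ∧
    (∑ i ∈ s, φ i.1 • Δ i.2 = ∑ i ∈ s, ∑ j ∈ s, φ i.1 • ((j.1 * i.2) ⊗ₜ[k] j.2)) := by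
  let G : H ⊗[k] (H ⊗[k] H) →ₗ[k] H ⊗[k] H :=
    (TensorProduct.lid k _).toLinearMap ∘ₗ TensorProduct.map φ LinearMap.id
  constructor
  · have := congrArg G (comul_comul_one (k := k) (H := H))
    rw [Finset.sum_comm]
    simpa [G, hs, map_sum, sum_tmul, tmul_sum, Finset.sum_mul, Finset.mul_sum] using this
  · have := congrArg G (comul_comul_one' (k := k) (H := H))
    simpa [G, hs, map_sum, sum_tmul, tmul_sum, Finset.sum_mul, Finset.mul_sum] using this

theorem slot_three {s : Finset (H × H)} (hs : Δ 1 = ∑ i ∈ s, i.1 ⊗ₜ[k] i.2) (φ : H →ₗ[k] k) :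
    (∑ i ∈ s, φ i.2 • Δ i.1 = ∑ i ∈ s, ∑ j ∈ s, φ j.2 • (i.1 ⊗ₜ[k] (i.2 * j.1))) ∧
    (∑ i ∈ s, φ i.2 • Δ i.1 = ∑ i ∈ s, ∑ j ∈ s, φ j.2 • (i.1 ⊗ₜ[k] (j.1 * i.2))) := by
  let G : H ⊗[k] (H ⊗[k] H) →ₗ[k] H ⊗[k] H :=
    (TensorProduct.rid k _).toLinearMap ∘ₗ TensorProduct.map LinearMap.id φ ∘ₗ
      (TensorProduct.assoc k H H H).symm.toLinearMap
  have h0 : ∑ i ∈ s, φ i.2 • Δ i.1 = G ((comul (R := k) (A := H)).lTensor H (Δ 1)) := by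
    rw [← coassoc_apply]
    simp [G, hs, map_sum]
  constructor
  · rw [h0, comul_comul_one, Finset.sum_comm]
    simp [G, hs, map_sum, sum_tmul, tmul_sum, Finset.sum_mul, Finset.mul_sum]
  · rw [h0, comul_comul_one']
    simp [G, hs, map_sum, sum_tmul, tmul_sum, Finset.sum_mul, Finset.mul_sum]

theorem slot_two {s : Finset (H × H)} (hs : Δ 1 = ∑ i ∈ s, i.1 ⊗ₜ[k] i.2) (φ : H →ₗ[k] k) :
    (∑ i ∈ s, TensorProduct.rid k H (φ.lTensor H (Δ i.1)) ⊗ₜ[k] i.2 =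
      ∑ i ∈ s, ∑ j ∈ s, φ (i.2 * j.1) • (i.1 ⊗ₜ[k] j.2)) ∧
    (∑ i ∈ s, TensorProduct.rid k H (φ.lTensor H (Δ i.1)) ⊗ₜ[k] i.2 =
      ∑ i ∈ s, ∑ j ∈ s, φ (j.1 * i.2) • (i.1 ⊗ₜ[k] j.2)) ∧
    (∑ i ∈ s, TensorProduct.rid k H (φ.lTensor H (Δ i.1)) ⊗ₜ[k] i.2 =
      ∑ i ∈ s, i.1 ⊗ₜ[k] TensorProduct.lid k H (φ.rTensor H (Δ i.2))) := by
  let G : H ⊗[k] (H ⊗[k] H) →ₗ[k] H ⊗[k] H :=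
    (((TensorProduct.rid k H).toLinearMap ∘ₗ φ.lTensor H).rTensor H) ∘ₗ
      (TensorProduct.assoc k H H H).symm.toLinearMap
  have hG : ∀ x y z, G (x ⊗ₜ (y ⊗ₜ z)) = φ y • (x ⊗ₜ z) := by
    intro x y z; simp [G, smul_tmul']
  have h0 : ∑ i ∈ s, TensorProduct.rid k H (φ.lTensor H (Δ i.1)) ⊗ₜ[k] i.2 =
      G ((comul (R := k) (A := H)).lTensor H (Δ 1)) := by
    rw [← coassoc_apply]
    simp [G, hs, map_sum]
  refine ⟨?_, ?_, ?_⟩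
  · rw [h0, comul_comul_one, Finset.sum_comm]
    simp [hG, hs, map_sum, sum_tmul, tmul_sum, Finset.sum_mul, Finset.mul_sum]
  · rw [h0, comul_comul_one']
    simp [hG, hs, map_sum, sum_tmul, tmul_sum, Finset.sum_mul, Finset.mul_sum]
  · rw [h0]
    have : G = ((TensorProduct.lid k H).toLinearMap ∘ₗ φ.rTensor H).lTensor H := by
      ext x y z; simp [hG]
    rw [this]
    simp [hs, map_sum]

theorem comul_target (x : H) :
    Δ (εt x) = (εt x ⊗ₜ[k] 1) * Δ 1 ∧ Δ (εt x) = Δ 1 * (εt x ⊗ₜ[k] 1) := by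
  obtain ⟨s, hs⟩ := exists_rep (Δ 1)
  obtain ⟨h1, h2⟩ := slot_one hs (ε ∘ₗ LinearMap.mulRight k x)
  rw [targetCounit_rep hs, map_sum]
  simp only [map_smul, LinearMap.comp_apply, LinearMap.mulRight_apply] at h1 h2 ⊢
  constructor
  · rw [h1, hs, Finset.sum_comm]
    simp [sum_tmul, Finset.sum_mul, Finset.mul_sum, smul_tmul']
  · rw [h2, hs, Finset.sum_comm]
    simp [sum_tmul, Finset.sum_mul, Finset.mul_sum, smul_tmul']
    try rw [Finset.sum_comm]

theorem comul_source (x : H) :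
    Δ (εs x) = (1 ⊗ₜ[k] εs x) * Δ 1 ∧ Δ (εs x) = Δ 1 * (1 ⊗ₜ[k] εs x) := by
  obtain ⟨s, hs⟩ := exists_rep (Δ 1)
  obtain ⟨h1, h2⟩ := slot_three hs (ε ∘ₗ LinearMap.mulLeft k x)
  rw [sourceCounit_rep hs, map_sum]
  simp only [map_smul, LinearMap.comp_apply, LinearMap.mulLeft_apply] at h1 h2 ⊢
  constructor
  · rw [h2, hs]
    simp [tmul_sum, Finset.sum_mul, Finset.mul_sum, Finset.smul_sum]
  · rw [h1, hs, Finset.sum_comm]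
    simp [tmul_sum, Finset.sum_mul, Finset.mul_sum, Finset.smul_sum]

theorem target_mul_source (x y : H) : εt x * εs y = εs y * εt x := by
  obtain ⟨s, hs⟩ := exists_rep (Δ 1)
  obtain ⟨h1, h2⟩ := slot_one hs (ε ∘ₗ LinearMap.mulRight k x)
  have h := congrArg (fun t => TensorProduct.rid k H
    ((ε ∘ₗ LinearMap.mulLeft k y).lTensor H t)) (h1.symm.trans h2)
  simp only [targetCounit_rep hs, sourceCounit_rep hs]
  simp only [map_sum, map_smul, LinearMap.lTensor_tmul, LinearMap.comp_apply,
    LinearMap.mulLeft_apply, LinearMap.mulRight_apply, TensorProduct.rid_tmul] at h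
  simp only [Finset.sum_mul, Finset.mul_sum, smul_mul_assoc, mul_smul_comm, Finset.smul_sum]
  simp only [smul_smul] at h ⊢
  rw [Finset.sum_comm, ← h]
  exact Finset.sum_congr rfl fun i _ => Finset.sum_congr rfl fun j _ => by
    rw [mul_comm (ε (y * j.2))]

/-- `h₍₁₎ ⊗ ε_t(h₍₂₎) = 1₍₁₎ h ⊗ 1₍₂₎` -/
theorem lTensor_target_comul (h : H) : (εt).lTensor H (Δ h) = Δ 1 * (h ⊗ₜ[k] 1) := by
  obtain ⟨s, hs⟩ := exists_rep (Δ 1)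
  obtain ⟨t, ht⟩ := exists_rep (Δ h)
  have key : ∀ b : H, (εt).lTensor H (Δ 1 * (1 ⊗ₜ[k] b)) =
      ∑ i ∈ s, TensorProduct.rid k H ((ε ∘ₗ LinearMap.mulRight k b).lTensor H (Δ i.1)) ⊗ₜ[k] i.2 := by
    intro b
    rw [(slot_two hs _).2.1, hs]
    simp [Finset.sum_mul, map_sum, targetCounit_rep hs, tmul_sum, mul_assoc]
  have h2 : (εt).lTensor H (Δ h) =
      ∑ j ∈ t, (εt).lTensor H (Δ 1 * (1 ⊗ₜ[k] j.2)) * (j.1 ⊗ₜ[k] 1) := by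
    conv_lhs => rw [← one_mul_comul, ht, hs]
    rw [hs]
    simp [Finset.sum_mul, Finset.mul_sum, map_sum]
  rw [h2]
  simp only [key]
  simp only [Finset.sum_mul, Algebra.TensorProduct.tmul_mul_tmul, mul_one]
  rw [Finset.sum_comm, hs]
  simp only [Finset.sum_mul, Algebra.TensorProduct.tmul_mul_tmul, mul_one]
  refine Finset.sum_congr rfl fun i _ => ?_
  rw [← sum_tmul]
  congr 1
  have h3 := congrArg (TensorProduct.rid k H) (lTensor_counit_comul (R := k) (i.1 * h))
  rw [comul_mul, ht] at h3
  obtain ⟨r, hr⟩ := exists_rep (Δ i.1)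
  rw [hr] at h3 ⊢
  simp [Finset.sum_mul, Finset.mul_sum, map_sum] at h3 ⊢
  exact h3

/-- `ε_s(h₍₁₎) ⊗ h₍₂₎ = 1₍₁₎ ⊗ h 1₍₂₎` -/
theorem rTensor_source_comul (h : H) : (εs).rTensor H (Δ h) = (1 ⊗ₜ[k] h) * Δ 1 := by
  obtain ⟨s, hs⟩ := exists_rep (Δ 1)
  obtain ⟨t, ht⟩ := exists_rep (Δ h)
  have key : ∀ b : H, (εs).rTensor H ((b ⊗ₜ[k] 1) * Δ 1) =
      ∑ i ∈ s, i.1 ⊗ₜ[k] TensorProduct.lid k H ((ε ∘ₗ LinearMap.mulLeft k b).rTensor H (Δ i.2)) := by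
    intro b
    rw [← (slot_two hs _).2.2, (slot_two hs _).2.1, hs]
    simp [Finset.mul_sum, map_sum, sourceCounit_rep hs, sum_tmul, mul_assoc, smul_tmul']
    rw [Finset.sum_comm]
  have h2 : (εs).rTensor H (Δ h) =
      ∑ j ∈ t, (1 ⊗ₜ[k] j.2) * (εs).rTensor H ((j.1 ⊗ₜ[k] 1) * Δ 1) := by
    conv_lhs => rw [← comul_mul_one, ht, hs]
    rw [hs]
    simp [Finset.sum_mul, Finset.mul_sum, map_sum]
    rw [Finset.sum_comm]
  rw [h2]
  simp only [key]
  simp only [Finset.mul_sum, Algebra.TensorProduct.tmul_mul_tmul, one_mul]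
  rw [Finset.sum_comm, hs]
  simp only [Finset.mul_sum, Algebra.TensorProduct.tmul_mul_tmul, one_mul]
  refine Finset.sum_congr rfl fun i _ => ?_
  rw [← tmul_sum]
  congr 1
  have h3 := congrArg (TensorProduct.lid k H) (rTensor_counit_comul (R := k) (h * i.2))
  rw [comul_mul, ht] at h3
  obtain ⟨r, hr⟩ := exists_rep (Δ i.2)
  rw [hr] at h3 ⊢
  simp [Finset.sum_mul, Finset.mul_sum, map_sum] at h3 ⊢
  rw [Finset.sum_comm]
  exact h3

theorem lTensor_target_one : (εt).lTensor H (Δ 1) = Δ 1 := by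
  rw [lTensor_target_comul, ← Algebra.TensorProduct.one_def, mul_one]

theorem rTensor_source_one : (εs).rTensor H (Δ 1) = Δ 1 := by
  rw [rTensor_source_comul, ← Algebra.TensorProduct.one_def, one_mul]

theorem target_one : εt 1 = 1 := by
  rw [targetCounit_apply, ← Algebra.TensorProduct.one_def, mul_one, rTensor_counit_comul]; simp

theorem source_one : εs 1 = 1 := by
  rw [sourceCounit_apply, ← Algebra.TensorProduct.one_def, one_mul, lTensor_counit_comul]; simp

theorem target_mul_target (x y : H) : εt (x * εt y) = εt (x * y) := by
  obtain ⟨s, hs⟩ := exists_rep (Δ 1)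
  simp only [targetCounit_rep hs (x * _), ← mul_assoc, counit_mul_target]

theorem target_target (x : H) : εt (εt x) = εt x := by
  simpa using target_mul_target 1 x

theorem source_source (x : H) : εs (εs x) = εs x := by
  obtain ⟨s, hs⟩ := exists_rep (Δ 1)
  simp only [sourceCounit_rep hs (εs x), counit_source_mul, ← sourceCounit_rep hs]

/-- `1₍₁₎ ε(1₍₂₎ x)` -/
noncomputable def sbar (x : H) : H :=
  TensorProduct.rid k H ((ε ∘ₗ LinearMap.mulRight k x).lTensor H (Δ 1))

/-- `ε(x 1₍₁₎) 1₍₂₎` -/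
noncomputable def tbar (x : H) : H :=
  TensorProduct.lid k H ((ε ∘ₗ LinearMap.mulLeft k x).rTensor H (Δ 1))

theorem sbar_rep {s : Finset (H × H)} (hs : Δ 1 = ∑ i ∈ s, i.1 ⊗ₜ[k] i.2) (x : H) :
    sbar (k := k) x = ∑ i ∈ s, ε (i.2 * x) • i.1 := by
  simp [sbar, hs, map_sum]

theorem tbar_rep {s : Finset (H × H)} (hs : Δ 1 = ∑ i ∈ s, i.1 ⊗ₜ[k] i.2) (x : H) :
    tbar (k := k) x = ∑ i ∈ s, ε (x * i.1) • i.2 := by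
  simp [tbar, hs, map_sum]

theorem sbar_target (x : H) : sbar (k := k) (εt x) = sbar (k := k) x := by
  obtain ⟨s, hs⟩ := exists_rep (Δ 1)
  simp only [sbar_rep hs, counit_mul_target]

/-- `h₍₁₎ ε(h₍₂₎ x) = h 1₍₁₎ ε(1₍₂₎ x)` -/
theorem comul_counit_mulRight (h x : H) :
    TensorProduct.rid k H ((ε ∘ₗ LinearMap.mulRight k x).lTensor H (Δ h)) =
      h * sbar (k := k) x := by
  obtain ⟨s, hs⟩ := exists_rep (Δ 1)
  obtain ⟨t, ht⟩ := exists_rep (Δ h)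
  have key : ∀ b : H, ∑ i ∈ s, ε (b * i.2 * x) • i.1 =
      ∑ i ∈ s, ε (i.2 * x) • TensorProduct.rid k H ((ε ∘ₗ LinearMap.mulLeft k b).lTensor H (Δ i.1)) := by
    intro b
    have h1 := congrArg (fun t => TensorProduct.rid k H
      ((ε ∘ₗ LinearMap.mulRight k x).lTensor H t)) (slot_two hs (ε ∘ₗ LinearMap.mulLeft k b)).2.2
    simp only [map_sum, LinearMap.lTensor_tmul, TensorProduct.rid_tmul, LinearMap.comp_apply,
      LinearMap.mulRight_apply] at h1
    rw [h1]
    refine Finset.sum_congr rfl fun i _ => ?_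
    obtain ⟨r, hr⟩ := exists_rep (Δ i.2)
    rw [counit_rep hr]
    congr 1
    simp [hr, Finset.sum_mul, map_sum]
  have e1 : TensorProduct.rid k H ((ε ∘ₗ LinearMap.mulRight k x).lTensor H (Δ h)) =
      ∑ j ∈ t, j.1 * ∑ i ∈ s, ε (j.2 * i.2 * x) • i.1 := by
    rw [← comul_mul_one, ht, hs]
    simp [Finset.mul_sum, Finset.sum_mul, map_sum]
    rw [Finset.sum_comm]
  rw [e1]
  simp only [key]
  rw [sbar_rep hs]
  simp only [Finset.mul_sum, mul_smul_comm]
  rw [Finset.sum_comm]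
  refine Finset.sum_congr rfl fun i _ => ?_
  rw [← Finset.smul_sum]
  congr 1
  obtain ⟨r, hr⟩ := exists_rep (Δ i.1)
  have h3 := congrArg (TensorProduct.rid k H) (lTensor_counit_comul (R := k) (h * i.1))
  rw [comul_mul, ht, hr] at h3
  rw [hr]
  simp [Finset.sum_mul, Finset.mul_sum, map_sum] at h3 ⊢
  rw [Finset.sum_comm]
  exact h3

/-- `ε(x h₍₁₎) h₍₂₎ = ε(x 1₍₁₎) 1₍₂₎ h` -/
theorem comul_counit_mulLeft (h x : H) :
    TensorProduct.lid k H ((ε ∘ₗ LinearMap.mulLeft k x).rTensor H (Δ h)) =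
      tbar (k := k) x * h := by
  obtain ⟨s, hs⟩ := exists_rep (Δ 1)
  obtain ⟨t, ht⟩ := exists_rep (Δ h)
  have key : ∀ a : H, ∑ i ∈ s, ε (x * i.1 * a) • i.2 =
      ∑ i ∈ s, ε (x * i.1) • TensorProduct.lid k H ((ε ∘ₗ LinearMap.mulRight k a).rTensor H (Δ i.2)) := by
    intro a
    have h1 := congrArg (fun t => TensorProduct.lid k H
      ((ε ∘ₗ LinearMap.mulLeft k x).rTensor H t)) (slot_two hs (ε ∘ₗ LinearMap.mulRight k a)).2.2
    simp only [map_sum, LinearMap.rTensor_tmul, TensorProduct.lid_tmul, LinearMap.comp_apply,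
      LinearMap.mulLeft_apply] at h1
    rw [← h1]
    refine Finset.sum_congr rfl fun i _ => ?_
    obtain ⟨r, hr⟩ := exists_rep (Δ i.1)
    rw [counit_rep hr]
    congr 1
    simp [hr, Finset.mul_sum, map_sum, mul_comm]
  have e1 : TensorProduct.lid k H ((ε ∘ₗ LinearMap.mulLeft k x).rTensor H (Δ h)) =
      ∑ j ∈ t, (∑ i ∈ s, ε (x * i.1 * j.1) • i.2) * j.2 := by
    rw [← one_mul_comul, ht, hs]
    simp [Finset.mul_sum, Finset.sum_mul, map_sum, mul_assoc]
  rw [e1]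
  simp only [key]
  rw [tbar_rep hs]
  simp only [Finset.sum_mul, smul_mul_assoc]
  rw [Finset.sum_comm]
  refine Finset.sum_congr rfl fun i _ => ?_
  rw [← Finset.smul_sum]
  congr 1
  obtain ⟨r, hr⟩ := exists_rep (Δ i.2)
  have h3 := congrArg (TensorProduct.lid k H) (rTensor_counit_comul (R := k) (i.2 * h))
  rw [comul_mul, ht, hr] at h3
  rw [hr]
  simp [Finset.sum_mul, Finset.mul_sum, map_sum] at h3 ⊢
  exact h3

/-- `h₍₁₎ ε(x h₍₂₎) = ε_s(x) h` -/
theorem comul_counit_source (h x : H) :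
    TensorProduct.rid k H ((ε ∘ₗ LinearMap.mulLeft k x).lTensor H (Δ h)) = εs x * h := by
  obtain ⟨s, hs⟩ := exists_rep (Δ 1)
  obtain ⟨t, ht⟩ := exists_rep (Δ h)
  have h1 := congrArg (fun t => TensorProduct.rid k H
      ((ε ∘ₗ LinearMap.mulLeft k x).lTensor H t)) (lTensor_target_comul (k := k) h)
  rw [hs, ht] at h1
  rw [ht, sourceCounit_rep hs]
  simpa [map_sum, Finset.sum_mul, counit_mul_target] using h1

/-- `ε_t(h₍₁₎) ⊗ h₍₂₎ = ε_t(1₍₁₎) ⊗ 1₍₂₎ h` -/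
theorem rTensor_target_comul (h : H) :
    (εt).rTensor H (Δ h) = (εt).rTensor H (Δ 1) * (1 ⊗ₜ[k] h) := by
  obtain ⟨s, hs⟩ := exists_rep (Δ 1)
  have key : ∀ g : H, (εt).rTensor H (Δ g) = ∑ i ∈ s, i.2 ⊗ₜ[k] (tbar (k := k) i.1 * g) := by
    intro g
    obtain ⟨t, ht⟩ := exists_rep (Δ g)
    simp only [← comul_counit_mulLeft]
    simp [ht, map_sum, targetCounit_rep hs, sum_tmul, tmul_sum, smul_tmul']
    rw [Finset.sum_comm]
  rw [key h, key 1, Finset.sum_mul]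
  simp

/-- `1₍₁₎ ⊗ 1₍₂₎ z = 1₍₁₎ x ⊗ 1₍₂₎` with `z = ε_t(h)` and `x = sbar h`. -/
theorem comul_one_mul_target (x : H) :
    Δ 1 * (1 ⊗ₜ[k] εt x) = Δ 1 * (sbar (k := k) x ⊗ₜ[k] 1) := by
  obtain ⟨s, hs⟩ := exists_rep (Δ 1)
  have h1 : ∑ i ∈ s, i.1 ⊗ₜ[k] tbar (k := k) i.2 = Δ 1 := by
    have := (slot_two hs ε).1
    have h2 : ∀ i ∈ s, TensorProduct.rid k H ((ε).lTensor H (Δ i.1)) ⊗ₜ[k] i.2 = i.1 ⊗ₜ[k] i.2 := by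
      intro i _
      rw [lTensor_counit_comul]; simp
    rw [Finset.sum_congr rfl h2, ← hs] at this
    rw [this]
    simp [tbar_rep hs, tmul_sum]
  -- both sides equal `∑ sbar (z₍₁₎) ⊗ z₍₂₎`
  obtain ⟨t, ht⟩ := exists_rep (Δ (εt x))
  have h2 : Δ 1 * (1 ⊗ₜ[k] εt x) = ∑ j ∈ t, sbar (k := k) j.1 ⊗ₜ[k] j.2 := by
    rw [← h1, Finset.sum_mul]
    simp only [Algebra.TensorProduct.tmul_mul_tmul, mul_one, ← comul_counit_mulLeft, ht]
    simp [map_sum, tmul_sum, sbar_rep hs, sum_tmul, smul_tmul']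
    rw [Finset.sum_comm]
  have h3 : ∑ j ∈ t, sbar (k := k) j.1 ⊗ₜ[k] j.2 =
      ∑ i ∈ s, sbar (k := k) (i.1 * εt x) ⊗ₜ[k] i.2 := by
    let G : H →ₗ[k] H := (TensorProduct.rid k H).toLinearMap ∘ₗ
      (ε).lTensor H ∘ₗ LinearMap.mulLeft k (Δ 1) ∘ₗ TensorProduct.mk k H H 1
    have hG : ∀ y, G y = sbar (k := k) y := by
      intro y
      simp [G, sbar_rep hs, hs, Finset.sum_mul, map_sum]
    have := congrArg (G.rTensor H) (ht.symm.trans (comul_target (k := k) x).2)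
    rw [hs] at this
    simpa [map_sum, Finset.sum_mul, hG] using this
  rw [h2, h3]
  have h4 := (slot_two hs (ε ∘ₗ LinearMap.mulRight k (εt x))).1
  have h5 := (slot_two hs (ε ∘ₗ LinearMap.mulRight k (εt x))).2.1
  simp only [comul_counit_mulRight, sbar_target] at h4
  rw [hs, Finset.sum_mul]
  simp only [Algebra.TensorProduct.tmul_mul_tmul, mul_one]
  rw [h4]
  simp [sbar_rep hs, sum_tmul, smul_tmul', mul_assoc]
  rw [Finset.sum_comm]

theorem sbar_mem (x : H) : εs (sbar (k := k) x) = sbar (k := k) x := by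
  obtain ⟨s, hs⟩ := exists_rep (Δ 1)
  have h := rTensor_source_one (k := k) (H := H)
  have h1 := congrArg (fun t => TensorProduct.rid k H
      ((ε ∘ₗ LinearMap.mulRight k x).lTensor H t)) h
  rw [hs] at h1
  rw [sbar_rep hs]
  simpa [map_sum] using h1

theorem target_sbar (x : H) : εt (sbar (k := k) x) = εt x := by
  obtain ⟨s, hs⟩ := exists_rep (Δ 1)
  have : ∀ j : H, ε (j * x) = ∑ i ∈ s, ε (j * i.1) * ε (i.2 * x) := by
    intro j; simpa using counit_rep hs j x
  rw [targetCounit_rep hs, targetCounit_rep hs]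
  refine Finset.sum_congr rfl fun j _ => ?_
  rw [this, sbar_rep hs]
  simp [Finset.mul_sum, map_sum, mul_comm]

theorem target_mul (x y : H) : ∀ {t : Finset (H × H)} (_ : Δ x = ∑ i ∈ t, i.1 ⊗ₜ[k] i.2),
    εt (x * y) = ∑ i ∈ t, i.1 * εt y * S i.2 := by
  intro t ht
  rw [← target_mul_target, ← mul_antipode, comul_mul, (comul_target y).2, ← mul_assoc,
    comul_mul_one, ht]
  simp [map_sum, Finset.sum_mul]

theorem source_mul_source (x y : H) : εs (εs x * y) = εs (x * y) := by
  obtain ⟨s, hs⟩ := exists_rep (Δ 1)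
  simp only [sourceCounit_rep hs (_ * y), mul_assoc, counit_source_mul]

theorem source_mul (x y : H) : ∀ {t : Finset (H × H)} (_ : Δ y = ∑ i ∈ t, i.1 ⊗ₜ[k] i.2),
    εs (x * y) = ∑ i ∈ t, S i.1 * εs x * i.2 := by
  intro t ht
  rw [← source_mul_source, ← antipode_mul, comul_mul, (comul_source x).1, mul_assoc,
    one_mul_comul, ht]
  simp [map_sum, Finset.mul_sum, mul_assoc]

theorem antipode_conv :
    WithConv.toConv (S) * (WithConv.toConv (LinearMap.id : H →ₗ[k] H) * WithConv.toConv (S)) =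
      WithConv.toConv (S) := by
  ext x
  simp only [LinearMap.convMul_apply]
  exact antipode_mul_antipode x

theorem id_conv_antipode :
    WithConv.toConv (LinearMap.id : H →ₗ[k] H) * WithConv.toConv (S) = WithConv.toConv (εt) := by
  ext x
  exact mul_antipode x

theorem antipode_conv_id :
    WithConv.toConv (S) * WithConv.toConv (LinearMap.id : H →ₗ[k] H) = WithConv.toConv (εs) := by
  ext x
  exact antipode_mul x

theorem antipode_rep_target {x : H} {t : Finset (H × H)} (ht : Δ x = ∑ i ∈ t, i.1 ⊗ₜ[k] i.2) :
    S x = ∑ i ∈ t, S i.1 * εt i.2 := by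
  have := antipode_conv (k := k) (H := H)
  rw [id_conv_antipode] at this
  have := congrArg (fun f => f.ofConv x) this
  simpa [LinearMap.convMul_def, ht, map_sum] using this.symm

theorem antipode_rep_source {x : H} {t : Finset (H × H)} (ht : Δ x = ∑ i ∈ t, i.1 ⊗ₜ[k] i.2) :
    S x = ∑ i ∈ t, εs i.1 * S i.2 := by
  have := antipode_conv (k := k) (H := H)
  rw [← mul_assoc, antipode_conv_id] at this
  have := congrArg (fun f => f.ofConv x) this
  simpa [LinearMap.convMul_def, ht, map_sum] using this.symm

theorem antipode_one : S (1 : H) = 1 := by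
  obtain ⟨s, hs⟩ := exists_rep (Δ 1)
  have h := rTensor_source_one (k := k) (H := H)
  have h1 := congrArg (fun t => LinearMap.mul' k H ((S).lTensor H t)) h
  rw [mul_antipode, target_one, hs] at h1
  rw [antipode_rep_source hs]
  simpa [map_sum] using h1

theorem antipode_mul_rev (x y : H) : S (x * y) = S y * S x := by
  let P : WithConv (H ⊗[k] H →ₗ[k] H) := WithConv.toConv (S ∘ₗ LinearMap.mul' k H)
  let M : WithConv (H ⊗[k] H →ₗ[k] H) := WithConv.toConv (LinearMap.mul' k H)
  let N : WithConv (H ⊗[k] H →ₗ[k] H) := WithConv.toConv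
    (LinearMap.mul' k H ∘ₗ (TensorProduct.comm k H H).toLinearMap ∘ₗ TensorProduct.map S S)
  have conv : ∀ (F G : WithConv (H ⊗[k] H →ₗ[k] H)) (x y : H) (s t : Finset (H × H)),
      Δ x = ∑ i ∈ s, i.1 ⊗ₜ[k] i.2 → Δ y = ∑ i ∈ t, i.1 ⊗ₜ[k] i.2 →
      (F * G).ofConv (x ⊗ₜ y) =
        ∑ i ∈ s, ∑ j ∈ t, F.ofConv (i.1 ⊗ₜ j.1) * G.ofConv (i.2 ⊗ₜ j.2) := by
    intro F G x y s t hs ht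
    simp [LinearMap.convMul_def, TensorProduct.comul_tmul, hs, ht, sum_tmul, tmul_sum, map_sum]
    try rw [Finset.sum_comm]
  have hPM : P * M = WithConv.toConv (εs ∘ₗ LinearMap.mul' k H) := by
    ext x y
    obtain ⟨s, hs⟩ := exists_rep (Δ x)
    obtain ⟨t, ht⟩ := exists_rep (Δ y)
    refine (conv P M x y s t hs ht).trans ?_
    simp [P, M, ← antipode_mul, comul_mul, hs, ht, Finset.sum_mul, Finset.mul_sum, map_sum]
    try rw [Finset.sum_comm]
  have hMP : M * P = WithConv.toConv (εt ∘ₗ LinearMap.mul' k H) := by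
    ext x y
    obtain ⟨s, hs⟩ := exists_rep (Δ x)
    obtain ⟨t, ht⟩ := exists_rep (Δ y)
    refine (conv M P x y s t hs ht).trans ?_
    simp [P, M, ← mul_antipode, comul_mul, hs, ht, Finset.sum_mul, Finset.mul_sum, map_sum]
    try rw [Finset.sum_comm]
  have hMN : M * N = WithConv.toConv (εt ∘ₗ LinearMap.mul' k H) := by
    ext x y
    obtain ⟨s, hs⟩ := exists_rep (Δ x)
    obtain ⟨t, ht⟩ := exists_rep (Δ y)
    refine (conv M N x y s t hs ht).trans ?_
    simp [M, N, map_sum, Finset.mul_sum, Finset.sum_mul, mul_assoc, target_mul x y hs, ← mul_antipode, ht]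
  have hNM : N * M = WithConv.toConv (εs ∘ₗ LinearMap.mul' k H) := by
    ext x y
    obtain ⟨s, hs⟩ := exists_rep (Δ x)
    obtain ⟨t, ht⟩ := exists_rep (Δ y)
    refine (conv N M x y s t hs ht).trans ?_
    simp [M, N, map_sum, Finset.mul_sum, Finset.sum_mul, mul_assoc, source_mul x y ht,
      ← antipode_mul, hs]
    try rw [Finset.sum_comm]
  have hPMP : P * (M * P) = P := by
    rw [← mul_assoc, hPM]
    ext x y
    obtain ⟨s, hs⟩ := exists_rep (Δ x)
    obtain ⟨t, ht⟩ := exists_rep (Δ y)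
    refine (conv _ P x y s t hs ht).trans ?_
    have hxy : Δ (x * y) = ∑ i ∈ s, ∑ j ∈ t, (i.1 * j.1) ⊗ₜ[k] (i.2 * j.2) := by
      rw [comul_mul, hs, ht, Finset.sum_mul_sum]; simp
    have := congrArg (fun f => f.ofConv (x * y)) (antipode_conv (k := k) (H := H))
    rw [← mul_assoc, antipode_conv_id] at this
    simpa [P, LinearMap.convMul_def, hxy, map_sum] using this
  have aux : ∀ (a y : H) (t : Finset (H × H)), Δ y = ∑ i ∈ t, i.1 ⊗ₜ[k] i.2 →
      ∑ j ∈ t, εs (a * j.1) * S j.2 = S y * εs a := by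
    intro a y t ht
    have h1 : WithConv.toConv (εs ∘ₗ LinearMap.mulLeft k a) =
        WithConv.toConv (LinearMap.mulRight k (εs a) ∘ₗ S) *
          WithConv.toConv (LinearMap.id : H →ₗ[k] H) := by
      ext z
      obtain ⟨r, hr⟩ := exists_rep (Δ z)
      simp [LinearMap.convMul_def, hr, map_sum, source_mul a z hr]
    have h2 := congrArg (fun f => (f * WithConv.toConv S).ofConv y) h1
    simp only [mul_assoc, id_conv_antipode] at h2
    simp [LinearMap.convMul_def, ht, map_sum] at h2
    rw [h2, antipode_rep_target ht, Finset.sum_mul]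
    simp only [mul_assoc, target_mul_source]
  have hNMN : N * M * N = N := by
    rw [hNM]
    ext x y
    obtain ⟨s, hs⟩ := exists_rep (Δ x)
    obtain ⟨t, ht⟩ := exists_rep (Δ y)
    refine (conv _ N x y s t hs ht).trans ?_
    have e : ∀ i ∈ s, ∑ j ∈ t, εs (i.1 * j.1) * (S j.2 * S i.2) =
        S y * (εs i.1 * S i.2) := by
      intro i _
      simp only [← mul_assoc, ← Finset.sum_mul, aux i.1 y t ht]
    simp only [N, LinearMap.comp_apply, LinearMap.mul'_apply, TensorProduct.map_tmul,
      LinearEquiv.coe_coe, TensorProduct.comm_tmul, AlgebraTensorModule.curry_apply, curry_apply,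
      LinearMap.coe_restrictScalars]
    rw [Finset.sum_congr rfl e, ← Finset.mul_sum, ← antipode_rep_source hs]
  have : P = N := by
    rw [← hPMP, hMP, ← hMN, ← mul_assoc, hPM, ← hNM, hNMN]
  exact congrArg (fun f => f.ofConv (x ⊗ₜ y)) this

theorem antipode_source (x : H) : S (εs x) = εt (εs x) := by
  obtain ⟨s, hs⟩ := exists_rep (Δ 1)
  have h := (comul_source (k := k) x).1
  have h1 := congrArg (fun t => LinearMap.mul' k H ((S).lTensor H t)) h
  have h2 := congrArg (fun t => LinearMap.mul' k H ((S).lTensor H t)) hs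
  simp only [mul_antipode, target_one] at h1 h2
  rw [h1, hs]
  simp [map_sum, Finset.mul_sum, antipode_mul_rev] at h2 ⊢
  simp only [← mul_assoc, ← Finset.sum_mul, ← h2, one_mul]

theorem antipode_target (x : H) : S (εt x) = εs (εt x) := by
  obtain ⟨s, hs⟩ := exists_rep (Δ 1)
  have h := (comul_target (k := k) x).2
  have h1 := congrArg (fun t => LinearMap.mul' k H ((S).rTensor H t)) h
  have h2 := congrArg (fun t => LinearMap.mul' k H ((S).rTensor H t)) hs
  simp only [antipode_mul, source_one] at h1 h2
  rw [h1, hs]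
  simp [map_sum, Finset.sum_mul, antipode_mul_rev] at h2 ⊢
  simp only [mul_assoc, ← Finset.mul_sum, ← h2, mul_one]

section Regular
variable [IsRegular k H]

theorem antipode_antipode_target (x : H) : S (S (εt x)) = εt x := by
  simpa [source_one] using IsRegular.antipode_antipode (k := k) x 1

theorem antipode_antipode_source (x : H) : S (S (εs x)) = εs x := by
  simpa [target_one] using IsRegular.antipode_antipode (k := k) 1 x

theorem antipode_target_eq_sbar (x : H) : S (εt x) = sbar (k := k) x := by
  have h1 : S (sbar (k := k) x) = εt x := by
    rw [← sbar_mem, antipode_source, sbar_mem, target_sbar]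
  rw [← h1, ← sbar_mem, antipode_antipode_source]

/-- `y 1₍₁₎ ⊗ 1₍₂₎ = 1₍₁₎ ⊗ S(y) 1₍₂₎` for `y ∈ H_s` -/
theorem source_mul_comul_one (x : H) :
    (εs x ⊗ₜ[k] 1) * Δ 1 = (1 ⊗ₜ[k] S (εs x)) * Δ 1 := by
  obtain ⟨s, hs⟩ := exists_rep (Δ 1)
  obtain ⟨z, hz⟩ : ∃ z, z = S (εs x) := ⟨_, rfl⟩
  have hz2 : εt z = z := by rw [hz, antipode_source, target_target]
  have hz1 : εs z = εs x := by
    rw [← hz2, ← antipode_target, hz2, hz, antipode_antipode_source]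
  rw [← hz1, hz1, ← hz, ← rTensor_source_comul]
  have h1 := (slot_two hs (ε ∘ₗ LinearMap.mulLeft k z)).1
  have h2 := (slot_two hs (ε ∘ₗ LinearMap.mulLeft k z)).2.1
  rw [h2] at h1
  have h3 := (slot_two hs (ε ∘ₗ LinearMap.mulLeft k z)).2.1
  simp only [comul_counit_source, hz1] at h3
  have h4 : (εs).rTensor H (Δ z) = (εs).rTensor H ((z ⊗ₜ[k] 1) * Δ 1) := by
    conv_lhs => rw [← hz2, (comul_target z).1, hz2]
  rw [h4, hs, Finset.mul_sum, Finset.mul_sum]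
  simp only [Algebra.TensorProduct.tmul_mul_tmul, one_mul]
  rw [h3]
  simp [map_sum, sourceCounit_rep hs, sum_tmul, smul_tmul', mul_assoc]
  rw [Finset.sum_comm]

end Regular

end Lemmas
end WeakHopfAlgebra

namespace WeakHopfAlgebra

section Truncated
variable (k H : Type u) [Field k] [Ring H] [Algebra k H]

/-- The `k`-linear map `H → End_k(M)` given by the action of `H` on a module `M`. -/
noncomputable abbrev actionMap (M : Type u) [AddCommGroup M] [Module k M] [Module H M]
    [IsScalarTower k H M] : H →ₗ[k] Module.End k M :=
  (Algebra.lsmul k k M).toLinearMap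

variable {k H}

/-- For linear maps `φ : H → End(M)` and `ψ : H → End(N)`, the induced map
`H ⊗ H → End(M ⊗ N)`, `x ⊗ y ↦ φ(x) ⊗ ψ(y)`. -/
noncomputable def act₂ {M N : Type u} [AddCommGroup M] [Module k M] [AddCommGroup N] [Module k N]
    (φ : H →ₗ[k] Module.End k M) (ψ : H →ₗ[k] Module.End k N) :
    H ⊗[k] H →ₗ[k] Module.End k (M ⊗[k] N) :=
  TensorProduct.homTensorHomMap (RingHom.id k) M N M N ∘ₗ TensorProduct.map φ ψ

section act
variable {M N P Q : Type u} [AddCommGroup M] [Module k M] [AddCommGroup N] [Module k N]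
  [AddCommGroup P] [Module k P] [AddCommGroup Q] [Module k Q]

@[simp]
theorem act₂_tmul (φ : H →ₗ[k] Module.End k M) (ψ : H →ₗ[k] Module.End k N) (x y : H)
    (m : M) (n : N) : act₂ φ ψ (x ⊗ₜ y) (m ⊗ₜ n) = φ x m ⊗ₜ ψ y n := by
  simp [act₂]

theorem act₂_tmul' (φ : H →ₗ[k] Module.End k M) (ψ : H →ₗ[k] Module.End k N) (x y : H) :
    act₂ φ ψ (x ⊗ₜ y) = TensorProduct.map (φ x) (ψ y) := by
  ext; simp

theorem act₂_mul (φ : H →ₗ[k] Module.End k M) (ψ : H →ₗ[k] Module.End k N)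
    (hφ : ∀ x y, φ (x * y) = φ x * φ y) (hψ : ∀ x y, ψ (x * y) = ψ x * ψ y) (x y : H ⊗[k] H) :
    act₂ φ ψ (x * y) = act₂ φ ψ x * act₂ φ ψ y := by
  induction x using TensorProduct.induction_on with
  | zero => simp
  | add a b ha hb => simp [add_mul, ha, hb]
  | tmul a b =>
    induction y using TensorProduct.induction_on with
    | zero => simp
    | add a b ha hb => simp [mul_add, ha, hb]
    | tmul c d =>
      ext m n
      simp [hφ, hψ]

theorem map_act₂ (φ : H →ₗ[k] Module.End k M) (ψ : H →ₗ[k] Module.End k N)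
    (φ' : H →ₗ[k] Module.End k P) (ψ' : H →ₗ[k] Module.End k Q) (f : M →ₗ[k] P) (g : N →ₗ[k] Q)
    (hf : ∀ x m, f (φ x m) = φ' x (f m)) (hg : ∀ x m, g (ψ x m) = ψ' x (g m))
    (x : H ⊗[k] H) (w : M ⊗[k] N) :
    TensorProduct.map f g (act₂ φ ψ x w) = act₂ φ' ψ' x (TensorProduct.map f g w) := by
  induction x using TensorProduct.induction_on with
  | zero => simp
  | add a b ha hb => simp [ha, hb]
  | tmul a b =>
    induction w using TensorProduct.induction_on with
    | zero => simp
    | add a b ha hb => simp only [map_add, ha, hb]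
    | tmul c d => simp [hf, hg]

end act

variable [Coalgebra k H]

variable (k H) in
/-- The diagonal action `h ↦ h₍₁₎ ⊗ h₍₂₎` of `H` on `M ⊗_k N` (in general not unital). -/
noncomputable def diagAction (M N : Type u) [AddCommGroup M] [Module k M] [Module H M]
    [IsScalarTower k H M] [AddCommGroup N] [Module k N] [Module H N] [IsScalarTower k H N] :
    H →ₗ[k] Module.End k (M ⊗[k] N) :=
  act₂ (actionMap k H M) (actionMap k H N) ∘ₗ comul (R := k) (A := H)

variable (k H) in
/-- The truncated tensor product `M ⊗_t N = Δ(1)(M ⊗_k N) ⊆ M ⊗_k N`. -/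
def TTensor (M N : Type u) [AddCommGroup M] [Module k M] [Module H M]
    [IsScalarTower k H M] [AddCommGroup N] [Module k N] [Module H N] [IsScalarTower k H N] :
    Type u :=
  LinearMap.range (diagAction k H M N 1)

section TTensor
variable {M N P Q : Type u}
  [AddCommGroup M] [Module k M] [Module H M] [IsScalarTower k H M]
  [AddCommGroup N] [Module k N] [Module H N] [IsScalarTower k H N]
  [AddCommGroup P] [Module k P] [Module H P] [IsScalarTower k H P]
  [AddCommGroup Q] [Module k Q] [Module H Q] [IsScalarTower k H Q]

noncomputable instance : AddCommGroup (TTensor k H M N) :=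
  inferInstanceAs (AddCommGroup (LinearMap.range (diagAction k H M N 1)))
noncomputable instance : Module k (TTensor k H M N) :=
  inferInstanceAs (Module k (LinearMap.range (diagAction k H M N 1)))

instance [FiniteDimensional k M] [FiniteDimensional k N] :
    FiniteDimensional k (TTensor k H M N) :=
  inferInstanceAs (FiniteDimensional k (LinearMap.range (diagAction k H M N 1)))

variable (k H M N) in
/-- The inclusion `M ⊗_t N ⊆ M ⊗_k N`. -/
noncomputable def TTensor.incl : TTensor k H M N →ₗ[k] M ⊗[k] N :=
  (LinearMap.range (diagAction k H M N 1)).subtype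

variable (k H M N) in
/-- The projection `M ⊗_k N → M ⊗_t N`, `m ⊗ n ↦ 1₍₁₎ m ⊗ 1₍₂₎ n`. -/
noncomputable def TTensor.proj : M ⊗[k] N →ₗ[k] TTensor k H M N :=
  (diagAction k H M N 1).rangeRestrict

theorem TTensor.incl_injective : Function.Injective (TTensor.incl k H M N) :=
  Subtype.val_injective

@[simp]
theorem TTensor.incl_proj (w : M ⊗[k] N) :
    TTensor.incl k H M N (TTensor.proj k H M N w) = diagAction k H M N 1 w := rfl

theorem TTensor.proj_surjective : Function.Surjective (TTensor.proj k H M N) :=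
  LinearMap.surjective_rangeRestrict _

variable (k H) in
/-- The element `1₍₁₎ m ⊗ 1₍₂₎ n` of `M ⊗_t N`. -/
noncomputable def ttmul (m : M) (n : N) : TTensor k H M N := TTensor.proj k H M N (m ⊗ₜ n)

theorem TTensor.proj_tmul (m : M) (n : N) :
    TTensor.proj k H M N (m ⊗ₜ n) = ttmul k H m n := rfl

theorem TTensor.hom_ext {V : Type*} [AddCommGroup V] [Module k V] {f g : TTensor k H M N →ₗ[k] V}
    (h : ∀ m n, f (ttmul k H m n) = g (ttmul k H m n)) : f = g := by
  have : f ∘ₗ TTensor.proj k H M N = g ∘ₗ TTensor.proj k H M N := TensorProduct.ext' h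
  ext w
  obtain ⟨v, rfl⟩ := TTensor.proj_surjective w
  exact LinearMap.congr_fun this v

variable [WeakHopfAlgebra k H]

theorem diagAction_mul (x y : H) :
    diagAction k H M N (x * y) = diagAction k H M N x * diagAction k H M N y := by
  simp only [diagAction, LinearMap.comp_apply, comul_mul]
  exact act₂_mul _ _ (fun x y => by simp) (fun x y => by simp) _ _

theorem diagAction_mul_apply (x y : H) (w : M ⊗[k] N) :
    diagAction k H M N x (diagAction k H M N y w) = diagAction k H M N (x * y) w := by
  rw [diagAction_mul]; rfl

@[simp]
theorem TTensor.diag_one_incl (w : TTensor k H M N) :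
    diagAction k H M N 1 (TTensor.incl k H M N w) = TTensor.incl k H M N w := by
  obtain ⟨v, rfl⟩ := TTensor.proj_surjective w
  rw [TTensor.incl_proj, diagAction_mul_apply, one_mul]

@[simp]
theorem TTensor.proj_incl (w : TTensor k H M N) :
    TTensor.proj k H M N (TTensor.incl k H M N w) = w := by
  apply TTensor.incl_injective
  simp

/-- `h · (1₍₁₎ m ⊗ 1₍₂₎ n) = h₍₁₎ m ⊗ h₍₂₎ n`. -/
noncomputable instance : Module H (TTensor k H M N) where
  smul h w := TTensor.proj k H M N (diagAction k H M N h (TTensor.incl k H M N w))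
  one_smul w := by
    change TTensor.proj k H M N _ = w
    simp
  mul_smul x y w := by
    change TTensor.proj k H M N _ = TTensor.proj k H M N (diagAction k H M N x
      (TTensor.incl k H M N (TTensor.proj k H M N _)))
    rw [TTensor.incl_proj, diagAction_mul_apply, diagAction_mul_apply]
    simp
  smul_zero x := by
    change TTensor.proj k H M N _ = _
    simp
  smul_add x v w := by
    change TTensor.proj k H M N _ = TTensor.proj k H M N _ + TTensor.proj k H M N _
    simp
  add_smul x y w := by
    change TTensor.proj k H M N _ = TTensor.proj k H M N _ + TTensor.proj k H M N _
    simp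
  zero_smul w := by
    change TTensor.proj k H M N _ = _
    simp

theorem TTensor.smul_def (h : H) (w : TTensor k H M N) :
    h • w = TTensor.proj k H M N (diagAction k H M N h (TTensor.incl k H M N w)) := rfl

@[simp]
theorem TTensor.incl_smul (h : H) (w : TTensor k H M N) :
    TTensor.incl k H M N (h • w) = diagAction k H M N h (TTensor.incl k H M N w) := by
  rw [TTensor.smul_def, TTensor.incl_proj, diagAction_mul_apply, one_mul]

theorem TTensor.smul_proj (h : H) (w : M ⊗[k] N) :
    h • TTensor.proj k H M N w = TTensor.proj k H M N (diagAction k H M N h w) := by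
  apply TTensor.incl_injective
  rw [TTensor.incl_smul, TTensor.incl_proj, TTensor.incl_proj, diagAction_mul_apply,
    diagAction_mul_apply, one_mul, mul_one]

instance : IsScalarTower k H (TTensor k H M N) where
  smul_assoc c h w := by
    apply TTensor.incl_injective
    simp

/-- A `k`-linear map out of `M ⊗_t N` is `H`-linear as soon as it is so on `1₍₁₎ m ⊗ 1₍₂₎ n`. -/
noncomputable def TTensor.homMk (f : TTensor k H M N →ₗ[k] P)
    (hf : ∀ (h : H) (m : M) (n : N), f (h • ttmul k H m n) = h • f (ttmul k H m n)) :
    TTensor k H M N →ₗ[H] P where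
  toFun := f
  map_add' := f.map_add
  map_smul' h w := by
    have : f ∘ₗ (actionMap k H _ h) = (actionMap k H _ h) ∘ₗ f := TTensor.hom_ext (hf h)
    exact LinearMap.congr_fun this w

/-- The map `f ⊗_t g` induced by two `H`-linear maps. -/
noncomputable def TTensor.mapₖ (f : M →ₗ[H] P) (g : N →ₗ[H] Q) :
    TTensor k H M N →ₗ[k] TTensor k H P Q :=
  TTensor.proj k H P Q ∘ₗ
    TensorProduct.map (f.restrictScalars k) (g.restrictScalars k) ∘ₗ TTensor.incl k H M N

theorem map_diagAction (f : M →ₗ[H] P) (g : N →ₗ[H] Q) (h : H) (w : M ⊗[k] N) :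
    TensorProduct.map (f.restrictScalars k) (g.restrictScalars k) (diagAction k H M N h w) =
      diagAction k H P Q h (TensorProduct.map (f.restrictScalars k) (g.restrictScalars k) w) :=
  map_act₂ _ _ _ _ _ _ (fun x m => by simp) (fun x m => by simp) _ _

theorem TTensor.incl_mapₖ (f : M →ₗ[H] P) (g : N →ₗ[H] Q) (w : TTensor k H M N) :
    TTensor.incl k H P Q (TTensor.mapₖ f g w) =
      TensorProduct.map (f.restrictScalars k) (g.restrictScalars k) (TTensor.incl k H M N w) := by
  rw [TTensor.mapₖ, LinearMap.comp_apply, LinearMap.comp_apply, TTensor.incl_proj,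
    ← map_diagAction, TTensor.diag_one_incl]

/-- The map `f ⊗_t g` induced by two `H`-linear maps. -/
noncomputable def TTensor.map (f : M →ₗ[H] P) (g : N →ₗ[H] Q) :
    TTensor k H M N →ₗ[H] TTensor k H P Q where
  toFun := TTensor.mapₖ f g
  map_add' := map_add _
  map_smul' h w := by
    apply TTensor.incl_injective
    rw [RingHom.id_apply, TTensor.incl_smul, TTensor.incl_mapₖ, TTensor.incl_mapₖ,
      TTensor.incl_smul, map_diagAction]

theorem TTensor.incl_map (f : M →ₗ[H] P) (g : N →ₗ[H] Q) (w : TTensor k H M N) :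
    TTensor.incl k H P Q (TTensor.map f g w) =
      TensorProduct.map (f.restrictScalars k) (g.restrictScalars k) (TTensor.incl k H M N w) :=
  TTensor.incl_mapₖ f g w

@[simp]
theorem TTensor.map_ttmul (f : M →ₗ[H] P) (g : N →ₗ[H] Q) (m : M) (n : N) :
    TTensor.map f g (ttmul k H m n) = ttmul k H (f m) (g n) := by
  apply TTensor.incl_injective
  rw [TTensor.incl_map, ← TTensor.proj_tmul, ← TTensor.proj_tmul, TTensor.incl_proj,
    TTensor.incl_proj, map_diagAction]
  simp

section assoc
variable (k H M N P)

/-- The associativity isomorphism, induced by `(M ⊗ N) ⊗ P ≅ M ⊗ (N ⊗ P)`. -/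
noncomputable def assocHomₖ :
    TTensor k H (TTensor k H M N) P →ₗ[k] TTensor k H M (TTensor k H N P) :=
  TTensor.proj k H M (TTensor k H N P) ∘ₗ (TTensor.proj k H N P).lTensor M ∘ₗ
    (TensorProduct.assoc k M N P).toLinearMap ∘ₗ (TTensor.incl k H M N).rTensor P ∘ₗ
      TTensor.incl k H (TTensor k H M N) P

/-- The inverse associativity isomorphism. -/
noncomputable def assocInvₖ :
    TTensor k H M (TTensor k H N P) →ₗ[k] TTensor k H (TTensor k H M N) P :=
  TTensor.proj k H (TTensor k H M N) P ∘ₗ (TTensor.proj k H M N).rTensor P ∘ₗ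
    (TensorProduct.assoc k M N P).symm.toLinearMap ∘ₗ (TTensor.incl k H N P).lTensor M ∘ₗ
      TTensor.incl k H M (TTensor k H N P)

/-- The inclusion `M ⊗_t (N ⊗_t P) ⊆ M ⊗ (N ⊗ P)`. -/
noncomputable def inclRight : TTensor k H M (TTensor k H N P) →ₗ[k] M ⊗[k] (N ⊗[k] P) :=
  (TTensor.incl k H N P).lTensor M ∘ₗ TTensor.incl k H M (TTensor k H N P)

/-- The inclusion `(M ⊗_t N) ⊗_t P ⊆ (M ⊗ N) ⊗ P`. -/
noncomputable def inclLeft : TTensor k H (TTensor k H M N) P →ₗ[k] (M ⊗[k] N) ⊗[k] P :=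
  (TTensor.incl k H M N).rTensor P ∘ₗ TTensor.incl k H (TTensor k H M N) P

/-- The diagonal action on `M ⊗ (N ⊗ P)`. -/
noncomputable def diagRight : H →ₗ[k] Module.End k (M ⊗[k] (N ⊗[k] P)) :=
  act₂ (actionMap k H M) (diagAction k H N P) ∘ₗ comul (R := k) (A := H)

/-- The diagonal action on `(M ⊗ N) ⊗ P`. -/
noncomputable def diagLeft : H →ₗ[k] Module.End k ((M ⊗[k] N) ⊗[k] P) :=
  act₂ (diagAction k H M N) (actionMap k H P) ∘ₗ comul (R := k) (A := H)

variable {k H M N P}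

theorem assoc_diag (h : H) (w : (M ⊗[k] N) ⊗[k] P) :
    TensorProduct.assoc k M N P (diagLeft k H M N P h w) =
      diagRight k H M N P h (TensorProduct.assoc k M N P w) := by
  have key : ∀ (t : (H ⊗[k] H) ⊗[k] H) (w : (M ⊗[k] N) ⊗[k] P),
      TensorProduct.assoc k M N P
        (TensorProduct.homTensorHomMap (RingHom.id k) (M ⊗[k] N) P (M ⊗[k] N) P
          (TensorProduct.map (act₂ (actionMap k H M) (actionMap k H N)) (actionMap k H P) t) w) =
      TensorProduct.homTensorHomMap (RingHom.id k) M (N ⊗[k] P) M (N ⊗[k] P)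
          (TensorProduct.map (actionMap k H M) (act₂ (actionMap k H N) (actionMap k H P))
            (TensorProduct.assoc k H H H t)) (TensorProduct.assoc k M N P w) := by
    intro t w
    induction t using TensorProduct.induction_on with
    | zero => simp
    | add a b ha hb => simp only [map_add, LinearMap.add_apply, ha, hb]
    | tmul a c =>
      induction a using TensorProduct.induction_on with
      | zero => simp
      | add a b ha hb => simp only [map_add, add_tmul, LinearMap.add_apply, ha, hb]
      | tmul a b =>
        induction w using TensorProduct.induction_on with
        | zero => simp
        | add a b ha hb => simp only [map_add, ha, hb]
        | tmul v p =>
          induction v using TensorProduct.induction_on with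
          | zero => simp
          | add a b ha hb => simp only [map_add, add_tmul, ha, hb]
          | tmul m n => simp
  have h1 := key ((comul (R := k) (A := H)).rTensor H (comul (R := k) h)) w
  rw [coassoc_apply] at h1
  have e1 : ∀ t : H ⊗[k] H,
      TensorProduct.map (act₂ (actionMap k H M) (actionMap k H N)) (actionMap k H P)
        ((comul (R := k) (A := H)).rTensor H t) =
      TensorProduct.map (diagAction k H M N) (actionMap k H P) t := by
    intro t
    rw [LinearMap.rTensor, ← LinearMap.comp_apply, ← TensorProduct.map_comp]; rfl
  have e2 : ∀ t : H ⊗[k] H,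
      TensorProduct.map (actionMap k H M) (act₂ (actionMap k H N) (actionMap k H P))
        ((comul (R := k) (A := H)).lTensor H t) =
      TensorProduct.map (actionMap k H M) (diagAction k H N P) t := by
    intro t
    rw [LinearMap.lTensor, ← LinearMap.comp_apply, ← TensorProduct.map_comp]; rfl
  rw [e1, e2] at h1
  exact h1

theorem inclRight_injective : Function.Injective (inclRight k H M N P) := by
  have h : (TTensor.proj k H N P).lTensor M ∘ₗ (TTensor.incl k H N P).lTensor M =
      LinearMap.id := by
    rw [← LinearMap.lTensor_comp]
    have : TTensor.proj k H N P ∘ₗ TTensor.incl k H N P = LinearMap.id := by ext; simp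
    rw [this, LinearMap.lTensor_id]
  refine Function.Injective.comp (g := ⇑((TTensor.incl k H N P).lTensor M)) ?_ TTensor.incl_injective
  exact Function.LeftInverse.injective (LinearMap.congr_fun h)

theorem inclLeft_injective : Function.Injective (inclLeft k H M N P) := by
  have h : (TTensor.proj k H M N).rTensor P ∘ₗ (TTensor.incl k H M N).rTensor P =
      LinearMap.id := by
    rw [← LinearMap.rTensor_comp]
    have : TTensor.proj k H M N ∘ₗ TTensor.incl k H M N = LinearMap.id := by ext; simp
    rw [this, LinearMap.rTensor_id]
  refine Function.Injective.comp (g := ⇑((TTensor.incl k H M N).rTensor P)) ?_ TTensor.incl_injective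
  exact Function.LeftInverse.injective (LinearMap.congr_fun h)

theorem inclRight_smul (h : H) (w : TTensor k H M (TTensor k H N P)) :
    inclRight k H M N P (h • w) = diagRight k H M N P h (inclRight k H M N P w) := by
  rw [inclRight, LinearMap.comp_apply, TTensor.incl_smul]
  exact map_act₂ (actionMap k H M) (actionMap k H (TTensor k H N P)) (actionMap k H M)
    (diagAction k H N P) LinearMap.id (TTensor.incl k H N P) (fun x m => rfl)
    (fun x m => by simp) _ _

theorem inclLeft_smul (h : H) (w : TTensor k H (TTensor k H M N) P) :
    inclLeft k H M N P (h • w) = diagLeft k H M N P h (inclLeft k H M N P w) := by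
  rw [inclLeft, LinearMap.comp_apply, TTensor.incl_smul]
  exact map_act₂ (actionMap k H (TTensor k H M N)) (actionMap k H P) (diagAction k H M N)
    (actionMap k H P) (TTensor.incl k H M N) LinearMap.id (fun x m => by simp)
    (fun x m => rfl) _ _

theorem inclRight_proj (w : M ⊗[k] (N ⊗[k] P)) :
    inclRight k H M N P (TTensor.proj k H M (TTensor k H N P)
      ((TTensor.proj k H N P).lTensor M w)) = diagRight k H M N P 1 w := by
  rw [inclRight, LinearMap.comp_apply, TTensor.incl_proj]
  refine (map_act₂ (actionMap k H M) (actionMap k H (TTensor k H N P)) (actionMap k H M)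
    (diagAction k H N P) LinearMap.id (TTensor.incl k H N P) (fun x m => rfl)
    (fun x m => by simp) _ _).trans ?_
  have h1 : TensorProduct.map LinearMap.id (TTensor.incl k H N P)
      ((TTensor.proj k H N P).lTensor M w) =
      act₂ (actionMap k H M) (diagAction k H N P) (1 ⊗ₜ 1) w := by
    induction w using TensorProduct.induction_on with
    | zero => simp
    | add a b ha hb => simp only [map_add, ha, hb]
    | tmul a b => simp
  rw [h1, ← Module.End.mul_apply, ← act₂_mul _ _ (fun x y => by simp)
    (fun x y => diagAction_mul x y), ← Algebra.TensorProduct.one_def, mul_one]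
  rfl

theorem inclLeft_proj (w : (M ⊗[k] N) ⊗[k] P) :
    inclLeft k H M N P (TTensor.proj k H (TTensor k H M N) P
      ((TTensor.proj k H M N).rTensor P w)) = diagLeft k H M N P 1 w := by
  rw [inclLeft, LinearMap.comp_apply, TTensor.incl_proj]
  refine (map_act₂ (actionMap k H (TTensor k H M N)) (actionMap k H P) (diagAction k H M N)
    (actionMap k H P) (TTensor.incl k H M N) LinearMap.id (fun x m => by simp)
    (fun x m => rfl) _ _).trans ?_
  have h1 : TensorProduct.map (TTensor.incl k H M N) LinearMap.id
      ((TTensor.proj k H M N).rTensor P w) =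
      act₂ (diagAction k H M N) (actionMap k H P) (1 ⊗ₜ 1) w := by
    induction w using TensorProduct.induction_on with
    | zero => simp
    | add a b ha hb => simp only [map_add, ha, hb]
    | tmul a b => simp
  rw [h1, ← Module.End.mul_apply, ← act₂_mul _ _ (fun x y => diagAction_mul x y)
    (fun x y => by simp), ← Algebra.TensorProduct.one_def, mul_one]
  rfl

theorem inclRight_assocHom (w : TTensor k H (TTensor k H M N) P) :
    inclRight k H M N P (assocHomₖ k H M N P w) =
      TensorProduct.assoc k M N P (inclLeft k H M N P w) := by
  have h1 : assocHomₖ k H M N P w = TTensor.proj k H M (TTensor k H N P)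
      ((TTensor.proj k H N P).lTensor M
        (TensorProduct.assoc k M N P (inclLeft k H M N P w))) := rfl
  rw [h1, inclRight_proj, ← assoc_diag, ← inclLeft_smul, one_smul]

theorem inclLeft_assocInv (w : TTensor k H M (TTensor k H N P)) :
    inclLeft k H M N P (assocInvₖ k H M N P w) =
      (TensorProduct.assoc k M N P).symm (inclRight k H M N P w) := by
  have h1 : assocInvₖ k H M N P w = TTensor.proj k H (TTensor k H M N) P
      ((TTensor.proj k H M N).rTensor P
        ((TensorProduct.assoc k M N P).symm (inclRight k H M N P w))) := rfl
  apply (TensorProduct.assoc k M N P).injective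
  rw [h1, inclLeft_proj, assoc_diag, LinearEquiv.apply_symm_apply, ← inclRight_smul, one_smul]

variable (k H M N P) in
/-- The associativity isomorphism `(M ⊗_t N) ⊗_t P ≅ M ⊗_t (N ⊗_t P)` induced by
`(M ⊗ N) ⊗ P ≅ M ⊗ (N ⊗ P)`. -/
noncomputable def assocEquiv :
    TTensor k H (TTensor k H M N) P ≃ₗ[H] TTensor k H M (TTensor k H N P) where
  toFun := assocHomₖ k H M N P
  invFun := assocInvₖ k H M N P
  map_add' := map_add _
  map_smul' h w := by
    apply inclRight_injective
    rw [RingHom.id_apply, inclRight_smul, inclRight_assocHom, inclRight_assocHom, inclLeft_smul,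
      assoc_diag]
  left_inv w := by
    apply inclLeft_injective
    rw [inclLeft_assocInv, inclRight_assocHom, LinearEquiv.symm_apply_apply]
  right_inv w := by
    apply inclRight_injective
    rw [inclRight_assocHom, inclLeft_assocInv, LinearEquiv.apply_symm_apply]

@[simp]
theorem assocEquiv_ttmul (m : M) (n : N) (p : P) :
    assocEquiv k H M N P (ttmul k H (ttmul k H m n) p) = ttmul k H m (ttmul k H n p) := by
  apply inclRight_injective
  have h1 : inclLeft k H M N P (ttmul k H (ttmul k H m n) p) =
      diagLeft k H M N P 1 ((m ⊗ₜ n) ⊗ₜ p) := by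
    rw [← inclLeft_proj]; rfl
  have h2 : inclRight k H M N P (ttmul k H m (ttmul k H n p)) =
      diagRight k H M N P 1 (m ⊗ₜ (n ⊗ₜ p)) := by
    rw [← inclRight_proj]; rfl
  refine (inclRight_assocHom _).trans ?_
  rw [h1, h2, assoc_diag, TensorProduct.assoc_tmul]

end assoc

end TTensor
end Truncated
end WeakHopfAlgebra

namespace WeakHopfAlgebra

section Bilinear
variable {k H : Type u} [Field k] [Ring H] [Algebra k H] [Coalgebra k H] [WeakHopfAlgebra k H]
variable {M N P Q : Type u}
  [AddCommGroup M] [Module k M] [Module H M] [IsScalarTower k H M]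
  [AddCommGroup N] [Module k N] [Module H N] [IsScalarTower k H N]
  [AddCommGroup P] [Module k P] [Module H P] [IsScalarTower k H P]
  [AddCommGroup Q] [Module k Q] [Module H Q] [IsScalarTower k H Q]

variable (k H M N) in
/-- `(m, n) ↦ 1₍₁₎ m ⊗ 1₍₂₎ n` as a bilinear map. -/
noncomputable def ttmulₗ : M →ₗ[k] N →ₗ[k] TTensor k H M N :=
  (TensorProduct.mk k M N).compr₂ (TTensor.proj k H M N)

@[simp]
theorem ttmulₗ_apply (m : M) (n : N) : ttmulₗ k H M N m n = ttmul k H m n := rfl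

/-- The map `x ⊗ y ↦ x m ⊗ y n`. -/
noncomputable def orbit₂ (m : M) (n : N) : H ⊗[k] H →ₗ[k] M ⊗[k] N :=
  TensorProduct.map ((actionMap k H M).flip m) ((actionMap k H N).flip n)

@[simp]
theorem orbit₂_tmul (m : M) (n : N) (x y : H) :
    orbit₂ (k := k) m n (x ⊗ₜ y) = (x • m) ⊗ₜ (y • n) := rfl

theorem act₂_eq_orbit (m : M) (n : N) (t : H ⊗[k] H) :
    act₂ (actionMap k H M) (actionMap k H N) t (m ⊗ₜ n) = orbit₂ (k := k) m n t := by
  induction t using TensorProduct.induction_on with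
  | zero => simp
  | add a b ha hb => simp [ha, hb]
  | tmul a b => simp

theorem diagAction_tmul (h : H) (m : M) (n : N) :
    diagAction k H M N h (m ⊗ₜ n) = orbit₂ (k := k) m n (comul h) :=
  act₂_eq_orbit _ _ _

theorem smul_ttmul_rep {h : H} {t : Finset (H × H)}
    (ht : comul (R := k) h = ∑ i ∈ t, i.1 ⊗ₜ[k] i.2) (m : M) (n : N) :
    h • ttmul k H m n = ∑ i ∈ t, ttmul k H (i.1 • m) (i.2 • n) := by
  rw [← TTensor.proj_tmul, TTensor.smul_proj, diagAction_tmul, ht]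
  simp [map_sum, TTensor.proj_tmul]

theorem TTensor.hom_ext₃ {V : Type u} [AddCommGroup V] [Module k V]
    {f g : TTensor k H (TTensor k H M N) P →ₗ[k] V}
    (h : ∀ m n p, f (ttmul k H (ttmul k H m n) p) = g (ttmul k H (ttmul k H m n) p)) : f = g := by
  refine TTensor.hom_ext fun w p => ?_
  have : f ∘ₗ (ttmulₗ k H (TTensor k H M N) P).flip p =
      g ∘ₗ (ttmulₗ k H (TTensor k H M N) P).flip p :=
    TTensor.hom_ext fun m n => h m n p
  exact LinearMap.congr_fun this w

theorem TTensor.hom_ext₃' {V : Type u} [AddCommGroup V] [Module k V]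
    {f g : TTensor k H M (TTensor k H N P) →ₗ[k] V}
    (h : ∀ m n p, f (ttmul k H m (ttmul k H n p)) = g (ttmul k H m (ttmul k H n p))) : f = g := by
  refine TTensor.hom_ext fun m w => ?_
  have : f ∘ₗ (ttmulₗ k H M (TTensor k H N P)) m =
      g ∘ₗ (ttmulₗ k H M (TTensor k H N P)) m :=
    TTensor.hom_ext fun n p => h m n p
  exact LinearMap.congr_fun this w

theorem TTensor.hom_ext₄ {V : Type u} [AddCommGroup V] [Module k V]
    {f g : TTensor k H (TTensor k H (TTensor k H M N) P) Q →ₗ[k] V}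
    (h : ∀ m n p q, f (ttmul k H (ttmul k H (ttmul k H m n) p) q) =
      g (ttmul k H (ttmul k H (ttmul k H m n) p) q)) : f = g := by
  refine TTensor.hom_ext fun w q => ?_
  have : f ∘ₗ (ttmulₗ k H (TTensor k H (TTensor k H M N) P) Q).flip q =
      g ∘ₗ (ttmulₗ k H (TTensor k H (TTensor k H M N) P) Q).flip q :=
    TTensor.hom_ext₃ fun m n p => h m n p q
  exact LinearMap.congr_fun this w

end Bilinear

section Unit
variable (k H : Type u) [Field k] [Ring H] [Algebra k H] [Coalgebra k H]

/-- The target subalgebra `H_t = ε_t(H)`, as a `k`-vector space. -/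
def TargetSpace : Type u := LinearMap.range (targetCounit k H)

noncomputable instance : AddCommGroup (TargetSpace k H) :=
  inferInstanceAs (AddCommGroup (LinearMap.range (targetCounit k H)))
noncomputable instance : Module k (TargetSpace k H) :=
  inferInstanceAs (Module k (LinearMap.range (targetCounit k H)))

instance [FiniteDimensional k H] : FiniteDimensional k (TargetSpace k H) :=
  inferInstanceAs (FiniteDimensional k (LinearMap.range (targetCounit k H)))

/-- The inclusion `H_t ⊆ H`. -/
noncomputable def TargetSpace.val : TargetSpace k H →ₗ[k] H :=
  (LinearMap.range (targetCounit k H)).subtype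

/-- `ε_t` as a map `H → H_t`. -/
noncomputable def TargetSpace.mk : H →ₗ[k] TargetSpace k H :=
  (targetCounit k H).rangeRestrict

variable {k H}

theorem TargetSpace.val_injective : Function.Injective (TargetSpace.val k H) :=
  Subtype.val_injective

@[simp]
theorem TargetSpace.val_mk (x : H) :
    TargetSpace.val k H (TargetSpace.mk k H x) = targetCounit k H x := rfl

variable [WeakHopfAlgebra k H]

@[simp]
theorem TargetSpace.target_val (z : TargetSpace k H) :
    targetCounit k H (TargetSpace.val k H z) = TargetSpace.val k H z := by
  obtain ⟨_, x, rfl⟩ := z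
  exact target_target x

@[simp]
theorem TargetSpace.mk_val (z : TargetSpace k H) :
    TargetSpace.mk k H (TargetSpace.val k H z) = z :=
  TargetSpace.val_injective (by simp)

theorem TargetSpace.mk_target (x : H) :
    TargetSpace.mk k H (targetCounit k H x) = TargetSpace.mk k H x :=
  TargetSpace.val_injective (by simp [target_target])

/-- The action of `H` on `H_t`, `h · z = ε_t(h z)`. -/
noncomputable instance : Module H (TargetSpace k H) where
  smul h z := TargetSpace.mk k H (h * TargetSpace.val k H z)
  one_smul z := by
    change TargetSpace.mk k H _ = z
    simp
  mul_smul x y z := by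
    change TargetSpace.mk k H _ = TargetSpace.mk k H (x * TargetSpace.val k H
      (TargetSpace.mk k H _))
    apply TargetSpace.val_injective
    simp [target_mul_target, mul_assoc]
  smul_zero x := by
    change TargetSpace.mk k H _ = _
    simp
  smul_add x v w := by
    change TargetSpace.mk k H _ = TargetSpace.mk k H _ + TargetSpace.mk k H _
    simp [mul_add]
  add_smul x y w := by
    change TargetSpace.mk k H _ = TargetSpace.mk k H _ + TargetSpace.mk k H _
    simp [add_mul]
  zero_smul w := by
    change TargetSpace.mk k H _ = _
    simp

theorem TargetSpace.smul_def (h : H) (z : TargetSpace k H) :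
    h • z = TargetSpace.mk k H (h * TargetSpace.val k H z) := rfl

@[simp]
theorem TargetSpace.val_smul (h : H) (z : TargetSpace k H) :
    TargetSpace.val k H (h • z) = targetCounit k H (h * TargetSpace.val k H z) := rfl

instance : IsScalarTower k H (TargetSpace k H) where
  smul_assoc c h z := by
    apply TargetSpace.val_injective
    simp

theorem comul_mul_targetVal (h : H) (z : TargetSpace k H) :
    comul (R := k) h * (TargetSpace.val k H z ⊗ₜ 1) = comul (R := k) (h * TargetSpace.val k H z) := by
  rw [comul_mul, ← TargetSpace.target_val, (comul_target _).2, ← mul_assoc, comul_mul_one]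

/-- `ε_t(h₍₁₎) h₍₂₎ = h` -/
theorem target_mul_self (h : H) :
    LinearMap.mul' k H ((targetCounit k H).rTensor H (comul h)) = h := by
  obtain ⟨s, hs⟩ := exists_rep (comul (R := k) (1 : H))
  obtain ⟨t, ht⟩ := exists_rep (comul (R := k) h)
  have h3 := congrArg (TensorProduct.lid k H) (rTensor_counit_comul (R := k) h)
  rw [← one_mul_comul, hs, ht] at h3
  rw [ht]
  simp [Finset.sum_mul, Finset.mul_sum, map_sum, targetCounit_rep hs] at h3 ⊢
  exact h3

section Unitors
variable {M N : Type u} [AddCommGroup M] [Module k M] [Module H M] [IsScalarTower k H M]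
  [AddCommGroup N] [Module k N] [Module H N] [IsScalarTower k H N]

variable (k H M) in
/-- The map `z ⊗ m ↦ z m`. -/
noncomputable def unitLeft : TargetSpace k H ⊗[k] M →ₗ[k] M :=
  TensorProduct.lift (actionMap k H M ∘ₗ TargetSpace.val k H)

variable (k H M) in
/-- The map `m ⊗ z ↦ S(z) m`. -/
noncomputable def unitRight : M ⊗[k] TargetSpace k H →ₗ[k] M :=
  TensorProduct.lift (actionMap k H M ∘ₗ antipode (k := k) ∘ₗ TargetSpace.val k H).flip

@[simp]
theorem unitLeft_tmul (z : TargetSpace k H) (m : M) :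
    unitLeft k H M (z ⊗ₜ m) = TargetSpace.val k H z • m := rfl

@[simp]
theorem unitRight_tmul (z : TargetSpace k H) (m : M) :
    unitRight k H M (m ⊗ₜ z) = antipode (k := k) (TargetSpace.val k H z) • m := rfl

theorem unitLeft_diag (h : H) (z : TargetSpace k H) (m : M) :
    unitLeft k H M (diagAction k H _ _ h (z ⊗ₜ m)) = (h * TargetSpace.val k H z) • m := by
  conv_rhs => rw [← target_mul_self (k := k) (h * TargetSpace.val k H z),
    ← comul_mul_targetVal]
  obtain ⟨t, ht⟩ := exists_rep (comul (R := k) h)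
  rw [diagAction_tmul, ht]
  simp [map_sum, Finset.sum_mul, Finset.sum_smul, mul_smul]

theorem unitRight_diag [IsRegular k H] (h : H) (z : TargetSpace k H) (m : M) :
    unitRight k H M (diagAction k H _ _ h (m ⊗ₜ z)) =
      (h * antipode (k := k) (TargetSpace.val k H z)) • m := by
  have e := comul_counit_mulRight (k := k) h (TargetSpace.val k H z)
  conv_rhs => rw [← TargetSpace.target_val, antipode_target_eq_sbar, ← e]
  obtain ⟨s, hs⟩ := exists_rep (comul (R := k) (1 : H))
  obtain ⟨t, ht⟩ := exists_rep (comul (R := k) h)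
  conv_rhs => rw [← one_mul_comul]
  rw [diagAction_tmul, ht]
  simp only [map_sum, orbit₂_tmul, unitRight_tmul, TargetSpace.val_smul, antipode_target_eq_sbar,
    sbar_rep hs]
  simp [hs, map_sum, Finset.sum_mul, Finset.mul_sum, Finset.sum_smul, mul_smul, mul_assoc]
  try rw [Finset.sum_comm]

/-- `1₍₁₎ z ⊗ 1₍₂₎ m` only depends on `z m`. -/
theorem ttmul_target_left (z : TargetSpace k H) (m : M) :
    ttmul k H z m = ttmul k H (TargetSpace.mk k H 1) (TargetSpace.val k H z • m) := by
  apply TTensor.incl_injective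
  rw [← TTensor.proj_tmul, ← TTensor.proj_tmul, TTensor.incl_proj, TTensor.incl_proj]
  let T : H ⊗[k] H →ₗ[k] TargetSpace k H ⊗[k] M :=
    TensorProduct.map (TargetSpace.mk k H) ((actionMap k H M).flip m)
  have hT : ∀ t, T ((targetCounit k H).rTensor H t) = T t := by
    intro t
    induction t using TensorProduct.induction_on with
    | zero => simp
    | add a b ha hb => simp only [map_add, ha, hb]
    | tmul a b => simp [T, TargetSpace.mk_target]
  have h1 : diagAction k H _ _ 1 (z ⊗ₜ m) = T (comul (R := k) (TargetSpace.val k H z)) := by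
    have := comul_mul_targetVal (k := k) 1 z
    rw [one_mul] at this
    rw [← this, diagAction_tmul]
    obtain ⟨t, ht⟩ := exists_rep (comul (R := k) (1 : H))
    simp [ht, T, map_sum, Finset.sum_mul, TargetSpace.smul_def]
  have h2 : diagAction k H _ _ 1 (TargetSpace.mk k H 1 ⊗ₜ (TargetSpace.val k H z • m)) =
      T (comul (R := k) (1 : H) * (1 ⊗ₜ TargetSpace.val k H z)) := by
    rw [diagAction_tmul]
    obtain ⟨t, ht⟩ := exists_rep (comul (R := k) (1 : H))
    simp [ht, T, map_sum, Finset.sum_mul, TargetSpace.smul_def, target_one, mul_smul]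
  have h3 : (targetCounit k H).rTensor H (comul (R := k) (TargetSpace.val k H z)) =
      (targetCounit k H).rTensor H (comul (R := k) (1 : H) * (1 ⊗ₜ TargetSpace.val k H z)) := by
    rw [rTensor_target_comul]
    obtain ⟨t, ht⟩ := exists_rep (comul (R := k) (1 : H))
    rw [ht]
    simp [map_sum, Finset.sum_mul]
  rw [h1, h2, ← hT (comul (R := k) (TargetSpace.val k H z)), h3, hT]

theorem ttmul_target_right [IsRegular k H] (z : TargetSpace k H) (m : M) :
    ttmul k H m z =
      ttmul k H (antipode (k := k) (TargetSpace.val k H z) • m) (TargetSpace.mk k H 1) := by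
  apply TTensor.incl_injective
  rw [← TTensor.proj_tmul, ← TTensor.proj_tmul, TTensor.incl_proj, TTensor.incl_proj]
  let T : H ⊗[k] H →ₗ[k] M ⊗[k] TargetSpace k H :=
    TensorProduct.map ((actionMap k H M).flip m) (TargetSpace.mk k H)
  have h1 : diagAction k H _ _ 1 (m ⊗ₜ z) =
      T (comul (R := k) (1 : H) * (1 ⊗ₜ TargetSpace.val k H z)) := by
    rw [diagAction_tmul]
    obtain ⟨t, ht⟩ := exists_rep (comul (R := k) (1 : H))
    simp [ht, T, map_sum, Finset.sum_mul, TargetSpace.smul_def]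
  have h2 : diagAction k H _ _ 1
      ((antipode (k := k) (TargetSpace.val k H z) • m) ⊗ₜ TargetSpace.mk k H 1) =
      T (comul (R := k) (1 : H) * (antipode (k := k) (TargetSpace.val k H z) ⊗ₜ 1)) := by
    rw [diagAction_tmul]
    obtain ⟨t, ht⟩ := exists_rep (comul (R := k) (1 : H))
    simp [ht, T, map_sum, Finset.sum_mul, TargetSpace.smul_def, target_one, mul_smul]
  rw [h1, h2, ← TargetSpace.target_val, antipode_target_eq_sbar, comul_one_mul_target]

theorem ttmul_middle [IsRegular k H] (m : M) (z : TargetSpace k H) (n : N) :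
    ttmul k H m (TargetSpace.val k H z • n) =
      ttmul k H (antipode (k := k) (TargetSpace.val k H z) • m) n := by
  apply TTensor.incl_injective
  rw [← TTensor.proj_tmul, ← TTensor.proj_tmul, TTensor.incl_proj, TTensor.incl_proj]
  have h1 : diagAction k H _ _ 1 (m ⊗ₜ (TargetSpace.val k H z • n)) =
      orbit₂ m n (comul (R := k) (1 : H) * (1 ⊗ₜ TargetSpace.val k H z)) := by
    rw [diagAction_tmul]
    obtain ⟨t, ht⟩ := exists_rep (comul (R := k) (1 : H))
    simp [ht, map_sum, Finset.sum_mul, mul_smul]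
  have h2 : diagAction k H _ _ 1 ((antipode (k := k) (TargetSpace.val k H z) • m) ⊗ₜ n) =
      orbit₂ m n (comul (R := k) (1 : H) * (antipode (k := k) (TargetSpace.val k H z) ⊗ₜ 1)) := by
    rw [diagAction_tmul]
    obtain ⟨t, ht⟩ := exists_rep (comul (R := k) (1 : H))
    simp [ht, map_sum, Finset.sum_mul, mul_smul]
  rw [h1, h2, ← TargetSpace.target_val, antipode_target_eq_sbar, comul_one_mul_target]

variable (k H M)

/-- The left unit isomorphism `l(1₍₁₎ z ⊗ 1₍₂₎ m) = z m`. -/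
noncomputable def leftUnitEquiv : TTensor k H (TargetSpace k H) M ≃ₗ[H] M :=
  { TTensor.homMk (unitLeft k H M ∘ₗ TTensor.incl k H (TargetSpace k H) M) (by
      intro h z m
      rw [LinearMap.comp_apply, LinearMap.comp_apply, TTensor.incl_smul, ← TTensor.proj_tmul,
        TTensor.incl_proj, diagAction_mul_apply, unitLeft_diag, unitLeft_diag, mul_one, one_mul,
        mul_smul]) with
    invFun := fun m => ttmul k H (TargetSpace.mk k H 1) m
    left_inv := by
      intro w
      have : (ttmulₗ k H _ M (TargetSpace.mk k H 1)) ∘ₗ unitLeft k H M ∘ₗ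
          TTensor.incl k H (TargetSpace k H) M = LinearMap.id := by
        refine TTensor.hom_ext fun z m => ?_
        rw [LinearMap.comp_apply, LinearMap.comp_apply, ← TTensor.proj_tmul, TTensor.incl_proj,
          unitLeft_diag, one_mul, ttmulₗ_apply, ← ttmul_target_left]
        rfl
      exact LinearMap.congr_fun this w
    right_inv := by
      intro m
      change unitLeft k H M (TTensor.incl k H _ _ (TTensor.proj k H _ _ _)) = m
      rw [TTensor.incl_proj, unitLeft_diag]
      simp [target_one] }

/-- The right unit isomorphism `r(1₍₁₎ m ⊗ 1₍₂₎ z) = S(z) m`. -/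
noncomputable def rightUnitEquiv [IsRegular k H] : TTensor k H M (TargetSpace k H) ≃ₗ[H] M :=
  { TTensor.homMk (unitRight k H M ∘ₗ TTensor.incl k H M (TargetSpace k H)) (by
      intro h m z
      rw [LinearMap.comp_apply, LinearMap.comp_apply, TTensor.incl_smul, ← TTensor.proj_tmul,
        TTensor.incl_proj, diagAction_mul_apply, unitRight_diag, unitRight_diag, mul_one, one_mul,
        mul_smul]) with
    invFun := fun m => ttmul k H m (TargetSpace.mk k H 1)
    left_inv := by
      intro w
      have : (ttmulₗ k H M _).flip (TargetSpace.mk k H 1) ∘ₗ unitRight k H M ∘ₗ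
          TTensor.incl k H M (TargetSpace k H) = LinearMap.id := by
        refine TTensor.hom_ext fun m z => ?_
        rw [LinearMap.comp_apply, LinearMap.comp_apply, ← TTensor.proj_tmul, TTensor.incl_proj,
          unitRight_diag, one_mul, LinearMap.flip_apply, ttmulₗ_apply, ← ttmul_target_right]
        rfl
      exact LinearMap.congr_fun this w
    right_inv := by
      intro m
      change unitRight k H M (TTensor.incl k H _ _ (TTensor.proj k H _ _ _)) = m
      rw [TTensor.incl_proj, unitRight_diag]
      simp [target_one, antipode_one] }

variable {k H M}

@[simp]
theorem leftUnitEquiv_ttmul (z : TargetSpace k H) (m : M) :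
    leftUnitEquiv k H M (ttmul k H z m) = TargetSpace.val k H z • m := by
  change unitLeft k H M (TTensor.incl k H _ _ (TTensor.proj k H _ _ _)) = _
  rw [TTensor.incl_proj, unitLeft_diag, one_mul]

@[simp]
theorem rightUnitEquiv_ttmul [IsRegular k H] (m : M) (z : TargetSpace k H) :
    rightUnitEquiv k H M (ttmul k H m z) = antipode (k := k) (TargetSpace.val k H z) • m := by
  change unitRight k H M (TTensor.incl k H _ _ (TTensor.proj k H _ _ _)) = _
  rw [TTensor.incl_proj, unitRight_diag, one_mul]

end Unitors
end Unit
end WeakHopfAlgebra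

namespace WeakHopfAlgebra

/-- A finite-dimensional left `H`-module over the `k`-algebra `H`. -/
structure HMod (k H : Type u) [Field k] [Ring H] [Algebra k H] where
  /-- the underlying space -/
  carrier : Type u
  [addCommGroup : AddCommGroup carrier]
  [moduleBase : Module k carrier]
  [moduleAlg : Module H carrier]
  [isScalarTower : IsScalarTower k H carrier]
  [finiteDimensional : FiniteDimensional k carrier]

namespace HMod

section Cat
variable {k H : Type u} [Field k] [Ring H] [Algebra k H]

instance : CoeSort (HMod k H) (Type u) := ⟨HMod.carrier⟩

attribute [instance] addCommGroup moduleBase moduleAlg isScalarTower finiteDimensional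

/-- Morphisms of finite-dimensional `H`-modules: the `H`-linear maps. -/
@[ext]
structure Hom (M N : HMod k H) where
  /-- the underlying `H`-linear map -/
  lin : M →ₗ[H] N

instance : Category (HMod k H) where
  Hom M N := Hom M N
  id M := ⟨LinearMap.id⟩
  comp f g := ⟨g.lin ∘ₗ f.lin⟩

/-- The `H`-linear map underlying a morphism. -/
def lin {M N : HMod k H} (f : M ⟶ N) : M →ₗ[H] N := Hom.lin f

/-- The morphism given by an `H`-linear map. -/
def ofLin {M N : HMod k H} (f : M →ₗ[H] N) : M ⟶ N := Hom.mk f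

@[simp] theorem lin_ofLin {M N : HMod k H} (f : M →ₗ[H] N) : lin (ofLin f) = f := rfl
@[simp] theorem lin_id (M : HMod k H) : lin (𝟙 M) = LinearMap.id := rfl
@[simp] theorem lin_comp {M N P : HMod k H} (f : M ⟶ N) (g : N ⟶ P) :
    lin (f ≫ g) = lin g ∘ₗ lin f := rfl

theorem hom_ext {M N : HMod k H} {f g : M ⟶ N} (h : lin f = lin g) : f = g := Hom.ext h

theorem hom_ext' {M N : HMod k H} {f g : M ⟶ N}
    (h : (lin f).restrictScalars k = (lin g).restrictScalars k) : f = g :=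
  hom_ext (LinearMap.restrictScalars_injective k h)

/-- The isomorphism given by an `H`-linear equivalence. -/
def isoMk {M N : HMod k H} (e : M ≃ₗ[H] N) : M ≅ N where
  hom := ofLin e.toLinearMap
  inv := ofLin e.symm.toLinearMap
  hom_inv_id := hom_ext (by ext; simp)
  inv_hom_id := hom_ext (by ext; simp)

@[simp] theorem lin_isoMk_hom {M N : HMod k H} (e : M ≃ₗ[H] N) :
    lin (isoMk e).hom = e.toLinearMap := rfl
@[simp] theorem lin_isoMk_inv {M N : HMod k H} (e : M ≃ₗ[H] N) :
    lin (isoMk e).inv = e.symm.toLinearMap := rfl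

end Cat

section Monoidal
variable {k H : Type u} [Field k] [Ring H] [Algebra k H] [Coalgebra k H] [WeakHopfAlgebra k H]
  [IsRegular k H] [FiniteDimensional k H]

noncomputable instance : MonoidalCategoryStruct (HMod k H) where
  tensorObj M N := ⟨TTensor k H M N⟩
  whiskerLeft M _ _ f := ofLin (TTensor.map LinearMap.id (lin f))
  whiskerRight f N := ofLin (TTensor.map (lin f) LinearMap.id)
  tensorHom f g := ofLin (TTensor.map (lin f) (lin g))
  tensorUnit := ⟨TargetSpace k H⟩
  associator M N P := isoMk (assocEquiv k H M N P)
  leftUnitor M := isoMk (leftUnitEquiv k H M)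
  rightUnitor M := isoMk (rightUnitEquiv k H M)

open MonoidalCategory

/-- The element `1₍₁₎ m ⊗ 1₍₂₎ n` of the tensor product in `H-mod`. -/
noncomputable def tm {M N : HMod k H} (m : M) (n : N) : (M ⊗ N : HMod k H) := ttmul k H m n

/-- The inclusion of the truncated tensor product into `M ⊗_k N`. -/
noncomputable def inclₖ (M N : HMod k H) : (M ⊗ N : HMod k H) →ₗ[k] TensorProduct k M N :=
  TTensor.incl k H M N

@[simp]
theorem whiskerLeft_tm (M : HMod k H) {N P : HMod k H} (f : N ⟶ P) (m : M) (n : N) :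
    lin (M ◁ f) (tm m n) = tm m (lin f n) := TTensor.map_ttmul _ _ _ _

@[simp]
theorem whiskerRight_tm {M N : HMod k H} (f : M ⟶ N) (P : HMod k H) (m : M) (p : P) :
    lin (f ▷ P) (tm m p) = tm (lin f m) p := TTensor.map_ttmul _ _ _ _

@[simp]
theorem tensorHom_tm {M N P Q : HMod k H} (f : M ⟶ N) (g : P ⟶ Q) (m : M) (p : P) :
    lin (f ⊗ₘ g) (tm m p) = tm (lin f m) (lin g p) := TTensor.map_ttmul _ _ _ _

@[simp]
theorem associator_tm (M N P : HMod k H) (m : M) (n : N) (p : P) :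
    lin (α_ M N P).hom (tm (tm m n) p) = tm m (tm n p) := assocEquiv_ttmul _ _ _

@[simp]
theorem associator_inv_tm (M N P : HMod k H) (m : M) (n : N) (p : P) :
    lin (α_ M N P).inv (tm m (tm n p)) = tm (tm m n) p :=
  (assocEquiv k H M N P).symm_apply_eq.2 (assocEquiv_ttmul _ _ _).symm

/-- An element of `H_t`, viewed in the unit object. -/
noncomputable def unitVal : (𝟙_ (HMod k H) : HMod k H) →ₗ[k] H := TargetSpace.val k H

@[simp]
theorem leftUnitor_tm (M : HMod k H) (z : (𝟙_ (HMod k H) : HMod k H)) (m : M) :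
    lin (λ_ M).hom (tm z m) = unitVal z • m := leftUnitEquiv_ttmul _ _

@[simp]
theorem rightUnitor_tm (M : HMod k H) (z : (𝟙_ (HMod k H) : HMod k H)) (m : M) :
    lin (ρ_ M).hom (tm m z) = antipode (k := k) (unitVal z) • m := rightUnitEquiv_ttmul _ _

theorem hom_ext₂ {M N V : HMod k H} {f g : M ⊗ N ⟶ V}
    (h : ∀ (m : M) (n : N), lin f (tm m n) = lin g (tm m n)) : f = g :=
  hom_ext' (TTensor.hom_ext h)

theorem hom_ext₃ {M N P V : HMod k H} {f g : (M ⊗ N) ⊗ P ⟶ V}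
    (h : ∀ (m : M) (n : N) (p : P), lin f (tm (tm m n) p) = lin g (tm (tm m n) p)) : f = g :=
  hom_ext' (TTensor.hom_ext₃ h)

theorem hom_ext₃' {M N P V : HMod k H} {f g : M ⊗ (N ⊗ P) ⟶ V}
    (h : ∀ (m : M) (n : N) (p : P), lin f (tm m (tm n p)) = lin g (tm m (tm n p))) : f = g :=
  hom_ext' (TTensor.hom_ext₃' h)

theorem hom_ext₄ {M N P Q V : HMod k H} {f g : ((M ⊗ N) ⊗ P) ⊗ Q ⟶ V}
    (h : ∀ (m : M) (n : N) (p : P) (q : Q),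
      lin f (tm (tm (tm m n) p) q) = lin g (tm (tm (tm m n) p) q)) : f = g :=
  hom_ext' (TTensor.hom_ext₄ h)

theorem tm_middle {M N : HMod k H} (m : M) (z : (𝟙_ (HMod k H) : HMod k H)) (n : N) :
    (tm m (unitVal z • n) : (M ⊗ N : HMod k H)) =
      tm (antipode (k := k) (unitVal z) • m) n := ttmul_middle m z n

/-- The monoidal category of finite-dimensional `H`-modules, with the truncated tensor product
and unit object `H_t`. -/
noncomputable instance : MonoidalCategory (HMod k H) where
  tensorHom_def f g := hom_ext₂ fun m n => by simp
  id_tensorHom_id M N := hom_ext₂ fun m n => by simp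
  tensorHom_comp_tensorHom f g h i := hom_ext₂ fun m n => by simp
  whiskerLeft_id M N := hom_ext₂ fun m n => by simp
  id_whiskerRight M N := hom_ext₂ fun m n => by simp
  associator_naturality f g h := hom_ext₃ fun m n p => by simp
  leftUnitor_naturality f := hom_ext₂ fun z m => by simp
  rightUnitor_naturality f := hom_ext₂ fun m z => by simp
  pentagon M N P Q := hom_ext₄ fun m n p q => by simp
  triangle M N := hom_ext₃ fun m z n => by simp [tm_middle]

theorem smul_tm {M N : HMod k H} {h : H} {t : Finset (H × H)}
    (ht : comul (R := k) h = ∑ i ∈ t, i.1 ⊗ₜ[k] i.2) (m : M) (n : N) :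
    h • (tm m n : (M ⊗ N : HMod k H)) = ∑ i ∈ t, tm (i.1 • m) (i.2 • n) :=
  smul_ttmul_rep ht m n

end Monoidal
end HMod
end WeakHopfAlgebra

namespace WeakHopfAlgebra

section QT
variable (k H : Type u) [Field k] [Ring H] [Algebra k H] [Coalgebra k H]

/-- A quasi-triangular weak Hopf algebra: a weak Hopf algebra together with a universal
`R`-matrix. -/
class Quasitriangular [WeakHopfAlgebra k H] where
  /-- the `R`-matrix `R = R¹ ⊗ R²` -/
  R : H ⊗[k] H
  /-- `R ∈ Δ^op(1) (H ⊗ H) Δ(1)` -/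
  exists_eq : ∃ t : H ⊗[k] H, R =
    TensorProduct.comm k H H (comul (R := k) (1 : H)) * t * comul (R := k) (1 : H)
  /-- `R Δ(h) = Δ^op(h) R` -/
  mul_comul : ∀ h : H, R * comul (R := k) h = TensorProduct.comm k H H (comul (R := k) h) * R
  /-- `(id ⊗ Δ)(R) = R₁₃ R₁₂` -/
  lTensor_comul : (comul (R := k) (A := H)).lTensor H R =
    TensorProduct.leftComm k H H H ((1 : H) ⊗ₜ[k] R) * TensorProduct.assoc k H H H (R ⊗ₜ[k] (1 : H))
  /-- `(Δ ⊗ id)(R) = R₁₃ R₂₃` -/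
  rTensor_comul : TensorProduct.assoc k H H H ((comul (R := k) (A := H)).rTensor H R) =
    TensorProduct.leftComm k H H H ((1 : H) ⊗ₜ[k] R) * ((1 : H) ⊗ₜ[k] R)
  /-- There is `R̄ ∈ Δ(1) (H ⊗ H) Δ^op(1)` with `R R̄ = Δ^op(1)` and `R̄ R = Δ(1)`. -/
  exists_inverse : ∃ R' : H ⊗[k] H,
    (∃ t : H ⊗[k] H, R' =
      comul (R := k) (1 : H) * t * TensorProduct.comm k H H (comul (R := k) (1 : H))) ∧
    R * R' = TensorProduct.comm k H H (comul (R := k) (1 : H)) ∧ R' * R = comul (R := k) (1 : H)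

end QT

section Braid
variable {k H : Type u} [Field k] [Ring H] [Algebra k H] [Coalgebra k H] [WeakHopfAlgebra k H]
variable {M N P Q : Type u}
  [AddCommGroup M] [Module k M] [Module H M] [IsScalarTower k H M]
  [AddCommGroup N] [Module k N] [Module H N] [IsScalarTower k H N]
  [AddCommGroup P] [Module k P] [Module H P] [IsScalarTower k H P]
  [AddCommGroup Q] [Module k Q] [Module H Q] [IsScalarTower k H Q]

/-- The flip of `H ⊗ H` is multiplicative. -/
theorem comm_mul (x y : H ⊗[k] H) : TensorProduct.comm k H H (x * y) =
    TensorProduct.comm k H H x * TensorProduct.comm k H H y :=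
  map_mul (Algebra.TensorProduct.comm k H H) x y

/-- The action of an element of `H ⊗ H` on `M ⊗ N`. -/
noncomputable abbrev pairAction (M N : Type u)
    [AddCommGroup M] [Module k M] [Module H M] [IsScalarTower k H M]
    [AddCommGroup N] [Module k N] [Module H N] [IsScalarTower k H N] :
    H ⊗[k] H →ₗ[k] Module.End k (M ⊗[k] N) :=
  act₂ (actionMap k H M) (actionMap k H N)

theorem pairAction_mul (x y : H ⊗[k] H) (w : M ⊗[k] N) :
    pairAction M N (x * y) w = pairAction M N x (pairAction M N y w) := by
  rw [pairAction, act₂_mul _ _ (fun x y => by simp) (fun x y => by simp)]; rfl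

theorem comm_pairAction (t : H ⊗[k] H) (w : M ⊗[k] N) :
    TensorProduct.comm k M N (pairAction M N t w) =
      pairAction N M (TensorProduct.comm k H H t) (TensorProduct.comm k M N w) := by
  induction t using TensorProduct.induction_on with
  | zero => simp
  | add a b ha hb => simp only [map_add, LinearMap.add_apply, ha, hb]
  | tmul a b =>
    induction w using TensorProduct.induction_on with
    | zero => simp
    | add a b ha hb => simp only [map_add, ha, hb]
    | tmul c d => simp

theorem diagAction_eq (h : H) (w : M ⊗[k] N) :
    diagAction k H M N h w = pairAction M N (comul h) w := rfl

/-- For `t ∈ H ⊗ H`, the map `M ⊗_t N → N ⊗_t M`, `1₍₁₎ m ⊗ 1₍₂₎ n ↦ t² n ⊗ t¹ m`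
followed by truncation. -/
noncomputable def flipHom (t : H ⊗[k] H) : TTensor k H M N →ₗ[k] TTensor k H N M :=
  TTensor.proj k H N M ∘ₗ (TensorProduct.comm k M N).toLinearMap ∘ₗ
    pairAction M N t ∘ₗ TTensor.incl k H M N

theorem incl_flipHom {t : H ⊗[k] H}
    (ht : TensorProduct.comm k H H (comul (1 : H)) * t = t) (w : TTensor k H M N) :
    TTensor.incl k H N M (flipHom t w) =
      TensorProduct.comm k M N (pairAction M N t (TTensor.incl k H M N w)) := by
  rw [flipHom, LinearMap.comp_apply, TTensor.incl_proj, diagAction_eq, LinearMap.comp_apply,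
    LinearMap.comp_apply, LinearEquiv.coe_coe, comm_pairAction, ← pairAction_mul]
  congr 2
  have := congrArg (TensorProduct.comm k H H) ht
  rw [comm_mul] at this
  simpa using this

theorem flipHom_ttmul {t : H ⊗[k] H} (ht : t * comul (1 : H) = t) (m : M) (n : N) :
    flipHom t (ttmul k H m n) =
      TTensor.proj k H N M (TensorProduct.comm k M N (pairAction M N t (m ⊗ₜ n))) := by
  rw [flipHom, LinearMap.comp_apply, LinearMap.comp_apply, LinearMap.comp_apply,
    ← TTensor.proj_tmul, TTensor.incl_proj, diagAction_eq, ← pairAction_mul, ht]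
  rfl

theorem flipHom_flipHom {s t : H ⊗[k] H}
    (ht : TensorProduct.comm k H H (comul (1 : H)) * t = t)
    (hs : TensorProduct.comm k H H (comul (1 : H)) * s = s)
    (hst : TensorProduct.comm k H H s * t = comul (1 : H)) (w : TTensor k H M N) :
    flipHom s (flipHom t w) = w := by
  apply TTensor.incl_injective
  have h : TensorProduct.comm k H H (TensorProduct.comm k H H t) = t :=
    (TensorProduct.comm k H H).symm_apply_apply t
  have h' : ∀ v : M ⊗[k] N, TensorProduct.comm k N M (TensorProduct.comm k M N v) = v :=
    (TensorProduct.comm k M N).symm_apply_apply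
  rw [incl_flipHom hs, incl_flipHom ht, comm_pairAction, comm_pairAction, comm_pairAction,
    h, h', ← pairAction_mul, hst, ← diagAction_eq, TTensor.diag_one_incl]

variable [Quasitriangular k H]
open Quasitriangular (R mul_comul)

theorem R_mul_one : R (k := k) * comul (1 : H) = R (k := k) := by
  obtain ⟨t, ht⟩ := Quasitriangular.exists_eq (k := k) (H := H)
  rw [ht, mul_assoc, one_mul_comul]

theorem one_mul_R : TensorProduct.comm k H H (comul (1 : H)) * R (k := k) = R (k := k) := by
  rw [← mul_comul, R_mul_one]

variable (k H M N) in
/-- The braiding `c(1₍₁₎ m ⊗ 1₍₂₎ n) = R² n ⊗ R¹ m`. -/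
noncomputable def braidEquiv : TTensor k H M N ≃ₗ[H] TTensor k H N M :=
  { flipHom (R (k := k)) with
    map_smul' := by
      intro h w
      change flipHom _ _ = h • flipHom _ _
      apply TTensor.incl_injective
      rw [TTensor.incl_smul, incl_flipHom one_mul_R, incl_flipHom one_mul_R, TTensor.incl_smul,
        diagAction_eq, diagAction_eq, ← pairAction_mul, comm_pairAction, comm_pairAction,
        ← pairAction_mul, mul_comul, comm_mul]
      simp
    invFun := flipHom (TensorProduct.comm k H H
      (Classical.choose (Quasitriangular.exists_inverse (k := k) (H := H))))
    left_inv := by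
      intro w
      obtain ⟨⟨t, ht⟩, h1, h2⟩ :=
        Classical.choose_spec (Quasitriangular.exists_inverse (k := k) (H := H))
      refine flipHom_flipHom one_mul_R ?_ ?_ w
      · conv_lhs => rw [ht]
        conv_rhs => rw [ht]
        rw [← comm_mul, ← mul_assoc, ← mul_assoc, one_mul_comul]
      · refine Eq.trans ?_ h2
        congr 1
        exact (TensorProduct.comm k H H).symm_apply_apply _
    right_inv := by
      intro w
      obtain ⟨⟨t, ht⟩, h1, h2⟩ :=
        Classical.choose_spec (Quasitriangular.exists_inverse (k := k) (H := H))
      refine flipHom_flipHom ?_ one_mul_R ?_ w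
      · conv_lhs => rw [ht]
        conv_rhs => rw [ht]
        rw [← comm_mul, ← mul_assoc, ← mul_assoc, one_mul_comul]
      · rw [← comm_mul, h1]
        exact (TensorProduct.comm k H H).symm_apply_apply _ }

theorem braidEquiv_ttmul (m : M) (n : N) :
    braidEquiv k H M N (ttmul k H m n) = TTensor.proj k H N M
      (TensorProduct.comm k M N (pairAction M N (R (k := k) (H := H)) (m ⊗ₜ n))) :=
  flipHom_ttmul (R_mul_one (k := k) (H := H)) m n

theorem braidEquiv_ttmul_rep {s : Finset (H × H)} (hs : R (k := k) (H := H) = ∑ i ∈ s, i.1 ⊗ₜ[k] i.2)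
    (m : M) (n : N) :
    braidEquiv k H M N (ttmul k H m n) = ∑ i ∈ s, ttmul k H (i.2 • n) (i.1 • m) := by
  rw [braidEquiv_ttmul, hs]
  simp [map_sum, TTensor.proj_tmul]

end Braid


namespace HMod
section Braided
variable {k H : Type u} [Field k] [Ring H] [Algebra k H] [Coalgebra k H] [WeakHopfAlgebra k H]
  [IsRegular k H] [FiniteDimensional k H]
open MonoidalCategory

/-- `tm` as a bilinear map. -/
noncomputable def tmₗ (M N : HMod k H) : M →ₗ[k] N →ₗ[k] (M ⊗ N : HMod k H) := ttmulₗ k H M N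

theorem tmₗ_apply {M N : HMod k H} (m : M) (n : N) : tmₗ M N m n = tm m n := rfl

/-- `x ⊗ y ↦ tm (x m) (y n)` -/
noncomputable def tmOrbit {M N : HMod k H} (m : M) (n : N) :
    H ⊗[k] H →ₗ[k] (M ⊗ N : HMod k H) :=
  TensorProduct.lift ((tmₗ M N).compl₁₂ ((actionMap k H M).flip m) ((actionMap k H N).flip n))

@[simp]
theorem tmOrbit_tmul {M N : HMod k H} (m : M) (n : N) (x y : H) :
    tmOrbit m n (x ⊗ₜ[k] y) = tm (x • m) (y • n) := rfl

theorem smul_tm_eq {M N : HMod k H} (h : H) (m : M) (n : N) :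
    h • (tm m n : (M ⊗ N : HMod k H)) = tmOrbit m n (comul (R := k) h) := by
  obtain ⟨t, ht⟩ := exists_rep (comul (R := k) h)
  rw [smul_tm ht, ht, map_sum]
  rfl

/-- `x ⊗ y ⊗ z ↦ tm (x m) (tm (y n) (z p))` -/
noncomputable def tmOrbit₃ {M N P : HMod k H} (m : M) (n : N) (p : P) :
    H ⊗[k] (H ⊗[k] H) →ₗ[k] (M ⊗ (N ⊗ P) : HMod k H) :=
  TensorProduct.lift ((tmₗ M (N ⊗ P)).compl₁₂ ((actionMap k H M).flip m) (tmOrbit n p))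

@[simp]
theorem tmOrbit₃_tmul {M N P : HMod k H} (m : M) (n : N) (p : P) (x : H) (w : H ⊗[k] H) :
    tmOrbit₃ m n p (x ⊗ₜ[k] w) = tm (x • m) (tmOrbit n p w) := rfl

/-- the underlying `k`-linear map of a morphism -/
noncomputable def linₖ {M N : HMod k H} (f : M ⟶ N) : M →ₗ[k] N := (lin f).restrictScalars k

theorem lin_apply {M N : HMod k H} (f : M ⟶ N) (m : M) : lin f m = linₖ f m := rfl

variable [Quasitriangular k H]
open Quasitriangular (R mul_comul)

/-- The braiding of `H-mod`. -/
noncomputable def braid (M N : HMod k H) : (M ⊗ N : HMod k H) ≅ N ⊗ M :=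
  isoMk (braidEquiv k H M N)

theorem braid_tm {s : Finset (H × H)} (hs : R (k := k) = ∑ i ∈ s, i.1 ⊗ₜ[k] i.2)
    {M N : HMod k H} (m : M) (n : N) :
    lin (braid M N).hom (tm m n) = ∑ i ∈ s, tm (i.2 • n) (i.1 • m) :=
  braidEquiv_ttmul_rep hs m n

theorem braid_tm_orbit {M N : HMod k H} (m : M) (n : N) :
    lin (braid M N).hom (tm m n) = tmOrbit n m (TensorProduct.comm k H H (R (k := k))) := by
  obtain ⟨s, hs⟩ := exists_rep (R (k := k) (H := H))
  rw [braid_tm hs, hs]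
  simp [map_sum]

theorem hexagon₁ (X Y Z : HMod k H) :
    (α_ X Y Z).hom ≫ (braid X (Y ⊗ Z)).hom ≫ (α_ Y Z X).hom =
      ((braid X Y).hom ▷ Z) ≫ (α_ Y X Z).hom ≫ (Y ◁ (braid X Z).hom) := by
  refine hom_ext₃ fun x y z => ?_
  obtain ⟨s, hs⟩ := exists_rep (R (k := k) (H := H))
  let T : H ⊗[k] (H ⊗[k] H) →ₗ[k] (Y ⊗ (Z ⊗ X) : HMod k H) :=
    tmOrbit₃ y z x ∘ₗ (TensorProduct.assoc k H H H).toLinearMap ∘ₗ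
      (TensorProduct.comm k H (H ⊗[k] H)).toLinearMap
  have hT : ∀ a b c, T (a ⊗ₜ (b ⊗ₜ c)) = tm (b • y) (tm (c • z) (a • x)) := fun a b c => rfl
  have key : ∀ (a : H) (t : H ⊗[k] H),
      lin (α_ Y Z X).hom (tm (tmOrbit y z t) (a • x)) = T (a ⊗ₜ t) := by
    intro a t
    induction t using TensorProduct.induction_on with
    | zero => rw [map_zero, tmul_zero, map_zero, ← tmₗ_apply]; simp
    | add u v hu hv => rw [map_add, tmul_add, map_add, ← hu, ← hv]; simp only [← tmₗ_apply]; simp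
    | tmul b c => rw [hT, tmOrbit_tmul, associator_tm]
  have h1 := congrArg T (Quasitriangular.lTensor_comul (k := k) (H := H))
  simp only [lin_comp, LinearMap.comp_apply, associator_tm, braid_tm hs, smul_tm_eq, map_sum, key]
  simp only [hs, map_sum, LinearMap.lTensor_tmul] at h1
  rw [h1, whiskerRight_tm, braid_tm hs]
  simp only [tmul_sum, sum_tmul, map_sum, TensorProduct.leftComm_tmul, TensorProduct.assoc_tmul,
    Finset.sum_mul, Finset.mul_sum, Algebra.TensorProduct.tmul_mul_tmul, hT, mul_one, one_mul,
    mul_smul]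
  simp only [← tmₗ_apply, map_sum, LinearMap.sum_apply]
  simp only [tmₗ_apply, associator_tm, whiskerLeft_tm, braid_tm hs]
  simp only [← tmₗ_apply, map_sum, LinearMap.sum_apply]

theorem hexagon₂ (X Y Z : HMod k H) :
    (α_ X Y Z).inv ≫ (braid (X ⊗ Y) Z).hom ≫ (α_ Z X Y).inv =
      (X ◁ (braid Y Z).hom) ≫ (α_ X Z Y).inv ≫ ((braid X Z).hom ▷ Y) := by
  refine hom_ext₃' fun x y z => ?_
  obtain ⟨s, hs⟩ := exists_rep (R (k := k) (H := H))
  let T : H ⊗[k] (H ⊗[k] H) →ₗ[k] ((Z ⊗ X) ⊗ Y : HMod k H) :=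
    linₖ (α_ Z X Y).inv ∘ₗ tmOrbit₃ z x y ∘ₗ
      (TensorProduct.comm k (H ⊗[k] H) H).toLinearMap ∘ₗ (TensorProduct.assoc k H H H).symm.toLinearMap
  have hT : ∀ a b c, T (a ⊗ₜ (b ⊗ₜ c)) = tm (tm (c • z) (a • x)) (b • y) := fun a b c =>
    associator_inv_tm _ _ _ _ _ _
  have key : ∀ (c : H) (t : H ⊗[k] H),
      lin (α_ Z X Y).inv (tm (c • z) (tmOrbit x y t)) = T (TensorProduct.assoc k H H H (t ⊗ₜ c)) := by
    intro a t
    simp only [T, LinearMap.comp_apply, LinearEquiv.coe_coe, LinearEquiv.symm_apply_apply]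
    rfl
  have h1 := congrArg T (Quasitriangular.rTensor_comul (k := k) (H := H))
  simp only [lin_comp, LinearMap.comp_apply, associator_inv_tm, braid_tm hs, smul_tm_eq, map_sum,
    key]
  simp only [hs, map_sum, LinearMap.rTensor_tmul] at h1
  rw [h1, whiskerLeft_tm, braid_tm hs]
  simp only [tmul_sum, sum_tmul, map_sum, TensorProduct.leftComm_tmul, TensorProduct.assoc_tmul,
    Finset.sum_mul, Finset.mul_sum, Algebra.TensorProduct.tmul_mul_tmul, hT, mul_one, one_mul,
    mul_smul]
  simp only [← tmₗ_apply, map_sum, LinearMap.sum_apply]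
  simp only [tmₗ_apply, associator_inv_tm, whiskerRight_tm, braid_tm hs]
  simp only [← tmₗ_apply, map_sum, LinearMap.sum_apply]

/-- The braided category of finite-dimensional modules over a quasi-triangular weak Hopf
algebra. -/
noncomputable instance : BraidedCategory (HMod k H) where
  braiding := braid
  braiding_naturality_right X Y Z f := hom_ext₂ fun x y => by
    obtain ⟨s, hs⟩ := exists_rep (R (k := k) (H := H))
    simp [braid_tm hs]
  braiding_naturality_left f Z := hom_ext₂ fun x y => by
    obtain ⟨s, hs⟩ := exists_rep (R (k := k) (H := H))
    simp [braid_tm hs]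
  hexagon_forward := hexagon₁
  hexagon_reverse := hexagon₂

end Braided
end HMod
end WeakHopfAlgebra

namespace WeakHopfAlgebra

/-- The linear dual `M^* = Hom_k(M, k)`, with the action `(h · f)(x) = f(S(h) x)`. -/
def DualSpace (k H M : Type u) [Field k] [AddCommGroup M] [Module k M] : Type u :=
  Module.Dual k M

section DualSpace
variable (k H : Type u) [Field k] [Ring H] [Algebra k H] [Coalgebra k H] [WeakHopfAlgebra k H]
variable (M : Type u) [AddCommGroup M] [Module k M] [Module H M] [IsScalarTower k H M]

noncomputable instance : AddCommGroup (DualSpace k H M) :=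
  inferInstanceAs (AddCommGroup (Module.Dual k M))
noncomputable instance : Module k (DualSpace k H M) :=
  inferInstanceAs (Module k (Module.Dual k M))
instance [FiniteDimensional k M] : FiniteDimensional k (DualSpace k H M) :=
  inferInstanceAs (FiniteDimensional k (Module.Dual k M))

/-- An element of `M^*` as a linear form. -/
noncomputable def DualSpace.toDual : DualSpace k H M ≃ₗ[k] Module.Dual k M := LinearEquiv.refl k _

variable {k H M}

/-- The action of `h` on `M^*`. -/
noncomputable def DualSpace.act (h : H) (f : DualSpace k H M) : DualSpace k H M :=
  (DualSpace.toDual k H M).symm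
    (DualSpace.toDual k H M f ∘ₗ actionMap k H M (antipode (k := k) h))

theorem DualSpace.act_apply (h : H) (f : DualSpace k H M) (x : M) :
    DualSpace.toDual k H M (DualSpace.act h f) x =
      DualSpace.toDual k H M f (antipode (k := k) h • x) := rfl

theorem DualSpace.ext {f g : DualSpace k H M}
    (h : ∀ x, DualSpace.toDual k H M f x = DualSpace.toDual k H M g x) : f = g :=
  (DualSpace.toDual k H M).injective (LinearMap.ext h)

noncomputable instance : Module H (DualSpace k H M) where
  smul := DualSpace.act
  one_smul f := DualSpace.ext fun x => by
    change DualSpace.toDual k H M (DualSpace.act 1 f) x = _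
    rw [DualSpace.act_apply, antipode_one, one_smul]
  mul_smul a b f := DualSpace.ext fun x => by
    change DualSpace.toDual k H M (DualSpace.act (a * b) f) x =
      DualSpace.toDual k H M (DualSpace.act a (DualSpace.act b f)) x
    rw [DualSpace.act_apply, DualSpace.act_apply, DualSpace.act_apply, antipode_mul_rev, mul_smul]
  smul_zero a := DualSpace.ext fun x => by
    change DualSpace.toDual k H M (DualSpace.act a 0) x = _
    rw [DualSpace.act_apply]; simp
  smul_add a f g := DualSpace.ext fun x => by
    change DualSpace.toDual k H M (DualSpace.act a (f + g)) x =
      DualSpace.toDual k H M (DualSpace.act a f + DualSpace.act a g) x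
    simp [DualSpace.act_apply]
  add_smul a b f := DualSpace.ext fun x => by
    change DualSpace.toDual k H M (DualSpace.act (a + b) f) x =
      DualSpace.toDual k H M (DualSpace.act a f + DualSpace.act b f) x
    simp [DualSpace.act_apply, add_smul]
  zero_smul f := DualSpace.ext fun x => by
    change DualSpace.toDual k H M (DualSpace.act 0 f) x = _
    rw [DualSpace.act_apply]; simp

@[simp]
theorem DualSpace.smul_apply (h : H) (f : DualSpace k H M) (x : M) :
    DualSpace.toDual k H M (h • f) x = DualSpace.toDual k H M f (antipode (k := k) h • x) := rfl

instance : IsScalarTower k H (DualSpace k H M) where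
  smul_assoc c h f := DualSpace.ext fun x => by simp

/-- `Σ S(h₍₁₎) 1₍₁₎ h₍₂₎ ⊗ 1₍₂₎ = 1₍₁₎ ⊗ ε_t(h 1₍₂₎)` -/
theorem antipode_conj {h : H} {t : Finset (H × H)}
    (ht : comul (R := k) h = ∑ i ∈ t, i.1 ⊗ₜ[k] i.2) :
    ∑ i ∈ t, (antipode (k := k) i.1 ⊗ₜ[k] (1 : H)) * comul (R := k) (1 : H) * (i.2 ⊗ₜ[k] 1) =
      (targetCounit k H).lTensor H ((1 ⊗ₜ[k] h) * comul (R := k) (1 : H)) := by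
  let G : (H ⊗[k] H) ⊗[k] H →ₗ[k] H ⊗[k] H :=
    TensorProduct.map (LinearMap.mul' k H ∘ₗ (antipode (k := k)).rTensor H) (targetCounit k H)
  have e1 : ∀ i : H × H, (antipode (k := k) i.1 ⊗ₜ[k] (1 : H)) * comul (R := k) (1 : H) *
      (i.2 ⊗ₜ[k] 1) = G ((TensorProduct.assoc k H H H).symm (i.1 ⊗ₜ comul (R := k) i.2)) := by
    intro i
    rw [mul_assoc, ← lTensor_target_comul]
    obtain ⟨r, hr⟩ := exists_rep (comul (R := k) i.2)
    rw [hr]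
    simp [G, map_sum, tmul_sum, Finset.mul_sum]
  have e2 : ∑ i ∈ t, i.1 ⊗ₜ[k] comul (R := k) i.2 =
      (comul (R := k) (A := H)).lTensor H (comul (R := k) h) := by
    rw [ht]; simp [map_sum]
  rw [Finset.sum_congr rfl fun i _ => e1 i, ← map_sum, ← map_sum, e2, coassoc_symm_apply,
    ← rTensor_source_comul, ht]
  simp [G, map_sum, antipode_mul]

/-- `x ⊗ y ↦ f(x m) ε_t(y)`. -/
noncomputable def pairForm (f : DualSpace k H M) (m : M) : H ⊗[k] H →ₗ[k] TargetSpace k H :=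
  (TensorProduct.lid k _).toLinearMap ∘ₗ
    TensorProduct.map (DualSpace.toDual k H M f ∘ₗ (actionMap k H M).flip m) (TargetSpace.mk k H)

@[simp]
theorem pairForm_tmul (f : DualSpace k H M) (m : M) (x y : H) :
    pairForm f m (x ⊗ₜ[k] y) = DualSpace.toDual k H M f (x • m) • TargetSpace.mk k H y := rfl

theorem pairForm_lTensor (f : DualSpace k H M) (m : M) (t : H ⊗[k] H) :
    pairForm f m ((targetCounit k H).lTensor H t) = pairForm f m t := by
  induction t using TensorProduct.induction_on with
  | zero => simp
  | add a b ha hb => simp only [map_add, ha, hb]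
  | tmul a b => simp [TargetSpace.mk_target]

theorem smul_pairForm (f : DualSpace k H M) (m : M) (h : H) (t : H ⊗[k] H) :
    h • pairForm f m t = pairForm f m ((1 ⊗ₜ[k] h) * t) := by
  induction t using TensorProduct.induction_on with
  | zero => simp
  | add a b ha hb => simp only [map_add, mul_add, smul_add, ha, hb]
  | tmul a b =>
    apply TargetSpace.val_injective
    rw [pairForm_tmul, smul_comm]
    simp [target_mul_target]

theorem pairForm_smul_smul (f : DualSpace k H M) (m : M) (a b : H) (t : H ⊗[k] H) :
    pairForm (a • f) (b • m) t =
      pairForm f m ((antipode (k := k) a ⊗ₜ[k] (1 : H)) * t * (b ⊗ₜ[k] 1)) := by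
  induction t using TensorProduct.induction_on with
  | zero => simp
  | add a b ha hb => simp only [map_add, mul_add, add_mul, ha, hb]
  | tmul c d => simp [mul_smul]

variable (k H M) in
/-- The map `f ⊗ m ↦ f(1₍₁₎ m) 1₍₂₎` on `M^* ⊗_k M`. -/
noncomputable def dualEval : DualSpace k H M ⊗[k] M →ₗ[k] TargetSpace k H :=
  TensorProduct.lift (LinearMap.mk₂ k (fun f m => pairForm f m (comul (R := k) (1 : H)))
    (fun f g m => by simp [pairForm, LinearMap.add_comp, TensorProduct.map_add_left])
    (fun c f m => by simp [pairForm, LinearMap.smul_comp, TensorProduct.map_smul_left])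
    (fun f m n => by simp [pairForm, LinearMap.comp_add, TensorProduct.map_add_left])
    (fun c f m => by simp [pairForm, LinearMap.comp_smul, TensorProduct.map_smul_left]))

@[simp]
theorem dualEval_tmul (f : DualSpace k H M) (m : M) :
    dualEval k H M (f ⊗ₜ m) = pairForm f m (comul (R := k) (1 : H)) := rfl

theorem dualEval_diag (h : H) (w : DualSpace k H M ⊗[k] M) :
    dualEval k H M (diagAction k H _ _ h w) = h • dualEval k H M w := by
  induction w using TensorProduct.induction_on with
  | zero => simp
  | add a b ha hb => simp only [map_add, smul_add, ha, hb]
  | tmul f m =>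
    obtain ⟨t, ht⟩ := exists_rep (comul (R := k) h)
    rw [diagAction_tmul, dualEval_tmul, smul_pairForm, ← pairForm_lTensor, ← antipode_conj ht, ht]
    simp [map_sum, pairForm_smul_smul]

variable (k H M) in
/-- The evaluation `1₍₁₎ f ⊗ 1₍₂₎ m ↦ f(1₍₁₎ m) 1₍₂₎`. -/
noncomputable def evalHom : TTensor k H (DualSpace k H M) M →ₗ[H] TargetSpace k H where
  toFun w := dualEval k H M (TTensor.incl k H _ _ w)
  map_add' v w := by simp
  map_smul' h w := by rw [RingHom.id_apply, TTensor.incl_smul, dualEval_diag]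

theorem evalHom_ttmul (f : DualSpace k H M) (m : M) :
    evalHom k H M (ttmul k H f m) = pairForm f m (comul (R := k) (1 : H)) := by
  change dualEval k H M (TTensor.incl k H _ _ (TTensor.proj k H _ _ _)) = _
  rw [TTensor.incl_proj, dualEval_diag, one_smul, dualEval_tmul]

section fin
variable [FiniteDimensional k M]

variable (k H M) in
/-- The canonical element `Σ xᵢ ⊗ xᵢ^*` of `M ⊗_k M^*`. -/
noncomputable def canonicalElement : M ⊗[k] DualSpace k H M :=
  (DualSpace.toDual k H M).symm.toLinearMap.lTensor M (coevaluation k M 1)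

variable (k H M) in
/-- The identification of `M ⊗ M^*` with the endomorphisms of `M`. -/
noncomputable def toEnd : M ⊗[k] DualSpace k H M ≃ₗ[k] Module.End k M :=
  ((DualSpace.toDual k H M).lTensor M).trans
    ((TensorProduct.comm k M (Module.Dual k M)).trans (dualTensorHomEquiv k M M))

@[simp]
theorem toEnd_tmul (m : M) (f : DualSpace k H M) (v : M) :
    toEnd k H M (m ⊗ₜ f) v = DualSpace.toDual k H M f v • m := by
  simp [toEnd]

theorem toEnd_canonical : toEnd k H M (canonicalElement k H M) = LinearMap.id := by
  ext v
  have : canonicalElement k H M = ∑ i, (Module.Basis.ofVectorSpace k M i) ⊗ₜ[k]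
      (DualSpace.toDual k H M).symm ((Module.Basis.ofVectorSpace k M).coord i) := by
    rw [canonicalElement, coevaluation_apply_one, map_sum]
    rfl
  rw [this, map_sum, LinearMap.sum_apply]
  simp only [toEnd_tmul, LinearEquiv.apply_symm_apply, LinearMap.id_apply]
  exact (Module.Basis.ofVectorSpace k M).sum_repr v

theorem toEnd_diag (y : H) (v : M) :
    toEnd k H M (diagAction k H _ _ y (canonicalElement k H M)) v = targetCounit k H y • v := by
  obtain ⟨t, ht⟩ := exists_rep (comul (R := k) y)
  have key : ∀ (a b : H) (w : M ⊗[k] DualSpace k H M),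
      toEnd k H M (pairAction M (DualSpace k H M) (a ⊗ₜ b) w) v =
        a • toEnd k H M w (antipode (k := k) b • v) := by
    intro a b w
    induction w using TensorProduct.induction_on with
    | zero => simp
    | add a b ha hb => simp only [map_add, LinearMap.add_apply, smul_add, ha, hb]
    | tmul m f =>
      rw [act₂_tmul, toEnd_tmul, toEnd_tmul, smul_comm]; rfl
  rw [diagAction_eq, ht, map_sum, LinearMap.sum_apply, map_sum, LinearMap.sum_apply,
    ← mul_antipode, ht]
  simp [key, toEnd_canonical, map_sum, Finset.sum_smul, mul_smul]

theorem diag_canonical (y : H) :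
    diagAction k H _ _ (targetCounit k H y) (canonicalElement k H M) =
      diagAction k H _ _ y (canonicalElement k H M) := by
  apply (toEnd k H M).injective
  ext v
  rw [toEnd_diag, toEnd_diag, target_target]

variable (k H M) in
/-- The coevaluation `z ↦ Σ z₍₁₎ xᵢ ⊗ z₍₂₎ xᵢ^*`. -/
noncomputable def coevHom : TargetSpace k H →ₗ[H] TTensor k H M (DualSpace k H M) where
  toFun z := TTensor.proj k H _ _ (diagAction k H _ _ (TargetSpace.val k H z)
    (canonicalElement k H M))
  map_add' y z := by simp
  map_smul' h z := by
    rw [RingHom.id_apply, TTensor.smul_proj, diagAction_mul_apply, TargetSpace.val_smul,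
      diag_canonical]

theorem zigzag_right (z : TargetSpace k H) (m : M)
    (G : M ⊗[k] DualSpace k H M →ₗ[k] M)
    (hG : ∀ x f, G (x ⊗ₜ f) =
      antipode (k := k) (TargetSpace.val k H (pairForm f m (comul (R := k) (1 : H)))) • x)
    [IsRegular k H] :
    G (diagAction k H _ _ (TargetSpace.val k H z) (canonicalElement k H M)) =
      TargetSpace.val k H z • m := by
  obtain ⟨s, hs⟩ := exists_rep (comul (R := k) (1 : H))
  have h1 : ∀ w, G w =
      ∑ i ∈ s, antipode (k := k) (targetCounit k H i.2) • toEnd k H M w (i.1 • m) := by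
    intro w
    induction w using TensorProduct.induction_on with
    | zero => simp
    | add a b ha hb => simp only [map_add, LinearMap.add_apply, smul_add, ha, hb,
        Finset.sum_add_distrib]
    | tmul x f =>
      rw [hG, hs]
      simp only [map_sum, pairForm_tmul, map_smul, TargetSpace.val_mk, toEnd_tmul, Finset.sum_smul]
      refine Finset.sum_congr rfl fun i _ => ?_
      rw [smul_assoc, smul_comm]
  rw [h1]
  simp only [toEnd_diag, TargetSpace.target_val, antipode_target_eq_sbar, ← mul_smul,
    ← Finset.sum_smul]
  congr 1
  have h2 := ((comul_target (TargetSpace.val k H z)).1.symm.trans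
    (comul_target (k := k) (TargetSpace.val k H z)).2)
  rw [TargetSpace.target_val] at h2
  have h3 := congrArg (fun t => LinearMap.mul' k H (TensorProduct.comm k H H
    (LinearMap.lTensor H (antipode (k := k) ∘ₗ targetCounit k H) t))) h2
  simp only [hs, Finset.sum_mul, Finset.mul_sum, map_sum, Algebra.TensorProduct.tmul_mul_tmul,
    LinearMap.lTensor_tmul, TensorProduct.comm_tmul, LinearMap.mul'_apply, one_mul, mul_one,
    LinearMap.comp_apply, antipode_target_eq_sbar, ← mul_assoc] at h3
  have h4 : ∑ i ∈ s, sbar (k := k) i.2 * i.1 = 1 := by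
    have h5 := lTensor_counit_comul (R := k) (1 : H)
    rw [← one_mul_comul, hs] at h5
    have h6 := congrArg (TensorProduct.rid k H) h5
    simp only [sbar_rep hs]
    simp [Finset.sum_mul, Finset.mul_sum, map_sum] at h6 ⊢
    exact h6
  simp only [← mul_assoc]
  rw [h3, ← Finset.sum_mul, h4, one_mul]

theorem zigzag_left (z : TargetSpace k H) (f : DualSpace k H M)
    (G : M ⊗[k] DualSpace k H M →ₗ[k] DualSpace k H M)
    (hG : ∀ x g, G (x ⊗ₜ g) =
      (TargetSpace.val k H (pairForm f x (comul (R := k) (1 : H)))) • g)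
    [IsRegular k H] :
    G (diagAction k H _ _ (TargetSpace.val k H z) (canonicalElement k H M)) =
      antipode (k := k) (TargetSpace.val k H z) • f := by
  obtain ⟨s, hs⟩ := exists_rep (comul (R := k) (1 : H))
  refine DualSpace.ext fun v => ?_
  have h1 : ∀ w, DualSpace.toDual k H M (G w) v =
      ∑ i ∈ s, DualSpace.toDual k H M f (i.1 •
        toEnd k H M w (antipode (k := k) (targetCounit k H i.2) • v)) := by
    intro w
    induction w using TensorProduct.induction_on with
    | zero => simp
    | add a b ha hb => simp only [map_add, LinearMap.add_apply, smul_add, ha, hb,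
        Finset.sum_add_distrib]
    | tmul x g =>
      rw [hG, hs]
      simp only [map_sum, pairForm_tmul, map_smul, TargetSpace.val_mk, toEnd_tmul, Finset.sum_smul,
        LinearMap.sum_apply]
      refine Finset.sum_congr rfl fun i _ => ?_
      rw [smul_assoc, map_smul (DualSpace.toDual k H M), LinearMap.smul_apply,
        DualSpace.smul_apply, smul_comm i.1
          (DualSpace.toDual k H M g (antipode (k := k) (targetCounit k H i.2) • v)) x,
        map_smul (DualSpace.toDual k H M f), smul_eq_mul, smul_eq_mul, mul_comm]
  rw [h1, DualSpace.smul_apply]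
  simp only [toEnd_diag, TargetSpace.target_val, ← mul_smul]
  rw [← map_sum, ← Finset.sum_smul, ← TargetSpace.target_val, antipode_antipode_target]
  congr 2
  simp only [TargetSpace.target_val]
  have h3 := target_mul (k := k) 1 (TargetSpace.val k H z) hs
  rw [one_mul, TargetSpace.target_val] at h3
  refine Eq.trans ?_ h3.symm
  let L : H ⊗[k] H →ₗ[k] H :=
    TensorProduct.lift ((LinearMap.mul k H).compl₁₂ (LinearMap.mulRight k (TargetSpace.val k H z))
      (antipode (k := k)))
  have h5 := congrArg L (lTensor_target_one (k := k) (H := H))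
  rw [hs] at h5
  simpa [L, map_sum, mul_assoc] using h5

end fin
end DualSpace

namespace HMod
section Dual
variable {k H : Type u} [Field k] [Ring H] [Algebra k H] [Coalgebra k H] [WeakHopfAlgebra k H]
  [IsRegular k H] [FiniteDimensional k H]
open MonoidalCategory

/-- The dual module `M^*`. -/
noncomputable def dual (M : HMod k H) : HMod k H := ⟨DualSpace k H M⟩

/-- The evaluation `M^* ⊗ M → 1`. -/
noncomputable def ev (M : HMod k H) : dual M ⊗ M ⟶ 𝟙_ (HMod k H) := ofLin (evalHom k H M)

/-- The coevaluation `1 → M ⊗ M^*`. -/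
noncomputable def coev (M : HMod k H) : 𝟙_ (HMod k H) ⟶ M ⊗ dual M := ofLin (coevHom k H M)

theorem ev_tm (M : HMod k H) (f : dual M) (m : M) :
    lin (ev M) (tm f m) = pairForm f m (comul (R := k) (1 : H)) := evalHom_ttmul _ _

/-- `M ⊗_k N → M ⊗_t N` -/
noncomputable def projₖ (M N : HMod k H) : TensorProduct k M N →ₗ[k] (M ⊗ N : HMod k H) :=
  TTensor.proj k H M N

theorem projₖ_tmul {M N : HMod k H} (m : M) (n : N) : projₖ M N (m ⊗ₜ n) = tm m n := rfl

theorem lin_coev (M : HMod k H) (z : (𝟙_ (HMod k H) : HMod k H)) :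
    lin (coev M) z = projₖ M (dual M) (diagAction k H M (DualSpace k H M) (unitVal z)
      (canonicalElement k H M)) := rfl

theorem zigzag_left_tm (M : HMod k H) (f : dual M) (x : M) (g : dual M) :
    lin ((α_ (dual M) M (dual M)).inv ≫ ev M ▷ dual M ≫ (λ_ (dual M)).hom) (tm f (tm x g)) =
      TargetSpace.val k H (pairForm f x (comul (R := k) (1 : H))) • g := by
  simp only [lin_comp, LinearMap.comp_apply, associator_inv_tm, whiskerRight_tm,
    leftUnitor_tm, ev_tm]
  rfl

theorem zigzag_right_tm (M : HMod k H) (x : M) (g : dual M) (m : M) :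
    lin ((α_ M (dual M) M).hom ≫ M ◁ ev M ≫ (ρ_ M).hom) (tm (tm x g) m) =
      antipode (k := k) (TargetSpace.val k H (pairForm g m (comul (R := k) (1 : H)))) • x := by
  simp only [lin_comp, LinearMap.comp_apply, associator_tm, whiskerLeft_tm,
    rightUnitor_tm, ev_tm]
  rfl

noncomputable instance exactPairing (M : HMod k H) : ExactPairing M (dual M) where
  coevaluation' := coev M
  evaluation' := ev M
  coevaluation_evaluation' := by
    rw [← cancel_mono (λ_ _).hom]
    refine hom_ext₂ fun f z => ?_
    simp only [Category.assoc, Iso.inv_hom_id, Category.comp_id, rightUnitor_tm]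
    simp only [lin_comp, LinearMap.comp_apply, whiskerLeft_tm, lin_coev]
    let G : TensorProduct k M (dual M) →ₗ[k] dual M :=
      linₖ ((α_ (dual M) M (dual M)).inv ≫ ev M ▷ dual M ≫ (λ_ (dual M)).hom) ∘ₗ
        tmₗ (dual M) (M ⊗ dual M) f ∘ₗ projₖ M (dual M)
    exact zigzag_left z f G fun x g => zigzag_left_tm M f x g
  evaluation_coevaluation' := by
    rw [← cancel_mono (ρ_ _).hom]
    refine hom_ext₂ fun z m => ?_
    simp only [Category.assoc, Iso.inv_hom_id, Category.comp_id, leftUnitor_tm]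
    simp only [lin_comp, LinearMap.comp_apply, whiskerRight_tm, lin_coev]
    let G : TensorProduct k M (dual M) →ₗ[k] M :=
      linₖ ((α_ M (dual M) M).hom ≫ M ◁ ev M ≫ (ρ_ M).hom) ∘ₗ
        (tmₗ (M ⊗ dual M) M).flip m ∘ₗ projₖ M (dual M)
    exact zigzag_right z m G fun x g => zigzag_right_tm M x g m

/-- Every finite-dimensional `H`-module `M` has the dual `M^*`, with evaluation
`M^* ⊗ M → 1` and coevaluation `1 → M ⊗ M^*`. -/
noncomputable instance : RightRigidCategory (HMod k H) where
  rightDual M := ⟨dual M⟩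

end Dual
end HMod
end WeakHopfAlgebra

namespace WeakHopfAlgebra

section Adjoint
variable (k H : Type u) [Field k] [Ring H] [Algebra k H] [Coalgebra k H] [WeakHopfAlgebra k H]

/-- The adjoint action `h ·_ad b = h₍₁₎ b S(h₍₂₎)`. -/
noncomputable def adAction : H →ₗ[k] Module.End k H :=
  TensorProduct.lift ((LinearMap.mul k (Module.End k H)).compl₁₂ (LinearMap.mul k H)
    ((LinearMap.mul k H).flip ∘ₗ antipode (k := k))) ∘ₗ comul (R := k) (A := H)

variable {k H} in
theorem adAction_rep {h : H} {t : Finset (H × H)}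
    (ht : comul (R := k) h = ∑ i ∈ t, i.1 ⊗ₜ[k] i.2) (b : H) :
    adAction k H h b = ∑ i ∈ t, i.1 * b * antipode (k := k) i.2 := by
  simp [adAction, ht, map_sum, LinearMap.sum_apply, mul_assoc]

variable {k H} in
theorem adAction_mul (x y b : H) :
    adAction k H (x * y) b = adAction k H x (adAction k H y b) := by
  obtain ⟨s, hs⟩ := exists_rep (comul (R := k) x)
  obtain ⟨t, ht⟩ := exists_rep (comul (R := k) y)
  rw [adAction_rep ht, adAction_rep hs, adAction, LinearMap.comp_apply, comul_mul, hs, ht]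
  simp [map_sum, LinearMap.sum_apply, Finset.sum_mul, Finset.mul_sum, mul_assoc, antipode_mul_rev]
  try rw [Finset.sum_comm]

variable {k H} in
theorem adAction_mem [IsRegular k H] (h b x : H) :
    sourceCounit k H x * adAction k H h b = adAction k H h b * sourceCounit k H x := by
  obtain ⟨t, ht⟩ := exists_rep (comul (R := k) h)
  let L : H ⊗[k] H →ₗ[k] H := TensorProduct.lift
    ((LinearMap.mul k H).compl₁₂ (LinearMap.mulRight k b) (antipode (k := k)))
  have h1 : (sourceCounit k H x ⊗ₜ[k] (1 : H)) * comul (R := k) h =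
      (1 ⊗ₜ[k] antipode (k := k) (sourceCounit k H x)) * comul (R := k) h := by
    rw [← one_mul_comul h, ← mul_assoc, source_mul_comul_one, mul_assoc]
  have h2 := congrArg L h1
  rw [ht] at h2
  rw [adAction_rep ht]
  simpa [L, map_sum, Finset.sum_mul, Finset.mul_sum, antipode_mul_rev, antipode_antipode_source,
    mul_assoc] using h2

/-- The centralizer `C_H(H_s)` of the source subalgebra `H_s = ε_s(H)`. -/
def CentralizerSpace : Type u := Subalgebra.centralizer k (Set.range (sourceCounit k H))

noncomputable instance : AddCommGroup (CentralizerSpace k H) :=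
  inferInstanceAs (AddCommGroup (Subalgebra.centralizer k (Set.range (sourceCounit k H))))
noncomputable instance : Module k (CentralizerSpace k H) :=
  inferInstanceAs (Module k (Subalgebra.centralizer k (Set.range (sourceCounit k H))))
instance [FiniteDimensional k H] : FiniteDimensional k (CentralizerSpace k H) :=
  inferInstanceAs (FiniteDimensional k
    (Subalgebra.toSubmodule (Subalgebra.centralizer k (Set.range (sourceCounit k H)))))

/-- The inclusion `C_H(H_s) ⊆ H`. -/
noncomputable def CentralizerSpace.val : CentralizerSpace k H →ₗ[k] H :=
  (Subalgebra.centralizer k (Set.range (sourceCounit k H))).val.toLinearMap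

variable {k H}

theorem CentralizerSpace.val_injective : Function.Injective (CentralizerSpace.val k H) :=
  Subtype.val_injective

theorem CentralizerSpace.comm (b : CentralizerSpace k H) (x : H) :
    sourceCounit k H x * CentralizerSpace.val k H b =
      CentralizerSpace.val k H b * sourceCounit k H x :=
  (Subalgebra.mem_centralizer_iff k).1 b.2 _ ⟨x, rfl⟩

variable [IsRegular k H]

/-- The adjoint action on the centralizer. -/
noncomputable def CentralizerSpace.act (h : H) (b : CentralizerSpace k H) :
    CentralizerSpace k H :=
  ⟨adAction k H h (CentralizerSpace.val k H b), (Subalgebra.mem_centralizer_iff k).2 (by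
    rintro _ ⟨x, rfl⟩
    exact adAction_mem _ _ _)⟩

theorem CentralizerSpace.val_act (h : H) (b : CentralizerSpace k H) :
    CentralizerSpace.val k H (CentralizerSpace.act h b) =
      adAction k H h (CentralizerSpace.val k H b) := rfl

theorem adAction_one (b : CentralizerSpace k H) :
    adAction k H 1 (CentralizerSpace.val k H b) = CentralizerSpace.val k H b := by
  obtain ⟨s, hs⟩ := exists_rep (comul (R := k) (1 : H))
  let L : H ⊗[k] H →ₗ[k] H := TensorProduct.lift
    ((LinearMap.mul k H).compl₁₂ (LinearMap.mulRight k (CentralizerSpace.val k H b))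
      (antipode (k := k)))
  have h1 := congrArg L (rTensor_source_one (k := k) (H := H))
  have h2 := mul_antipode (k := k) (1 : H)
  have h3 := congrArg (fun t => LinearMap.mul' k H ((antipode (k := k)).lTensor H t))
    (rTensor_source_one (k := k) (H := H))
  simp only [h2, target_one] at h3
  rw [hs] at h1 h3
  rw [adAction_rep hs]
  simp only [L, map_sum, LinearMap.rTensor_tmul, TensorProduct.lift.tmul,
    LinearMap.compl₁₂_apply, LinearMap.mulRight_apply, LinearMap.mul_apply',
    LinearMap.lTensor_tmul, LinearMap.mul'_apply, CentralizerSpace.comm] at h1 h3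
  rw [← h1]
  simp only [mul_assoc]
  rw [← Finset.mul_sum, h3, mul_one]

noncomputable instance : Module H (CentralizerSpace k H) where
  smul := CentralizerSpace.act
  one_smul b := CentralizerSpace.val_injective (adAction_one b)
  mul_smul x y b := CentralizerSpace.val_injective (adAction_mul x y _)
  smul_zero x := CentralizerSpace.val_injective (by
    change adAction k H x (CentralizerSpace.val k H 0) = _
    simp)
  smul_add x b c := CentralizerSpace.val_injective (by
    change adAction k H x (CentralizerSpace.val k H (b + c)) =
      CentralizerSpace.val k H (CentralizerSpace.act x b + CentralizerSpace.act x c)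
    simp [CentralizerSpace.val_act])
  add_smul x y b := CentralizerSpace.val_injective (by
    change adAction k H (x + y) (CentralizerSpace.val k H b) =
      CentralizerSpace.val k H (CentralizerSpace.act x b + CentralizerSpace.act y b)
    simp [CentralizerSpace.val_act])
  zero_smul b := CentralizerSpace.val_injective (by
    change adAction k H 0 (CentralizerSpace.val k H b) = _
    simp)

theorem CentralizerSpace.val_smul (h : H) (b : CentralizerSpace k H) :
    CentralizerSpace.val k H (h • b) = adAction k H h (CentralizerSpace.val k H b) := rfl

instance : IsScalarTower k H (CentralizerSpace k H) where
  smul_assoc c h b := CentralizerSpace.val_injective (by simp [CentralizerSpace.val_smul])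

end Adjoint

namespace HMod
variable (k H : Type u) [Field k] [Ring H] [Algebra k H] [Coalgebra k H] [WeakHopfAlgebra k H]
  [IsRegular k H] [FiniteDimensional k H]

/-- The object `(C_H(H_s), ·_ad)` of `H-mod`. -/
noncomputable def adCentralizer : HMod k H := ⟨CentralizerSpace k H⟩

variable {k H} in
/-- An element of `(C_H(H_s), ·_ad)`, viewed in `H`. -/
noncomputable def adVal : adCentralizer k H →ₗ[k] H := CentralizerSpace.val k H

variable {H} in
/-- `b ↦ b₍₁₎ S(R²) ⊗ R¹ ·_ad b₍₂₎` -/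
noncomputable def braidedComul [Quasitriangular k H] (b : H) : H ⊗[k] H :=
  act₂ ((LinearMap.mul k H).flip ∘ₗ antipode (k := k)) (adAction k H)
    (TensorProduct.comm k H H (Quasitriangular.R (k := k) (H := H))) (comul (R := k) b)

variable {H} in
/-- `b ↦ R² S(R¹ ·_ad b)` -/
noncomputable def braidedAntipode [Quasitriangular k H] (b : H) : H :=
  LinearMap.mul' k H (TensorProduct.map LinearMap.id
    (antipode (k := k) ∘ₗ (adAction k H).flip b)
    (TensorProduct.comm k H H (Quasitriangular.R (k := k) (H := H))))

end HMod
end WeakHopfAlgebra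

namespace AutomorphismBraidedGroup
open MonoidalCategory Opposite

universe v w

section Defs
variable {C : Type w} [Category.{v} C] [MonoidalCategory C]

variable (C) in
/-- The contravariant functor `V ↦ Nat(V ⊗ id_C, id_C)`. -/
abbrev natFunctor : Cᵒᵖ ⥤ Type (max w v) := (tensoringLeft C).op ⋙ yoneda.obj (𝟭 C)

/-- For a natural isomorphism `θ_V : Hom(V, B) ≅ Nat(V ⊗ id, id)`, the natural transformation
`α = θ_B(id_B) : B ⊗ id ⟶ id`. -/
def universalAction {B : C} (θ : (natFunctor C).RepresentableBy B) : tensorLeft B ⟶ 𝟭 C :=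
  θ.homEquiv (𝟙 B)

variable (C) in
/-- The functor `(X, Y, Z) ↦ X ⊗ (Y ⊗ Z)`. -/
abbrev tensor₃ : C × C × C ⥤ C := (𝟭 C).prod (MonoidalCategory.tensor C) ⋙ MonoidalCategory.tensor C

variable [BraidedCategory C] {B : C}

/-- The map `θ²_V : Hom(V, B ⊗ B) → Nat(V ⊗ id^{⊗2}, id^{⊗2})`,
`θ²_V(t)_{X,Y} = (α_X ⊗ α_Y) (id ⊗ c_{B,X} ⊗ id) (t ⊗ id)`. -/
def theta₂ (α : tensorLeft B ⟶ 𝟭 C) (V : C) (t : V ⟶ B ⊗ B) :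
    MonoidalCategory.tensor C ⋙ tensorLeft V ⟶ MonoidalCategory.tensor C where
  app P := t ▷ (P.1 ⊗ P.2) ≫ tensorμ B B P.1 P.2 ≫ (α.app P.1 ⊗ₘ α.app P.2)
  naturality P Q f := by
    have h1 : B ◁ f.1 ≫ α.app Q.1 = α.app P.1 ≫ f.1 := α.naturality f.1
    have h2 : B ◁ f.2 ≫ α.app Q.2 = α.app P.2 ≫ f.2 := α.naturality f.2
    have h3 := tensorμ_natural_right B B f.1 f.2
    change V ◁ (f.1 ⊗ₘ f.2) ≫ _ = _ ≫ (f.1 ⊗ₘ f.2)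
    rw [whisker_exchange_assoc, reassoc_of% h3, MonoidalCategory.tensorHom_comp_tensorHom, h1, h2,
      ← MonoidalCategory.tensorHom_comp_tensorHom]
    simp only [Category.assoc]

/-- The map `θ³_V : Hom(V, B ⊗ B ⊗ B) → Nat(V ⊗ id^{⊗3}, id^{⊗3})`, obtained by moving the
factors `X`, `Y`, `Z` next to the factors `B` by means of the braiding, and letting
`α_X ⊗ α_Y ⊗ α_Z` act. -/
def theta₃ (α : tensorLeft B ⟶ 𝟭 C) (V : C) (s : V ⟶ B ⊗ (B ⊗ B)) :
    tensor₃ C ⋙ tensorLeft V ⟶ tensor₃ C where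
  app P := s ▷ (P.1 ⊗ (P.2.1 ⊗ P.2.2)) ≫ tensorμ B (B ⊗ B) P.1 (P.2.1 ⊗ P.2.2) ≫
    (α.app P.1 ⊗ₘ (tensorμ B B P.2.1 P.2.2 ≫ (α.app P.2.1 ⊗ₘ α.app P.2.2)))
  naturality P Q f := by
    have h1 : B ◁ f.1 ≫ α.app Q.1 = α.app P.1 ≫ f.1 := α.naturality f.1
    have h2 : B ◁ f.2.1 ≫ α.app Q.2.1 = α.app P.2.1 ≫ f.2.1 := α.naturality f.2.1
    have h3 : B ◁ f.2.2 ≫ α.app Q.2.2 = α.app P.2.2 ≫ f.2.2 := α.naturality f.2.2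
    have h4 := tensorμ_natural_right B B f.2.1 f.2.2
    have h5 := tensorμ_natural_right B (B ⊗ B) f.1 (f.2.1 ⊗ₘ f.2.2)
    change V ◁ (f.1 ⊗ₘ (f.2.1 ⊗ₘ f.2.2)) ≫ _ = _ ≫ (f.1 ⊗ₘ (f.2.1 ⊗ₘ f.2.2))
    rw [whisker_exchange_assoc, reassoc_of% h5, MonoidalCategory.tensorHom_comp_tensorHom, h1,
      reassoc_of% h4, MonoidalCategory.tensorHom_comp_tensorHom, h2, h3,
      ← MonoidalCategory.tensorHom_comp_tensorHom (α.app P.2.1), ← Category.assoc (tensorμ B B _ _),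
      ← MonoidalCategory.tensorHom_comp_tensorHom (α.app P.1)]
    simp only [Category.assoc]

/-- The data in the representability assumption for modules: an object `B`, a natural isomorphism
`θ_V : Hom(V, B) ≅ Nat(V ⊗ id, id)`, such that the induced maps `θ²_V` and `θ³_V` are
bijective. -/
structure ModuleRepresentation (B : C) where
  /-- the natural isomorphism `θ` -/
  θ : (natFunctor C).RepresentableBy B
  bijective_theta₂ : ∀ V : C, Function.Bijective (theta₂ (universalAction θ) V)
  bijective_theta₃ : ∀ V : C, Function.Bijective (theta₃ (universalAction θ) V)

/-- The canonical action `α_X : B ⊗ X ⟶ X`. -/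
def ModuleRepresentation.α (ρ : ModuleRepresentation B) (X : C) : B ⊗ X ⟶ X :=
  (universalAction ρ.θ).app X

variable (C) in
/-- The representability assumption for modules. -/
def RepresentabilityAssumption : Prop := ∃ B : C, Nonempty (ModuleRepresentation B)

variable [RightRigidCategory C]

open MonObj ComonObj HopfObj in
/-- The Hopf algebra `B` in `C` is the automorphism braided group of `C`: `B` represents
`V ↦ Nat(V ⊗ id, id)` as in the representability assumption, and its structure maps are the ones
determined by the canonical action `α`. The dual `X^*` used for the antipode has
`ev : X^* ⊗ X ⟶ 1` and `coev : 1 ⟶ X ⊗ X^*`. -/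
structure IsAutomorphismBraidedGroup (ρ : ModuleRepresentation B) [HopfObj B] : Prop where
  /-- `θ_{B ⊗ B}(m)_X = α_X (id_B ⊗ α_X)` -/
  mul_act : ∀ X : C, μ[B] ▷ X ≫ ρ.α X = (α_ B B X).hom ≫ B ◁ ρ.α X ≫ ρ.α X
  /-- `θ_1(u)_X = id_X` -/
  one_act : ∀ X : C, η[B] ▷ X ≫ ρ.α X = (λ_ X).hom
  /-- `θ²_B(Δ)_{X,Y} = α_{X ⊗ Y}` -/
  comul_act : ∀ X Y : C,
    (theta₂ (universalAction ρ.θ) B Δ[B]).app (X, Y) = ρ.α (X ⊗ Y)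
  /-- `ε = α_1` -/
  counit_eq : ε[B] = (ρ_ B).inv ≫ ρ.α (𝟙_ C)
  /-- `θ_B(S)_X` is the composite
  `B ⊗ X → B ⊗ X ⊗ X^* ⊗ X → X ⊗ B ⊗ X^* ⊗ X → X ⊗ X^* ⊗ X → X`
  of `coev_X`, `c_{B,X}`, `α_{X^*}` and `ev_X`. -/
  antipode_act : ∀ X : C, 𝒮[B] ▷ X ≫ ρ.α X =
    B ◁ ((λ_ X).inv ≫ (η_ X Xᘁ) ▷ X ≫ (α_ X Xᘁ X).hom) ≫ (α_ B X (Xᘁ ⊗ X)).inv ≫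
      (β_ B X).hom ▷ (Xᘁ ⊗ X) ≫ (α_ X B (Xᘁ ⊗ X)).hom ≫
        X ◁ ((α_ B Xᘁ X).inv ≫ ρ.α Xᘁ ▷ X ≫ ε_ X Xᘁ) ≫ (ρ_ X).hom

end Defs
end AutomorphismBraidedGroup

open MonoidalCategory WeakHopfAlgebra WeakHopfAlgebra.HMod AutomorphismBraidedGroup

/-!
Write `B = C_H(H_s)` with the adjoint action. The proof is Tannaka reconstruction, carried out by
evaluating natural transformations at `1` in the regular module `H`.

*Representability.* A transformation `e : V ⊗ id ⟶ id` satisfies `e_X(v ⊗ x) = w(v) x` with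
`w(v) = e_H(v ⊗ 1)`, by naturality along `H ⟶ X`, `h ↦ h x`. Since `y (v ⊗ 1) = v ⊗ y` for
`y ∈ H_s` in the truncated tensor product, `w(v)` lies in `B`, and
`h₍₁₎ (v ⊗ S(h₍₂₎)) = h v ⊗ 1` shows that `w` intertwines the action of `H` on `V` with the adjoint
action (`isUniversalAction_canonicalAction`). The bijectivity of `θ²` and `θ³` is then formal: in a
braided category with duals, the tensor product of two universal actions is universal
(`IsUniversalAction.tensor`), because a dual of `W` turns transformations `V ⊗ F ⟶ W ⊗ F` into
transformations `(W^* ⊗ V) ⊗ F ⟶ F`.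

*Structure maps.* Universality yields the product, unit, coproduct and antipode as the morphisms
with the prescribed actions. The bialgebra axioms hold because both sides act in the same way
(`IsSeparatingAction.bimonObj`). Evaluation at `1 ∈ H` gives the product, the unit and the counit.

*Coproduct.* The element `c ⊗ d` of `B ⊗_t B`, acting on `1 ⊗ 1` in `H ⊗_t H`, gives
`c R² ⊗ R¹ ·_ad d` (`actOnOne_tm`), whereas `Δ_B(b)` has to give `Δ(b)` (`actOnOne_comul`).
The axiom `(id ⊗ Δ)R = R₁₃ R₁₂` shows that `a ⊗ d ↦ a S(R²) ⊗ R¹ ·_ad d` undoes the former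
(`unbraid_actOnOne`), which is the formula for `Δ_B`.

*Antipode.* The composite through `X ⊗ X^*` that defines `S_B` acts as `R² S(R¹ ·_ad b)`
(`antipodeAction_tm`); the truncations cancel since this element commutes with `H_s`
(`source_mul_braidedAntipode`). In terms of the values at `1 ⊗ 1` the map `m_B (id ⊗ S_B)` is
`x ⊗ y ↦ x S(y)`, so that `b₍₁₎ S(b₍₂₎) = ε_t(b)` is one of the two antipode axioms. The other
one follows because a one-sided inverse in the finite-dimensional convolution algebra is
two-sided (`conv_mul_eq_one_symm`).
-/

/-! ### Universal actions and their tensor products -/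

namespace AutomorphismBraidedGroup

section UniversalAction
universe v w v₁ w₁ v₂ w₂

variable {C : Type w} [Category.{v} C] [MonoidalCategory C]
  {D : Type w₁} [Category.{v₁} D] {E : Type w₂} [Category.{v₂} E]

/-- The transformation `V ⊗ F ⟶ F` obtained from `t : V ⟶ A` and an action
`β : A ⊗ F ⟶ F` of the object `A` on the functor `F`. -/
def actVia {F : D ⥤ C} {A : C} (β : F ⋙ tensorLeft A ⟶ F) {V : C} (t : V ⟶ A) :
    F ⋙ tensorLeft V ⟶ F where
  app P := t ▷ F.obj P ≫ β.app P
  naturality P Q f := by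
    have h : A ◁ F.map f ≫ β.app Q = β.app P ≫ F.map f := β.naturality f
    change V ◁ F.map f ≫ _ = _ ≫ F.map f
    rw [whisker_exchange_assoc, h, Category.assoc]

/-- The action `β : A ⊗ F ⟶ F` is universal: every `V ⊗ F ⟶ F` comes from a unique `V ⟶ A`. -/
def IsUniversalAction {F : D ⥤ C} {A : C} (β : F ⋙ tensorLeft A ⟶ F) : Prop :=
  ∀ V : C, Function.Bijective (actVia β (V := V))

theorem IsUniversalAction.ext {F : D ⥤ C} {A : C} {β : F ⋙ tensorLeft A ⟶ F}
    (hβ : IsUniversalAction β) {V : C} {s t : V ⟶ A}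
    (h : ∀ P, s ▷ F.obj P ≫ β.app P = t ▷ F.obj P ≫ β.app P) : s = t :=
  (hβ V).1 (NatTrans.ext (funext h))

theorem IsUniversalAction.exists_act {F : D ⥤ C} {A : C} {β : F ⋙ tensorLeft A ⟶ F}
    (hβ : IsUniversalAction β) {V : C} (e : ∀ P, V ⊗ F.obj P ⟶ F.obj P)
    (he : ∀ {P Q : D} (f : P ⟶ Q), V ◁ F.map f ≫ e Q = e P ≫ F.map f) :
    ∃ t : V ⟶ A, ∀ P, t ▷ F.obj P ≫ β.app P = e P := by
  obtain ⟨t, ht⟩ := (hβ V).2 { app := e, naturality := fun _ _ f => he f }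
  exact ⟨t, fun P => congrArg (fun η => η.app P) ht⟩

/-- Transposing along the duality of `W` is compatible with letting `A` act on `F`. -/
theorem symm_tensorLeftHomEquiv_act {F : D ⥤ C} {A : C} (β : F ⋙ tensorLeft A ⟶ F) {V W W' : C}
    [ExactPairing W W'] (t : V ⟶ W ⊗ A) (P : D) :
    (tensorLeftHomEquiv (V ⊗ F.obj P) W W' (F.obj P)).symm
        (t ▷ F.obj P ≫ (α_ _ _ _).hom ≫ W ◁ β.app P) =
      (α_ _ _ _).inv ≫ (tensorLeftHomEquiv V W W' A).symm t ▷ F.obj P ≫ β.app P := by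
  have h := tensorLeftHomEquiv_tensor (X := V) (Y := W) (Y' := W') (Z := A) t (𝟙 (F.obj P))
  have h2 := tensorLeftHomEquiv_naturality (Y := W) (Y' := W')
    ((tensorLeftHomEquiv (V ⊗ F.obj P) W W' (A ⊗ F.obj P)).symm
    ((t ⊗ₘ 𝟙 (F.obj P)) ≫ (α_ _ _ _).hom)) (β.app P)
  rw [Equiv.symm_apply_eq]
  rw [Equiv.apply_symm_apply, h] at h2
  simpa using h2.symm

/-- If `A` acts universally on `F`, and `W` has a dual, then transformations `V ⊗ F ⟶ W ⊗ F`
correspond to morphisms `V ⟶ W ⊗ A`. -/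
theorem IsUniversalAction.existsUnique_whisker [RightRigidCategory C] {F : D ⥤ C} {A : C}
    {β : F ⋙ tensorLeft A ⟶ F} (hβ : IsUniversalAction β) {V W : C}
    (η : ∀ P, V ⊗ F.obj P ⟶ W ⊗ F.obj P)
    (hη : ∀ {P Q : D} (f : P ⟶ Q), V ◁ F.map f ≫ η Q = η P ≫ W ◁ F.map f) :
    ∃! t : V ⟶ W ⊗ A, ∀ P, t ▷ F.obj P ≫ (α_ _ _ _).hom ≫ W ◁ β.app P = η P := by
  let e : ∀ P, (Wᘁ ⊗ (V ⊗ F.obj P) ⟶ F.obj P) ≃ (V ⊗ F.obj P ⟶ W ⊗ F.obj P) := fun P =>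
    tensorLeftHomEquiv (V ⊗ F.obj P) W Wᘁ (F.obj P)
  let η' : F ⋙ tensorLeft (Wᘁ ⊗ V) ⟶ F :=
    { app := fun P => (α_ _ _ _).hom ≫ (e P).symm (η P)
      naturality := fun P Q f => by
        have h1 : (e P).symm (η P) ≫ F.map f = (e P).symm (η P) ≫ F.map f := rfl
        have h2 : (tensorLeftHomEquiv (V ⊗ F.obj P) W Wᘁ (F.obj Q)).symm (η P ≫ W ◁ F.map f) =
            (e P).symm (η P) ≫ F.map f := by
          rw [Equiv.symm_apply_eq, tensorLeftHomEquiv_naturality, Equiv.apply_symm_apply]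
        rw [← hη, tensorLeftHomEquiv_symm_naturality] at h2
        change (Wᘁ ⊗ V) ◁ F.map f ≫ _ = _ ≫ F.map f
        rw [Category.assoc, ← h2]
        simp [e] }
  have key : ∀ t : V ⟶ W ⊗ A, (∀ P, t ▷ F.obj P ≫ (α_ _ _ _).hom ≫ W ◁ β.app P = η P) ↔
      actVia β ((tensorLeftHomEquiv V W Wᘁ A).symm t) = η' := by
    intro t
    rw [NatTrans.ext_iff, funext_iff]
    refine forall_congr' fun P => ?_
    rw [← (e P).symm.injective.eq_iff, symm_tensorLeftHomEquiv_act β t P]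
    simp [actVia, η', Iso.inv_comp_eq]
  obtain ⟨s, hs⟩ := (hβ (Wᘁ ⊗ V)).2 η'
  refine ⟨tensorLeftHomEquiv V W Wᘁ A s, (key _).2 (by simpa using hs), fun t ht => ?_⟩
  rw [← Equiv.symm_apply_eq]
  exact (hβ _).1 (((key t).1 ht).trans hs.symm)

variable [BraidedCategory C]

/-- For actions of `A₁` on `F₁` and of `A₂` on `F₂`, the action of `A₁ ⊗ A₂` on `F₁ ⊗ F₂` which
moves `F₁` past `A₂` by means of the braiding. -/
def tensorAction {F₁ : D ⥤ C} {F₂ : E ⥤ C} {A₁ A₂ : C} (β₁ : F₁ ⋙ tensorLeft A₁ ⟶ F₁)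
    (β₂ : F₂ ⋙ tensorLeft A₂ ⟶ F₂) :
    (F₁.prod F₂ ⋙ tensor C) ⋙ tensorLeft (A₁ ⊗ A₂) ⟶ F₁.prod F₂ ⋙ tensor C where
  app P := tensorμ A₁ A₂ (F₁.obj P.1) (F₂.obj P.2) ≫ (β₁.app P.1 ⊗ₘ β₂.app P.2)
  naturality P Q f := by
    have h1 : A₁ ◁ F₁.map f.1 ≫ β₁.app Q.1 = β₁.app P.1 ≫ F₁.map f.1 := β₁.naturality f.1
    have h2 : A₂ ◁ F₂.map f.2 ≫ β₂.app Q.2 = β₂.app P.2 ≫ F₂.map f.2 := β₂.naturality f.2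
    change (A₁ ⊗ A₂) ◁ (F₁.map f.1 ⊗ₘ F₂.map f.2) ≫ _ = _ ≫ (F₁.map f.1 ⊗ₘ F₂.map f.2)
    rw [tensorμ_natural_right_assoc, tensorHom_comp_tensorHom, h1, h2, Category.assoc,
      tensorHom_comp_tensorHom]

/-- Acting with `A₂` first and then moving it past `F₁` is the same as exchanging `A₁` and `A₂`
and moving `F₁` past `A₂` before `A₁` acts. -/
theorem braid_tensorAction_aux {A₁ A₂ X Y : C} (b₁ : A₁ ⊗ X ⟶ X) (b₂ : A₂ ⊗ Y ⟶ Y) :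
    (β_ A₂ A₁).hom ▷ (X ⊗ Y) ≫ tensorμ A₁ A₂ X Y ≫ (b₁ ⊗ₘ b₂) =
      (α_ _ _ _).inv ≫ ((α_ _ _ _).hom ≫ A₂ ◁ b₁ ≫ (β_ A₂ X).hom) ▷ Y ≫
        (α_ _ _ _).hom ≫ X ◁ b₂ := by
  have h : A₂ ◁ b₁ ≫ (β_ A₂ X).hom = (β_ A₂ (A₁ ⊗ X)).hom ≫ b₁ ▷ A₂ := by simp
  rw [h, BraidedCategory.braiding_tensor_right_hom, MonoidalCategory.tensorHom_def, tensorμ]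
  simp only [Category.assoc, Iso.hom_inv_id_assoc, comp_whiskerRight]
  monoidal

/-- The tensor product of two universal actions is universal. -/
theorem IsUniversalAction.tensor [RightRigidCategory C] {F₁ : D ⥤ C} {F₂ : E ⥤ C} {A₁ A₂ : C}
    {β₁ : F₁ ⋙ tensorLeft A₁ ⟶ F₁} {β₂ : F₂ ⋙ tensorLeft A₂ ⟶ F₂}
    (h₁ : IsUniversalAction β₁) (h₂ : IsUniversalAction β₂) :
    IsUniversalAction (tensorAction β₁ β₂) := by
  -- a transformation `V ⊗ F₁ ⟶ F₁ ⊗ A₂`, read as `V ⊗ F₁ ⟶ A₂ ⊗ F₁`, gives `V ⟶ A₂ ⊗ A₁`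
  let Φ : ∀ {V : C} (t : V ⟶ A₁ ⊗ A₂) (X : D), V ⊗ F₁.obj X ⟶ F₁.obj X ⊗ A₂ := fun t X =>
    (t ≫ (β_ A₂ A₁).inv) ▷ F₁.obj X ≫ (α_ _ _ _).hom ≫ A₂ ◁ β₁.app X ≫ (β_ A₂ (F₁.obj X)).hom
  have hΦ : ∀ {V : C} (t : V ⟶ A₁ ⊗ A₂) (X : D) (Y : E), (actVia (tensorAction β₁ β₂) t).app (X, Y) =
      (α_ V (F₁.obj X) (F₂.obj Y)).inv ≫ Φ t X ▷ F₂.obj Y ≫ (α_ _ _ _).hom ≫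
        F₁.obj X ◁ β₂.app Y := by
    intro V t X Y
    have h := braid_tensorAction_aux (β₁.app X) (β₂.app Y)
    change t ▷ (F₁.obj X ⊗ F₂.obj Y) ≫ tensorμ _ _ _ _ ≫ (β₁.app X ⊗ₘ β₂.app Y) = _
    have h' : t = (t ≫ (β_ A₂ A₁).inv) ≫ (β_ A₂ A₁).hom := by simp
    conv_lhs => rw [h']
    rw [comp_whiskerRight, Category.assoc, h]
    simp only [Φ, comp_whiskerRight, Category.assoc]
    simp
  have hinj : ∀ {V : C} {s t : V ⟶ A₁ ⊗ A₂}, (∀ X, Φ s X = Φ t X) → s = t := by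
    intro V s t h
    rw [← cancel_mono (β_ A₂ A₁).inv]
    obtain ⟨r, -, hr⟩ := h₁.existsUnique_whisker (W := A₂)
      (fun X => (t ≫ (β_ A₂ A₁).inv) ▷ F₁.obj X ≫ (α_ _ _ _).hom ≫ A₂ ◁ β₁.app X)
      (fun {P Q} f => by
        have : A₁ ◁ F₁.map f ≫ β₁.app Q = β₁.app P ≫ F₁.map f := β₁.naturality f
        rw [whisker_exchange_assoc]
        simp [← whiskerLeft_comp, this])
    refine (hr _ fun X => ?_).trans (hr _ fun X => rfl).symm
    have := h X
    simp only [Φ, ← Category.assoc, cancel_mono] at this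
    simpa only [← Category.assoc] using this
  have hnat : ∀ {V : C} (P : D) {s t : V ⟶ F₁.obj P ⊗ A₂},
      (∀ Y, s ▷ F₂.obj Y ≫ (α_ _ _ _).hom ≫ F₁.obj P ◁ β₂.app Y =
        t ▷ F₂.obj Y ≫ (α_ _ _ _).hom ≫ F₁.obj P ◁ β₂.app Y) → s = t := by
    intro V P s t h
    obtain ⟨r, -, hr⟩ := h₂.existsUnique_whisker
      (fun Y => t ▷ F₂.obj Y ≫ (α_ _ _ _).hom ≫ F₁.obj P ◁ β₂.app Y)
      (fun {Y Z} f => by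
        have : A₂ ◁ F₂.map f ≫ β₂.app Z = β₂.app Y ≫ F₂.map f := β₂.naturality f
        rw [whisker_exchange_assoc]
        simp [← whiskerLeft_comp, this])
    exact (hr _ h).trans (hr _ fun Y => rfl).symm
  intro V
  refine ⟨fun s t h => hinj fun X => hnat X fun Y => ?_, fun η => ?_⟩
  · have := congrArg (fun η => η.app (X, Y)) h
    simp only [hΦ] at this
    exact (cancel_epi _).1 this
  · obtain ⟨e, he⟩ : ∃ e : ∀ X Y, V ⊗ (F₁.obj X ⊗ F₂.obj Y) ⟶ F₁.obj X ⊗ F₂.obj Y,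
      ∀ X Y, η.app (X, Y) = e X Y := ⟨fun X Y => η.app (X, Y), fun _ _ => rfl⟩
    have hη : ∀ {X X' : D} {Y Y' : E} (f : X ⟶ X') (g : Y ⟶ Y'),
        V ◁ (F₁.map f ⊗ₘ F₂.map g) ≫ e X' Y' = e X Y ≫ (F₁.map f ⊗ₘ F₂.map g) :=
      fun {X X' Y Y'} f g => by
        simp only [← he]
        exact η.naturality (X := (X, Y)) (Y := (X', Y')) (f, g)
    have hτ := fun X => h₂.existsUnique_whisker (V := V ⊗ F₁.obj X) (W := F₁.obj X)
      (fun Y => (α_ V (F₁.obj X) (F₂.obj Y)).hom ≫ e X Y)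
      (fun {Y Y'} g => by
        have := hη (𝟙 X) g
        simp only [CategoryTheory.Functor.map_id, id_tensorHom] at this
        rw [Category.assoc, ← this]
        simp)
    choose τ hτ _ using hτ
    have hτn : ∀ {X X' : D} (f : X ⟶ X'), V ◁ F₁.map f ≫ τ X' = τ X ≫ F₁.map f ▷ A₂ := by
      intro X X' f
      refine hnat X' fun Y => ?_
      have h1 := hη f (𝟙 Y)
      simp only [CategoryTheory.Functor.map_id, tensorHom_id] at h1
      rw [comp_whiskerRight, Category.assoc, hτ, comp_whiskerRight, Category.assoc,
        associator_naturality_left_assoc, ← whisker_exchange, ← Category.assoc (α_ _ _ _).hom,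
        ← Category.assoc (τ X ▷ _), hτ]
      rw [Category.assoc, ← h1]
      simp
    obtain ⟨t, ht, -⟩ := h₁.existsUnique_whisker (V := V) (W := A₂)
      (fun X => τ X ≫ (β_ A₂ (F₁.obj X)).inv)
      (fun {X X'} f => by
        rw [← Category.assoc, hτn, Category.assoc, Category.assoc]
        simp)
    refine ⟨t ≫ (β_ A₂ A₁).hom, NatTrans.ext (funext fun ⟨X, Y⟩ => ?_)⟩
    have h : Φ (t ≫ (β_ A₂ A₁).hom) X = τ X := by
      have := ht X
      rw [Iso.eq_comp_inv] at this
      simpa [Φ] using this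
    rw [hΦ, h, hτ, he]
    simp

theorem bijective_theta₂_of_isUniversalAction [RightRigidCategory C] {B : C}
    {α : tensorLeft B ⟶ 𝟭 C} (h : IsUniversalAction (F := 𝟭 C) α) (V : C) :
    Function.Bijective (theta₂ α V) :=
  (h.tensor h) V

theorem bijective_theta₃_of_isUniversalAction [RightRigidCategory C] {B : C}
    {α : tensorLeft B ⟶ 𝟭 C} (h : IsUniversalAction (F := 𝟭 C) α) (V : C) :
    Function.Bijective (theta₃ α V) :=
  (h.tensor (h.tensor h)) V

end UniversalAction
end AutomorphismBraidedGroup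

/-! ### Bialgebra structure from a separating action -/

namespace AutomorphismBraidedGroup

section Reconstruction
universe v w
variable {C : Type w} [Category.{v} C] [MonoidalCategory C] [BraidedCategory C]

/-- The action of a morphism `V ⟶ B ⊗ B` on `X ⊗ Y`. -/
def actVia₂ {B V X Y : C} (a : B ⊗ X ⟶ X) (b : B ⊗ Y ⟶ Y) (t : V ⟶ B ⊗ B) :
    V ⊗ (X ⊗ Y) ⟶ X ⊗ Y :=
  t ▷ (X ⊗ Y) ≫ tensorμ B B X Y ≫ (a ⊗ₘ b)

/-- A natural action `a_X : B ⊗ X ⟶ X` on all objects such that morphisms into `B`, `B ⊗ B` and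
`B ⊗ B ⊗ B` are determined by the induced actions. -/
structure IsSeparatingAction {B : C} (a : ∀ X : C, B ⊗ X ⟶ X) : Prop where
  naturality : ∀ {X Y : C} (f : X ⟶ Y), B ◁ f ≫ a Y = a X ≫ f
  ext : ∀ {V : C} {s t : V ⟶ B}, (∀ X, s ▷ X ≫ a X = t ▷ X ≫ a X) → s = t
  ext₂ : ∀ {V : C} {s t : V ⟶ B ⊗ B},
    (∀ X Y, actVia₂ (a X) (a Y) s = actVia₂ (a X) (a Y) t) → s = t
  ext₃ : ∀ {V : C} {s t : V ⟶ B ⊗ (B ⊗ B)},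
    (∀ X Y Z, s ▷ (X ⊗ (Y ⊗ Z)) ≫ tensorμ B (B ⊗ B) X (Y ⊗ Z) ≫
        (a X ⊗ₘ (tensorμ B B Y Z ≫ (a Y ⊗ₘ a Z))) =
      t ▷ (X ⊗ (Y ⊗ Z)) ≫ tensorμ B (B ⊗ B) X (Y ⊗ Z) ≫
        (a X ⊗ₘ (tensorμ B B Y Z ≫ (a Y ⊗ₘ a Z)))) → s = t

namespace IsSeparatingAction
variable {B : C} {a : ∀ X : C, B ⊗ X ⟶ X} (ha : IsSeparatingAction a) {d : B ⟶ B ⊗ B}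
include ha

theorem comul_assoc (hd : ∀ X Y, actVia₂ (a X) (a Y) d = a (X ⊗ Y)) :
    d ≫ B ◁ d = d ≫ d ▷ B ≫ (α_ B B B).hom := by
  refine ha.ext₃ fun X Y Z => ?_
  simp only [actVia₂] at hd
  trans a (X ⊗ (Y ⊗ Z))
  · rw [← hd X, ← hd Y Z, ← id_tensorHom, comp_whiskerRight, Category.assoc,
      tensorμ_natural_left_assoc, tensorHom_comp_tensorHom, id_whiskerRight, Category.id_comp]
  · have h : (α_ B B B).hom ▷ (X ⊗ (Y ⊗ Z)) =
        ((B ⊗ B) ⊗ B) ◁ (α_ X Y Z).inv ≫ ((α_ B B B).hom ⊗ₘ (α_ X Y Z).hom) := by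
      rw [MonoidalCategory.tensorHom_def', ← whiskerLeft_comp_assoc]
      simp
    have h1 : (a X ⊗ₘ (tensorμ B B Y Z ≫ (a Y ⊗ₘ a Z))) =
        (B ⊗ X) ◁ tensorμ B B Y Z ≫ (a X ⊗ₘ (a Y ⊗ₘ a Z)) := by
      rw [← id_tensorHom, tensorHom_comp_tensorHom, Category.id_comp]
    rw [comp_whiskerRight, comp_whiskerRight, Category.assoc, Category.assoc, h, Category.assoc, h1,
      ← Category.assoc (tensorμ B (B ⊗ B) X (Y ⊗ Z)),
      ← Category.assoc ((α_ B B B).hom ⊗ₘ _), ← associator_monoidal]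
    simp only [Category.assoc]
    rw [← associator_naturality, ← whisker_exchange_assoc, ← whisker_exchange_assoc,
      ← tensorHom_id d B, tensorμ_natural_left_assoc, ← tensorHom_id (tensorμ B B X Y),
      tensorHom_comp_tensorHom_assoc, tensorHom_comp_tensorHom_assoc]
    simp only [id_whiskerRight, Category.id_comp, Category.assoc]
    rw [hd X Y, reassoc_of% (hd (X ⊗ Y) Z), ← ha.naturality]
    simp

theorem counit_comul (hd : ∀ X Y, actVia₂ (a X) (a Y) d = a (X ⊗ Y)) :
    d ≫ ((ρ_ B).inv ≫ a (𝟙_ C)) ▷ B = (λ_ B).inv := by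
  rw [← cancel_mono (λ_ B).hom]
  obtain ⟨e, he⟩ : ∃ e, e = (ρ_ B).inv ≫ a (𝟙_ C) := ⟨_, rfl⟩
  have he' : a (𝟙_ C) = e ▷ 𝟙_ C ≫ (λ_ (𝟙_ C)).hom := by
    rw [unitors_equal, rightUnitor_naturality, he]; simp
  rw [← he]
  refine ha.ext fun X => ?_
  rw [← cancel_epi (B ◁ (λ_ X).hom)]
  have h1 : (a (𝟙_ C) ⊗ₘ a X) ≫ (λ_ X).hom =
      (e ▷ 𝟙_ C ⊗ₘ 𝟙 B ▷ X) ≫ (λ_ (𝟙_ C)).hom ▷ (B ⊗ X) ≫ (λ_ (B ⊗ X)).hom ≫ a X := by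
    rw [he', ← leftUnitor_naturality, ← tensorHom_id (λ_ _).hom, ← id_tensorHom _ (a X),
      tensorHom_comp_tensorHom_assoc, tensorHom_comp_tensorHom_assoc]
    simp only [id_whiskerRight, Category.id_comp, Category.comp_id]
  have h2 := hd (𝟙_ C) X =≫ (λ_ X).hom
  rw [← ha.naturality, actVia₂, Category.assoc, Category.assoc, h1,
    ← tensorμ_natural_left_assoc, ← leftUnitor_monoidal_assoc] at h2
  simp only [Iso.inv_hom_id, id_whiskerRight, Category.id_comp]
  rw [← h2]
  simp [MonoidalCategory.tensorHom_def]

theorem comul_counit (hd : ∀ X Y, actVia₂ (a X) (a Y) d = a (X ⊗ Y)) :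
    d ≫ B ◁ ((ρ_ B).inv ≫ a (𝟙_ C)) = (ρ_ B).inv := by
  rw [← cancel_mono (ρ_ B).hom]
  obtain ⟨e, he⟩ : ∃ e, e = (ρ_ B).inv ≫ a (𝟙_ C) := ⟨_, rfl⟩
  have he' : a (𝟙_ C) = e ▷ 𝟙_ C ≫ (λ_ (𝟙_ C)).hom := by
    rw [unitors_equal, rightUnitor_naturality, he]; simp
  rw [← he]
  refine ha.ext fun X => ?_
  rw [← cancel_epi (B ◁ (ρ_ X).hom)]
  have h1 : (a X ⊗ₘ a (𝟙_ C)) ≫ (ρ_ X).hom =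
      (𝟙 B ▷ X ⊗ₘ e ▷ 𝟙_ C) ≫ (B ⊗ X) ◁ (λ_ (𝟙_ C)).hom ≫ (ρ_ (B ⊗ X)).hom ≫ a X := by
    rw [he', ← rightUnitor_naturality, ← id_tensorHom _ (λ_ _).hom, ← tensorHom_id (a X),
      tensorHom_comp_tensorHom_assoc, tensorHom_comp_tensorHom_assoc]
    simp only [id_whiskerRight, Category.id_comp, Category.comp_id]
  have h2 := hd X (𝟙_ C) =≫ (ρ_ X).hom
  rw [← ha.naturality, actVia₂, Category.assoc, Category.assoc, h1,
    ← tensorμ_natural_left_assoc, ← rightUnitor_monoidal_assoc] at h2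
  simp only [Iso.inv_hom_id, id_whiskerRight, Category.id_comp]
  rw [← h2]
  simp [MonoidalCategory.tensorHom_def]

theorem mul_assoc {m : B ⊗ B ⟶ B}
    (hm : ∀ X, m ▷ X ≫ a X = (α_ B B X).hom ≫ B ◁ a X ≫ a X) :
    m ▷ B ≫ m = (α_ B B B).hom ≫ B ◁ m ≫ m := by
  refine ha.ext fun X => ?_
  have h : ∀ X, B ◁ m ▷ X ≫ B ◁ a X = B ◁ (α_ B B X).hom ≫ B ◁ B ◁ a X ≫ B ◁ a X := fun X => by
    simp only [← whiskerLeft_comp, hm]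
  rw [comp_whiskerRight, Category.assoc, hm, associator_naturality_left_assoc,
    ← whisker_exchange_assoc, hm]
  simp only [comp_whiskerRight, Category.assoc, hm, whisker_assoc, Iso.inv_hom_id_assoc,
    reassoc_of% h]
  simp

theorem one_mul {m : B ⊗ B ⟶ B} {u : 𝟙_ C ⟶ B}
    (hm : ∀ X, m ▷ X ≫ a X = (α_ B B X).hom ≫ B ◁ a X ≫ a X)
    (hu : ∀ X, u ▷ X ≫ a X = (λ_ X).hom) : u ▷ B ≫ m = (λ_ B).hom := by
  refine ha.ext fun X => ?_
  rw [comp_whiskerRight, Category.assoc, hm, associator_naturality_left_assoc,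
    ← whisker_exchange_assoc, hu]
  simp

theorem mul_one {m : B ⊗ B ⟶ B} {u : 𝟙_ C ⟶ B}
    (hm : ∀ X, m ▷ X ≫ a X = (α_ B B X).hom ≫ B ◁ a X ≫ a X)
    (hu : ∀ X, u ▷ X ≫ a X = (λ_ X).hom) : B ◁ u ≫ m = (ρ_ B).hom := by
  refine ha.ext fun X => ?_
  have h : B ◁ u ▷ X ≫ B ◁ a X = B ◁ (λ_ X).hom := by rw [← whiskerLeft_comp, hu]
  rw [comp_whiskerRight, Category.assoc, hm]
  simp [reassoc_of% h]

theorem mul_comul (hd : ∀ X Y, actVia₂ (a X) (a Y) d = a (X ⊗ Y))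
    {m : B ⊗ B ⟶ B}
    (hm : ∀ X, m ▷ X ≫ a X = (α_ B B X).hom ≫ B ◁ a X ≫ a X) :
    m ≫ d = (d ⊗ₘ d) ≫ tensorμ B B B B ≫ (m ⊗ₘ m) := by
  refine ha.ext₂ fun X Y => ?_
  simp only [actVia₂] at hd ⊢
  trans (α_ B B (X ⊗ Y)).hom ≫ B ◁ a (X ⊗ Y) ≫ a (X ⊗ Y)
  · rw [comp_whiskerRight, Category.assoc, hd, hm]
  · simp only [comp_whiskerRight, Category.assoc]
    rw [tensorμ_natural_left_assoc, tensorHom_comp_tensorHom, hm, hm,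
      ← tensorHom_comp_tensorHom, reassoc_of% (tensor_associativity B B B B X Y),
      ← tensorHom_comp_tensorHom (B ◁ a X), ← tensorμ_natural_right_assoc, ← hd X Y,
      MonoidalCategory.tensorHom_def' d d, comp_whiskerRight, Category.assoc,
      associator_naturality_left_assoc, ← whisker_exchange_assoc, ← whisker_exchange_assoc,
      associator_naturality_middle_assoc]
    simp

theorem one_comul (hd : ∀ X Y, actVia₂ (a X) (a Y) d = a (X ⊗ Y))
    {u : 𝟙_ C ⟶ B}
    (h1 : ∀ X, u ▷ X ≫ a X = (λ_ X).hom) : u ≫ d = (λ_ (𝟙_ C)).inv ≫ (u ⊗ₘ u) := by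
  refine ha.ext₂ fun X Y => ?_
  simp only [actVia₂] at hd ⊢
  rw [comp_whiskerRight, Category.assoc, hd, h1, comp_whiskerRight, Category.assoc,
    tensorμ_natural_left_assoc, tensorHom_comp_tensorHom, h1, h1, tensor_left_unitality]

omit ha [BraidedCategory C] in
theorem mul_counit {m : B ⊗ B ⟶ B}
    (hm : m ▷ 𝟙_ C ≫ a (𝟙_ C) = (α_ B B (𝟙_ C)).hom ≫ B ◁ a (𝟙_ C) ≫ a (𝟙_ C)) :
    m ≫ (ρ_ B).inv ≫ a (𝟙_ C) =
      (((ρ_ B).inv ≫ a (𝟙_ C)) ⊗ₘ ((ρ_ B).inv ≫ a (𝟙_ C))) ≫ (λ_ (𝟙_ C)).hom := by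
  rw [rightUnitor_inv_naturality_assoc, hm, unitors_equal, MonoidalCategory.tensorHom_def']
  simp

/-- The bialgebra structure determined by a separating action: the product corresponds to acting
twice, the coproduct to acting on a tensor product, and the counit is the action on the unit
object. -/
@[reducible]
def bimonObj {m : B ⊗ B ⟶ B} (hm : ∀ X, m ▷ X ≫ a X = (α_ B B X).hom ≫ B ◁ a X ≫ a X)
    {u : 𝟙_ C ⟶ B} (hu : ∀ X, u ▷ X ≫ a X = (λ_ X).hom)
    (hd : ∀ X Y, actVia₂ (a X) (a Y) d = a (X ⊗ Y)) : BimonObj B where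
  mul := m
  one := u
  mul_assoc := ha.mul_assoc hm
  one_mul := ha.one_mul hm hu
  mul_one := ha.mul_one hm hu
  comul := d
  counit := (ρ_ B).inv ≫ a (𝟙_ C)
  counit_comul := ha.counit_comul hd
  comul_counit := ha.comul_counit hd
  comul_assoc := ha.comul_assoc hd
  mul_comul := ha.mul_comul hd hm
  one_comul := ha.one_comul hd hu
  mul_counit := mul_counit (hm _)
  one_counit := by
    rw [rightUnitor_inv_naturality_assoc, hu, unitors_equal, Iso.inv_hom_id]

end IsSeparatingAction
end Reconstruction
end AutomorphismBraidedGroup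

/-! ### The adjoint action and the canonical action of the centralizer -/

namespace WeakHopfAlgebra

section Adjoint
variable {k H : Type u} [Field k] [Ring H] [Algebra k H] [Coalgebra k H] [WeakHopfAlgebra k H]

variable (k H) in
/-- The map `x ⊗ y ↦ (b ↦ x b S(y))`, through which the adjoint action factors. -/
noncomputable def sandwich : H ⊗[k] H →ₗ[k] Module.End k H :=
  TensorProduct.lift ((LinearMap.mul k (Module.End k H)).compl₁₂ (LinearMap.mul k H)
    ((LinearMap.mul k H).flip ∘ₗ antipode (k := k)))

@[simp]
theorem sandwich_tmul (x y b : H) :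
    sandwich k H (x ⊗ₜ y) b = x * (b * antipode (k := k) y) := rfl

theorem adAction_eq_sandwich (h b : H) :
    adAction k H h b = sandwich k H (comul (R := k) h) b := rfl

theorem sandwich_left_mul (x : H) (t : H ⊗[k] H) (b : H) :
    sandwich k H ((x ⊗ₜ 1) * t) b = x * sandwich k H t b := by
  induction t using TensorProduct.induction_on with
  | zero => simp
  | add s t hs ht => simp only [mul_add, map_add, LinearMap.add_apply, hs, ht]
  | tmul y z => simp [mul_assoc]

theorem sandwich_right_mul (x : H) (t : H ⊗[k] H) (b : H) :
    sandwich k H ((1 ⊗ₜ x) * t) b = sandwich k H t b * antipode (k := k) x := by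
  induction t using TensorProduct.induction_on with
  | zero => simp
  | add s t hs ht => simp only [mul_add, add_mul, map_add, LinearMap.add_apply, hs, ht]
  | tmul y z => simp [mul_assoc, antipode_mul_rev]

theorem adAction_target (x b : H) :
    adAction k H (targetCounit k H x) b = targetCounit k H x * adAction k H 1 b := by
  rw [adAction_eq_sandwich, (comul_target x).1, sandwich_left_mul, adAction_eq_sandwich]

theorem adAction_source (x b : H) :
    adAction k H (sourceCounit k H x) b =
      adAction k H 1 b * antipode (k := k) (sourceCounit k H x) := by
  rw [adAction_eq_sandwich, (comul_source x).1, sandwich_right_mul, adAction_eq_sandwich]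

/-- `h₍₁₎ ε_s(h₍₂₎) = h` -/
theorem mul_source_self (h : H) :
    LinearMap.mul' k H ((sourceCounit k H).lTensor H (comul h)) = h := by
  obtain ⟨s, hs⟩ := exists_rep (comul (R := k) (1 : H))
  obtain ⟨t, ht⟩ := exists_rep (comul (R := k) h)
  have h3 := congrArg (TensorProduct.rid k H) (lTensor_counit_comul (R := k) h)
  rw [← comul_mul_one, hs, ht] at h3
  rw [ht]
  simp [Finset.sum_mul, Finset.mul_sum, map_sum, sourceCounit_rep hs] at h3 ⊢
  rw [Finset.sum_comm]
  exact h3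

/-- `(h₍₁₎ ·_ad b) h₍₂₎ = h b` for `b` in the centralizer of `H_s`: the left-hand side is
`h₍₁₎ b ε_s(h₍₂₎)`. -/
theorem adAction_mul_comul (h : H) {b : H}
    (hb : ∀ x, sourceCounit k H x * b = b * sourceCounit k H x) :
    LinearMap.mul' k H (((adAction k H).flip b).rTensor H (comul (R := k) h)) = h * b := by
  let L : H ⊗[k] (H ⊗[k] H) →ₗ[k] H := LinearMap.mul' k H ∘ₗ
    (LinearMap.mulLeft k b ∘ₗ LinearMap.mul' k H ∘ₗ (antipode (k := k)).rTensor H).lTensor H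
  have h1 : ∀ t : H ⊗[k] H, LinearMap.mul' k H (((adAction k H).flip b).rTensor H t) =
      L (TensorProduct.assoc k H H H ((comul (R := k)).rTensor H t)) := by
    have h2 : ∀ (w : H ⊗[k] H) (y : H), sandwich k H w b * y =
        L (TensorProduct.assoc k H H H (w ⊗ₜ y)) := by
      intro w y
      induction w using TensorProduct.induction_on with
      | zero => simp
      | add s t hs ht => simp only [map_add, LinearMap.add_apply, add_mul, add_tmul, hs, ht]
      | tmul x z => simp [L, mul_assoc]
    intro t
    induction t using TensorProduct.induction_on with
    | zero => simp
    | add s t hs ht => simp only [map_add, hs, ht]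
    | tmul x y => simpa [adAction_eq_sandwich] using h2 _ _
  rw [h1, coassoc_apply]
  conv_rhs => rw [← mul_source_self (k := k) h]
  obtain ⟨t, ht⟩ := exists_rep (comul (R := k) h)
  simp [ht, L, map_sum, antipode_mul, Finset.sum_mul, ← hb, mul_assoc]

end Adjoint

namespace HMod
section Regular
variable {k H : Type u} [Field k] [Ring H] [Algebra k H] [FiniteDimensional k H]

variable (k H) in
/-- The regular module `H`. -/
noncomputable def regular : HMod k H := ⟨H⟩

variable (k H) in
/-- The element `1` of the regular module. -/
def regularOne : regular k H := (1 : H)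

/-- An element of the regular module, viewed in `H`. -/
noncomputable def regularVal : regular k H →ₗ[H] H := LinearMap.id

theorem regularVal_injective : Function.Injective (regularVal (k := k) (H := H)) :=
  Function.injective_id

@[simp]
theorem regularVal_one : regularVal (regularOne k H) = 1 := rfl

@[simp]
theorem regularVal_smul_one (x : H) : regularVal (x • regularOne k H) = x := mul_one x

/-- The morphism `H ⟶ X`, `h ↦ h x`. -/
noncomputable def fromRegular {X : HMod k H} (x : X) : regular k H ⟶ X :=
  ofLin (LinearMap.toSpanSingleton H X x)

theorem fromRegular_one {X : HMod k H} (x : X) :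
    lin (fromRegular x) (regularOne k H) = x := one_smul H x

end Regular

section Action
variable {k H : Type u} [Field k] [Ring H] [Algebra k H] [Coalgebra k H] [WeakHopfAlgebra k H]
  [IsRegular k H] [FiniteDimensional k H]

/-- Linear maps on the truncated tensor product are determined by their values on `tm m n`. -/
theorem linearMap_ext_tm {M N : HMod k H} {V : Type u} [AddCommGroup V] [Module k V]
    {f g : (M ⊗ N : HMod k H) →ₗ[k] V} (h : ∀ m n, f (tm m n) = g (tm m n)) : f = g :=
  TTensor.hom_ext h

theorem adVal_injective : Function.Injective (adVal (k := k) (H := H)) :=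
  CentralizerSpace.val_injective

theorem adVal_smul (h : H) (b : adCentralizer k H) :
    adVal (h • b) = adAction k H h (adVal b) := rfl

theorem source_mul_adVal (b : adCentralizer k H) (x : H) :
    sourceCounit k H x * adVal b = adVal b * sourceCounit k H x :=
  CentralizerSpace.comm b x

theorem exists_adVal_eq {c : H}
    (hc : ∀ x, sourceCounit k H x * c = c * sourceCounit k H x) :
    ∃ b : adCentralizer k H, adVal b = c :=
  ⟨⟨c, (Subalgebra.mem_centralizer_iff k).2 (by rintro _ ⟨x, rfl⟩; exact hc x)⟩, rfl⟩

theorem adVal_target_smul (x : H) (b : adCentralizer k H) :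
    adVal (targetCounit k H x • b) = targetCounit k H x * adVal b := by
  rw [adVal_smul, adAction_target]
  congr 1
  exact adAction_one b

theorem adVal_source_smul (x : H) (b : adCentralizer k H) :
    adVal (sourceCounit k H x • b) = adVal b * antipode (k := k) (sourceCounit k H x) := by
  rw [adVal_smul, adAction_source]
  congr 1
  exact adAction_one b

/-- The map `b ⊗ x ↦ b x` on `C_H(H_s) ⊗_k X`. -/
noncomputable def adMul (X : HMod k H) : adCentralizer k H ⊗[k] X →ₗ[k] X :=
  TensorProduct.lift (actionMap k H X ∘ₗ adVal)

theorem adMul_diag (X : HMod k H) (h : H) (b : adCentralizer k H) (x : X) :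
    adMul X (diagAction k H _ _ h (b ⊗ₜ x)) = h • adVal b • x := by
  rw [← mul_smul, ← adAction_mul_comul h (source_mul_adVal b), diagAction_tmul]
  generalize comul (R := k) h = t
  induction t using TensorProduct.induction_on with
  | zero => simp
  | add s t hs ht => simp only [map_add, add_smul, hs, ht]
  | tmul y z => simp [adMul, mul_smul, adVal_smul]

/-- The canonical action of `C_H(H_s)` on an `H`-module, `1₍₁₎ ·_ad b ⊗ 1₍₂₎ x ↦ b x`. -/
noncomputable def canonicalAction (X : HMod k H) : adCentralizer k H ⊗ X ⟶ X :=
  ofLin (TTensor.homMk (adMul X ∘ₗ TTensor.incl k H _ _) (by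
    intro h b x
    rw [LinearMap.comp_apply, LinearMap.comp_apply, TTensor.incl_smul, ← TTensor.proj_tmul,
      TTensor.incl_proj, diagAction_mul_apply, mul_one, adMul_diag, adMul_diag, one_smul]))

@[simp]
theorem canonicalAction_tm (X : HMod k H) (b : adCentralizer k H) (x : X) :
    lin (canonicalAction X) (tm b x) = adVal b • x :=
  (adMul_diag X 1 b x).trans (one_smul _ _)

theorem canonicalAction_naturality {X Y : HMod k H} (f : X ⟶ Y) :
    adCentralizer k H ◁ f ≫ canonicalAction Y = canonicalAction X ≫ f :=
  hom_ext₂ fun b x => by simp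

variable (k H) in
/-- The canonical action as a natural transformation. -/
noncomputable def canonicalActionNat : tensorLeft (adCentralizer k H) ⟶ 𝟭 (HMod k H) where
  app := canonicalAction
  naturality _ _ f := canonicalAction_naturality f

end Action
end HMod
end WeakHopfAlgebra

/-! ### Universality of the canonical action -/

namespace WeakHopfAlgebra
namespace HMod
section Representability
variable {k H : Type u} [Field k] [Ring H] [Algebra k H] [Coalgebra k H] [WeakHopfAlgebra k H]
  [IsRegular k H] [FiniteDimensional k H]

theorem tmOrbit_comul_one {M N : HMod k H} (m : M) (n : N) :
    tmOrbit m n (comul (R := k) (1 : H)) = tm m n := by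
  rw [← smul_tm_eq, one_smul]

theorem tmOrbit_mul_tmul {M N : HMod k H} (m : M) (n : N) (t : H ⊗[k] H) (x y : H) :
    tmOrbit m n (t * (x ⊗ₜ y)) = tmOrbit (x • m) (y • n) t := by
  induction t using TensorProduct.induction_on with
  | zero => simp
  | add s t hs ht => simp only [add_mul, map_add, hs, ht]
  | tmul a b => simp [mul_smul]

theorem source_smul_tm {M N : HMod k H} (y : H) (m : M) (n : N) :
    sourceCounit k H y • (tm m n : (M ⊗ N : HMod k H)) = tm m (sourceCounit k H y • n) := by
  rw [smul_tm_eq, (comul_source y).2, tmOrbit_mul_tmul, one_smul, tmOrbit_comul_one]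

/-- `h₍₁₎ (v ⊗ S(h₍₂₎) n) = h v ⊗ n` in the truncated tensor product. -/
theorem sum_smul_tm_antipode {M N : HMod k H} (h : H) {t : Finset (H × H)}
    (ht : comul (R := k) h = ∑ i ∈ t, i.1 ⊗ₜ[k] i.2) (m : M) (n : N) :
    ∑ i ∈ t, i.1 • (tm m (antipode (k := k) i.2 • n) : (M ⊗ N : HMod k H)) = tm (h • m) n := by
  let L : H ⊗[k] (H ⊗[k] H) →ₗ[k] (M ⊗ N : HMod k H) := tmOrbit m n ∘ₗ
    (LinearMap.mul' k H ∘ₗ (antipode (k := k)).lTensor H).lTensor H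
  have h1 : ∀ (w : H ⊗[k] H) (y : H), tmOrbit m (antipode (k := k) y • n) w =
      L (TensorProduct.assoc k H H H (w ⊗ₜ y)) := by
    intro w y
    induction w using TensorProduct.induction_on with
    | zero => simp
    | add s t hs ht => simp only [map_add, add_tmul, hs, ht]
    | tmul x z => simp [L, mul_smul]
  have h2 : ∑ i ∈ t, comul (R := k) i.1 ⊗ₜ[k] i.2 =
      (comul (R := k)).rTensor H (comul (R := k) h) := by
    rw [ht]; simp [map_sum]
  have h3 : ∀ w : H ⊗[k] H, L ((comul (R := k)).lTensor H w) =
      tmOrbit m n ((targetCounit k H).lTensor H w) := by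
    intro w
    induction w using TensorProduct.induction_on with
    | zero => simp
    | add s t hs ht => simp only [map_add, hs, ht]
    | tmul x z => simp only [L, LinearMap.comp_apply, LinearMap.lTensor_tmul, mul_antipode]
  simp only [smul_tm_eq, h1, ← map_sum]
  rw [h2, coassoc_apply, h3, lTensor_target_comul, tmOrbit_mul_tmul, one_smul, tmOrbit_comul_one]

/-- The canonical action of `C_H(H_s)` is universal: a transformation `V ⊗ id ⟶ id` is
determined by its values on `v ⊗ 1` in the regular module, which lie in `C_H(H_s)` because
`y (v ⊗ 1) = v ⊗ y` for `y ∈ H_s`. -/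
theorem isUniversalAction_canonicalAction :
    IsUniversalAction (F := 𝟭 (HMod k H)) (canonicalActionNat k H) := by
  refine fun V => ⟨fun s t h => ?_, fun η => ?_⟩
  · refine hom_ext (LinearMap.ext fun v => adVal_injective ?_)
    have h1 : s ▷ regular k H ≫ canonicalAction (regular k H) =
        t ▷ regular k H ≫ canonicalAction (regular k H) :=
      congrArg (fun η => η.app (regular k H)) h
    have h2 := congrArg (fun f => lin f (tm v (regularOne k H))) h1
    simp only [lin_comp, LinearMap.comp_apply, whiskerRight_tm, canonicalAction_tm] at h2
    simpa using congrArg regularVal h2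
  · obtain ⟨e, he⟩ : ∃ e : ∀ X, V ⊗ X ⟶ X, ∀ X, η.app X = e X := ⟨fun X => η.app X, fun _ => rfl⟩
    have hn : ∀ {X Y : HMod k H} (f : X ⟶ Y), V ◁ f ≫ e Y = e X ≫ f := fun {X Y} f => by
      simp only [← he]
      exact η.naturality f
    let w : V →ₗ[k] H := regularVal.restrictScalars k ∘ₗ
      linₖ (e (regular k H)) ∘ₗ (tmₗ V (regular k H)).flip (regularOne k H)
    have hw : ∀ (X : HMod k H) (v : V) (x : X), lin (e X) (tm v x) = w v • x := by
      intro X v x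
      have h := congrArg (fun f => lin f (tm v (regularOne k H))) (hn (fromRegular x))
      simp only [lin_comp, LinearMap.comp_apply, whiskerLeft_tm, fromRegular_one] at h
      rw [h]
      exact congrArg (fun y => lin (fromRegular x) y) (regularVal_injective (by simp; rfl))
    have hc : ∀ v x, sourceCounit k H x * w v = w v * sourceCounit k H x := by
      intro v x
      have h : sourceCounit k H x * w v = regularVal (lin (e (regular k H))
          (sourceCounit k H x • tm v (regularOne k H))) := by
        rw [map_smul, map_smul]; rfl
      rw [h, source_smul_tm, hw, map_smul, regularVal_smul_one, smul_eq_mul]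
    have hs : ∀ (h : H) v, w (h • v) = adAction k H h (w v) := by
      intro h v
      obtain ⟨t, ht⟩ := exists_rep (comul (R := k) h)
      rw [adAction_rep ht]
      change regularVal (lin (e (regular k H)) (tm (h • v) (regularOne k H))) = _
      rw [← sum_smul_tm_antipode h ht, map_sum, map_sum]
      refine Finset.sum_congr rfl fun i _ => ?_
      rw [map_smul, hw, map_smul, map_smul, regularVal_smul_one, smul_eq_mul, smul_eq_mul,
        mul_assoc]
    choose f hf using fun v => exists_adVal_eq (hc v)
    refine ⟨ofLin
      { toFun := f
        map_add' := fun u v => adVal_injective (by rw [map_add, hf, hf, hf, map_add])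
        map_smul' := fun h v => adVal_injective (by
          rw [RingHom.id_apply, adVal_smul, hf, hf, hs]) }, ?_⟩
    refine NatTrans.ext (funext fun X => (hom_ext₂ fun v x => ?_ : _ = e X).trans (he X).symm)
    change lin (canonicalAction X) (lin (_ ▷ X) (tm v x)) = _
    rw [whiskerRight_tm, canonicalAction_tm, hw]
    exact congrArg (· • x) (hf v)

variable (k H) in
/-- The natural isomorphism `Hom(V, C_H(H_s)) ≅ Nat(V ⊗ id, id)`. -/
noncomputable def canonicalRepresentation :
    (natFunctor (HMod k H)).RepresentableBy (adCentralizer k H) where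
  homEquiv {V} := Equiv.ofBijective _ (isUniversalAction_canonicalAction V)
  homEquiv_comp f g := NatTrans.ext (funext fun X => by
    change (f ≫ g) ▷ X ≫ _ = f ▷ X ≫ g ▷ X ≫ _
    rw [comp_whiskerRight, Category.assoc])

theorem universalAction_canonicalRepresentation :
    universalAction (canonicalRepresentation k H) = canonicalActionNat k H :=
  NatTrans.ext (funext fun X => by
    change 𝟙 (adCentralizer k H) ▷ X ≫ _ = _
    rw [id_whiskerRight, Category.id_comp])

variable [Quasitriangular k H]

variable (k H) in
/-- The representability data given by the canonical action. -/
noncomputable def canonicalModuleRepresentation :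
    ModuleRepresentation (adCentralizer k H) where
  θ := canonicalRepresentation k H
  bijective_theta₂ V := by
    rw [universalAction_canonicalRepresentation]
    exact bijective_theta₂_of_isUniversalAction isUniversalAction_canonicalAction V
  bijective_theta₃ V := by
    rw [universalAction_canonicalRepresentation]
    exact bijective_theta₃_of_isUniversalAction isUniversalAction_canonicalAction V

theorem canonicalModuleRepresentation_α (X : HMod k H) :
    (canonicalModuleRepresentation k H).α X = canonicalAction X := by
  change (universalAction (canonicalRepresentation k H)).app X = _
  rw [universalAction_canonicalRepresentation]
  rfl

theorem isSeparatingAction_canonicalAction :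
    IsSeparatingAction (canonicalAction (k := k) (H := H)) where
  naturality := canonicalAction_naturality
  ext h := isUniversalAction_canonicalAction.ext h
  ext₂ h := (isUniversalAction_canonicalAction.tensor isUniversalAction_canonicalAction).ext
    fun P => h P.1 P.2
  ext₃ h := (isUniversalAction_canonicalAction.tensor
    (isUniversalAction_canonicalAction.tensor isUniversalAction_canonicalAction)).ext
      fun P => h P.1 P.2.1 P.2.2

end Representability
end HMod
end WeakHopfAlgebra

/-! ### The truncated square of the regular module and the flipped R-matrix -/

namespace WeakHopfAlgebra
namespace HMod
section RMatrix
variable {k H : Type u} [Field k] [Ring H] [Algebra k H] [Coalgebra k H] [WeakHopfAlgebra k H]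
  [IsRegular k H] [FiniteDimensional k H]

/-- The inclusion of `H ⊗_t H` into `H ⊗_k H`. -/
noncomputable def regularIncl : (regular k H ⊗ regular k H : HMod k H) →ₗ[k] H ⊗[k] H :=
  TensorProduct.map (regularVal.restrictScalars k) (regularVal.restrictScalars k) ∘ₗ
    inclₖ (regular k H) (regular k H)

theorem inclₖ_tm {M N : HMod k H} (m : M) (n : N) :
    inclₖ M N (tm m n) = orbit₂ (k := k) m n (comul (R := k) (1 : H)) :=
  diagAction_tmul _ _ _

theorem inclₖ_tmOrbit {M N : HMod k H} (m : M) (n : N) (t : H ⊗[k] H) :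
    inclₖ M N (tmOrbit m n t) = orbit₂ (k := k) m n (comul (R := k) (1 : H) * t) := by
  induction t using TensorProduct.induction_on with
  | zero => simp
  | add s t hs ht => simp only [map_add, mul_add, hs, ht]
  | tmul x y =>
    rw [tmOrbit_tmul, inclₖ_tm]
    generalize comul (R := k) (1 : H) = t
    induction t using TensorProduct.induction_on with
    | zero => simp
    | add s t hs ht => simp only [map_add, add_mul, hs, ht]
    | tmul a b => simp [mul_smul]

theorem regularIncl_smul (h : H) (w : (regular k H ⊗ regular k H : HMod k H)) :
    regularIncl (h • w) = comul (R := k) h * regularIncl w := by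
  have h1 : inclₖ _ _ (h • w) = diagAction k H _ _ h (inclₖ _ _ w) := TTensor.incl_smul h w
  rw [regularIncl, LinearMap.comp_apply, LinearMap.comp_apply, h1, diagAction_eq]
  generalize comul (R := k) h = t
  generalize inclₖ (regular k H) (regular k H) w = u
  induction t using TensorProduct.induction_on with
  | zero => simp
  | add s t hs ht => simp only [map_add, LinearMap.add_apply, add_mul, hs, ht]
  | tmul x y =>
    induction u using TensorProduct.induction_on with
    | zero => simp
    | add s t hs ht => simp only [map_add, mul_add, hs, ht]
    | tmul a b => simp

theorem regularIncl_tm (x y : regular k H) :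
    regularIncl (tm x y) =
      comul (R := k) (1 : H) * (regularVal x ⊗ₜ regularVal y) := by
  rw [regularIncl, LinearMap.comp_apply, inclₖ_tm]
  generalize comul (R := k) (1 : H) = t
  induction t using TensorProduct.induction_on with
  | zero => simp
  | add s t hs ht => simp only [map_add, add_mul, hs, ht]
  | tmul a b => simp

theorem regularIncl_smul_one (h : H) :
    regularIncl (h • tm (regularOne k H) (regularOne k H)) = comul (R := k) h := by
  rw [regularIncl_smul, regularIncl_tm, regularVal_one, ← Algebra.TensorProduct.one_def, mul_one,
    comul_mul_one]

variable [Quasitriangular k H]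

variable (k H) in
/-- The flipped `R`-matrix `R² ⊗ R¹`. -/
noncomputable def flipR : H ⊗[k] H :=
  TensorProduct.comm k H H (Quasitriangular.R (k := k) (H := H))

theorem comul_one_mul_flipR :
    comul (R := k) (1 : H) * flipR k H =
      flipR k H := by
  have h := congrArg (TensorProduct.comm k H H) (one_mul_R (k := k) (H := H))
  rw [comm_mul] at h
  have h' : TensorProduct.comm k H H (TensorProduct.comm k H H (comul (R := k) (1 : H))) =
    comul (R := k) (1 : H) := (TensorProduct.comm k H H).symm_apply_apply _
  rwa [h'] at h

/-- `R² ⊗ S(y) R¹ = y R² ⊗ R¹` for `y ∈ H_s`. -/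
theorem source_mul_flipR (y : H) :
    (sourceCounit k H y ⊗ₜ[k] (1 : H)) * flipR k H =
      ((1 : H) ⊗ₜ[k] antipode (k := k) (sourceCounit k H y)) *
        flipR k H := by
  rw [← comul_one_mul_flipR, ← _root_.mul_assoc, source_mul_comul_one, _root_.mul_assoc]

/-- `ε_t(R²) ⊗ R¹ = ε_t(1₍₁₎) ⊗ 1₍₂₎`, which expresses that the braiding with the unit object is
given by the unit isomorphisms. -/
theorem rTensor_target_flipR :
    (targetCounit k H).rTensor H (flipR k H) =
      (targetCounit k H).rTensor H (comul (R := k) (1 : H)) := by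
  have h := congrArg (fun f => lin f (tm (regularOne k H)
    (TargetSpace.mk k H 1 : (𝟙_ (HMod k H) : HMod k H))))
    (braiding_tensorUnit_right (regular k H))
  have h1 : lin (β_ (regular k H) (𝟙_ (HMod k H))).hom (tm (regularOne k H)
      (TargetSpace.mk k H 1 : (𝟙_ (HMod k H) : HMod k H))) =
      tmOrbit (TargetSpace.mk k H 1 : (𝟙_ (HMod k H) : HMod k H)) (regularOne k H)
        (flipR k H) := braid_tm_orbit _ _
  have h2 : lin (λ_ (regular k H)).inv (regularOne k H) =
      tm (TargetSpace.mk k H 1 : (𝟙_ (HMod k H) : HMod k H)) (regularOne k H) := rfl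
  have h3 : antipode (k := k) (unitVal (TargetSpace.mk k H 1 : (𝟙_ (HMod k H) : HMod k H))) =
      (1 : H) := by
    change antipode (k := k) (TargetSpace.val k H _) = _
    rw [TargetSpace.val_mk, target_one, antipode_one]
  simp only [lin_comp, LinearMap.comp_apply, h1, rightUnitor_tm, h3, one_smul, h2] at h
  have h4 := congrArg (TensorProduct.map (TargetSpace.val k H)
    (regularVal (k := k) (H := H).restrictScalars k)) (congrArg (inclₖ _ _) h)
  rw [inclₖ_tmOrbit, inclₖ_tm, comul_one_mul_flipR] at h4
  have hG : ∀ t : H ⊗[k] H, TensorProduct.map (TargetSpace.val k H)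
      (regularVal (k := k) (H := H).restrictScalars k)
      (orbit₂ (k := k) (TargetSpace.mk k H 1) (regularOne k H) t) =
        (targetCounit k H).rTensor H t := by
    intro t
    induction t using TensorProduct.induction_on with
    | zero => simp
    | add s t hs ht => simp only [map_add, hs, ht]
    | tmul x y => simp [target_one]
  exact (hG _).symm.trans (h4.trans (hG _))

end RMatrix
end HMod
end WeakHopfAlgebra

/-! ### The coproduct on the centralizer -/

namespace WeakHopfAlgebra
namespace HMod
section Coproduct
variable {k H : Type u} [Field k] [Ring H] [Algebra k H] [Coalgebra k H] [WeakHopfAlgebra k H]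
  [IsRegular k H] [FiniteDimensional k H] [Quasitriangular k H]

theorem tm_sum_left {ι : Type*} {M N : HMod k H} (s : Finset ι) (f : ι → M) (n : N) :
    tm (∑ i ∈ s, f i) n = ∑ i ∈ s, tm (f i) n :=
  LinearMap.map_sum₂ (tmₗ M N) s f n

theorem tm_sum_right {ι : Type*} {M N : HMod k H} (s : Finset ι) (m : M) (f : ι → N) :
    tm m (∑ i ∈ s, f i) = ∑ i ∈ s, tm m (f i) :=
  map_sum (tmₗ M N m) f s

theorem braiding_tm {s : Finset (H × H)} (hs : flipR k H = ∑ i ∈ s, i.1 ⊗ₜ[k] i.2)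
    {M N : HMod k H} (m : M) (n : N) :
    lin (β_ M N).hom (tm m n) = ∑ i ∈ s, tm (i.1 • n) (i.2 • m) := by
  refine (braid_tm_orbit m n).trans ?_
  change tmOrbit n m (flipR k H) = _
  simp [hs, map_sum]

/-- The action of `C_H(H_s) ⊗_t C_H(H_s)` on `X ⊗_t Y`. -/
noncomputable def pairedAction (X Y : HMod k H) :
    (adCentralizer k H ⊗ adCentralizer k H) ⊗ (X ⊗ Y) ⟶ X ⊗ Y :=
  tensorμ _ _ X Y ≫ (canonicalAction X ⊗ₘ canonicalAction Y)

theorem pairedAction_tm {s : Finset (H × H)} (hs : flipR k H = ∑ i ∈ s, i.1 ⊗ₜ[k] i.2)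
    {X Y : HMod k H} (c d : adCentralizer k H) (x : X) (y : Y) :
    lin (pairedAction X Y) (tm (tm c d) (tm x y)) =
      ∑ i ∈ s, tm (adVal c • i.1 • x) (adVal (i.2 • d) • y) := by
  simp only [pairedAction, tensorμ, lin_comp, LinearMap.comp_apply, associator_tm, whiskerLeft_tm,
    associator_inv_tm, whiskerRight_tm, braiding_tm hs, tm_sum_left, tm_sum_right, map_sum,
    tensorHom_tm, canonicalAction_tm]

/-- The action of `C_H(H_s) ⊗_t C_H(H_s)` on `1 ⊗ 1`, as a map with values in `H ⊗_k H`. -/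
noncomputable def actOnOne : (adCentralizer k H ⊗ adCentralizer k H : HMod k H) →ₗ[k] H ⊗[k] H :=
  regularIncl ∘ₗ linₖ (pairedAction (regular k H) (regular k H)) ∘ₗ
    (tmₗ _ _).flip (tm (regularOne k H) (regularOne k H))

/-- The value of `c ⊗ d` at `1 ⊗ 1` is `c R² ⊗ R¹ ·_ad d`. No truncation is needed, since `c`
commutes with `H_s` and multiplication of `C_H(H_s)` by `H_t` is the adjoint action. -/
theorem actOnOne_tm (c d : adCentralizer k H) :
    actOnOne (tm c d) = (adVal c ⊗ₜ 1) *
      ((adAction k H).flip (adVal d)).lTensor H (flipR k H) := by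
  obtain ⟨s, hs⟩ := exists_rep (flipR k H)
  obtain ⟨r, hr⟩ := exists_rep (comul (R := k) (1 : H))
  have hr' : comul (R := k) (1 : H) =
      ∑ j ∈ r, sourceCounit k H j.1 ⊗ₜ[k] targetCounit k H j.2 := by
    have h := congrArg ((sourceCounit k H).rTensor H) (lTensor_target_one (k := k) (H := H))
    rw [rTensor_source_one, hr] at h
    rw [hr, ← h]
    simp [map_sum]
  have h1 : actOnOne (tm c d) = ∑ i ∈ s, comul (R := k) (1 : H) *
      ((adVal c * i.1) ⊗ₜ adVal (i.2 • d)) := by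
    change regularIncl (lin (pairedAction (regular k H) (regular k H)) (tm (tm c d)
      (tm (regularOne k H) (regularOne k H)))) = _
    rw [pairedAction_tm hs, map_sum]
    refine Finset.sum_congr rfl fun i _ => ?_
    rw [regularIncl_tm, map_smul, map_smul, map_smul, regularVal_one]
    simp
  have h2 : ∀ x y : H, comul (R := k) (1 : H) * ((adVal c * x) ⊗ₜ adVal (y • d)) =
      (adVal c ⊗ₜ 1) * ((adAction k H).flip (adVal d)).lTensor H
        (comul (R := k) (1 : H) * (x ⊗ₜ y)) := by
    intro x y
    rw [hr', Finset.sum_mul, Finset.sum_mul, map_sum, Finset.mul_sum]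
    refine Finset.sum_congr rfl fun j _ => ?_
    have e : adAction k H (targetCounit k H j.2 * y) (adVal d) =
        targetCounit k H j.2 * adVal (y • d) := by
      rw [← adVal_target_smul, ← mul_smul, adVal_smul]
    simp only [Algebra.TensorProduct.tmul_mul_tmul, LinearMap.lTensor_tmul, LinearMap.flip_apply,
      e, ← mul_assoc, source_mul_adVal, one_mul]
  rw [h1, Finset.sum_congr rfl fun i _ => h2 i.1 i.2, ← Finset.mul_sum, ← map_sum,
    ← Finset.mul_sum, ← hs, comul_one_mul_flipR]

/-- The map `a ⊗ d ↦ a S(R²) ⊗ R¹ ·_ad d`. -/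
noncomputable def unbraid : H ⊗[k] H →ₗ[k] H ⊗[k] H :=
  act₂ ((LinearMap.mul k H).flip ∘ₗ antipode (k := k)) (adAction k H) (flipR k H)

/-- An element of `C_H(H_s) ⊗_t C_H(H_s)` is recovered from its value at `1 ⊗ 1`: by
`(id ⊗ Δ)(R) = R₁₃ R₁₂` and `R¹ ⊗ ε_t(R²) = 1₍₂₎ ⊗ ε_t(1₍₁₎)`, the factors `R` cancel up to
truncation. -/
theorem unbraid_actOnOne_tm (c d : adCentralizer k H) :
    unbraid (actOnOne (tm c d)) =
      TensorProduct.map adVal adVal (inclₖ (adCentralizer k H) (adCentralizer k H) (tm c d)) := by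
  obtain ⟨s, hs⟩ := exists_rep (Quasitriangular.R (k := k) (H := H))
  have hs' : flipR k H = ∑ i ∈ s, i.2 ⊗ₜ[k] i.1 := by simp [flipR, hs, map_sum]
  let T : H ⊗[k] (H ⊗[k] H) →ₗ[k] H ⊗[k] H := (TensorProduct.comm k H H).toLinearMap ∘ₗ
    TensorProduct.map ((adAction k H).flip (adVal d))
      (LinearMap.mulLeft k (adVal c) ∘ₗ LinearMap.mul' k H ∘ₗ (antipode (k := k)).lTensor H)
  have h1 := congrArg T (Quasitriangular.lTensor_comul (k := k) (H := H))
  have h2 : T ((comul (R := k)).lTensor H (Quasitriangular.R (k := k) (H := H))) =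
      (adVal c ⊗ₜ 1) * ((adAction k H).flip (adVal d)).lTensor H
        ((targetCounit k H).rTensor H (flipR k H)) := by
    rw [hs', hs]
    simp only [map_sum, LinearMap.lTensor_tmul, LinearMap.rTensor_tmul, Finset.mul_sum]
    refine Finset.sum_congr rfl fun i _ => ?_
    simp [T, mul_antipode]
  have h3 : unbraid (actOnOne (tm c d)) = T (TensorProduct.leftComm k H H H ((1 : H) ⊗ₜ[k]
      Quasitriangular.R (k := k) (H := H)) *
        TensorProduct.assoc k H H H (Quasitriangular.R (k := k) (H := H) ⊗ₜ[k] (1 : H))) := by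
    rw [actOnOne_tm, unbraid, hs', hs]
    simp only [map_sum, tmul_sum, sum_tmul, Finset.sum_mul, Finset.mul_sum, LinearMap.sum_apply]
    refine Finset.sum_congr rfl fun i _ => Finset.sum_congr rfl fun j _ => ?_
    simp [T, adAction_mul, mul_assoc]
  rw [h3, ← h1, h2, rTensor_target_flipR, inclₖ_tm, ← rTensor_source_one]
  generalize comul (R := k) (1 : H) = t
  induction t using TensorProduct.induction_on with
  | zero => simp
  | add s t hs ht => simp only [map_add, mul_add, hs, ht]
  | tmul x y =>
    simp only [LinearMap.rTensor_tmul, LinearMap.lTensor_tmul, Algebra.TensorProduct.tmul_mul_tmul,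
      orbit₂_tmul, TensorProduct.map_tmul, adVal_source_smul, LinearMap.flip_apply, one_mul,
      adVal_smul y, antipode_source]

theorem unbraid_actOnOne (u : (adCentralizer k H ⊗ adCentralizer k H : HMod k H)) :
    unbraid (actOnOne u) = TensorProduct.map adVal adVal (inclₖ _ _ u) :=
  LinearMap.congr_fun (linearMap_ext_tm (f := unbraid ∘ₗ actOnOne)
    (g := TensorProduct.map adVal adVal ∘ₗ inclₖ _ _) unbraid_actOnOne_tm) u

/-- A coproduct `d` corresponding to the action on tensor products satisfies
`d(b) · (1 ⊗ 1) = Δ(b)`. -/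
theorem actOnOne_comul {d : adCentralizer k H ⟶ adCentralizer k H ⊗ adCentralizer k H}
    (hd : actVia₂ (canonicalAction (regular k H)) (canonicalAction (regular k H)) d =
      canonicalAction (regular k H ⊗ regular k H)) (b : adCentralizer k H) :
    actOnOne (lin d b) = comul (R := k) (adVal b) := by
  have h := congrArg (fun f => regularIncl (lin f (tm b (tm (regularOne k H) (regularOne k H))))) hd
  simp only [canonicalAction_tm, regularIncl_smul_one] at h
  rw [← h, actVia₂, lin_comp, LinearMap.comp_apply, whiskerRight_tm]
  rfl

theorem comul_eq_braidedComul {d : adCentralizer k H ⟶ adCentralizer k H ⊗ adCentralizer k H}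
    (hd : actVia₂ (canonicalAction (regular k H)) (canonicalAction (regular k H)) d =
      canonicalAction (regular k H ⊗ regular k H)) (b : adCentralizer k H) :
    TensorProduct.map adVal adVal (inclₖ _ _ (lin d b)) = braidedComul k (adVal b) := by
  rw [← unbraid_actOnOne, actOnOne_comul hd]
  rfl

end Coproduct
end HMod
end WeakHopfAlgebra

/-! ### The antipode on the centralizer -/

namespace WeakHopfAlgebra
namespace HMod
section Antipode
variable {k H : Type u} [Field k] [Ring H] [Algebra k H] [Coalgebra k H] [WeakHopfAlgebra k H]
  [IsRegular k H] [FiniteDimensional k H] [Quasitriangular k H]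

theorem braidedAntipode_rep {s : Finset (H × H)} (hs : flipR k H = ∑ i ∈ s, i.1 ⊗ₜ[k] i.2)
    (b : H) : braidedAntipode k b = ∑ i ∈ s, i.1 * antipode (k := k) (adAction k H i.2 b) := by
  change LinearMap.mul' k H (TensorProduct.map _ _ (flipR k H)) = _
  simp [hs, map_sum]

/-- `R² S(R¹ ·_ad b)` commutes with `H_s`, because `y R² ⊗ R¹ = R² ⊗ S(y) R¹` for `y ∈ H_s`. -/
theorem source_mul_braidedAntipode (b : adCentralizer k H) (y : H) :
    sourceCounit k H y * braidedAntipode k (adVal b) =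
      braidedAntipode k (adVal b) * sourceCounit k H y := by
  let T : H ⊗[k] H →ₗ[k] H := LinearMap.mul' k H ∘ₗ
    (antipode (k := k) ∘ₗ (adAction k H).flip (adVal b)).lTensor H
  have h := congrArg T (source_mul_flipR (k := k) y)
  obtain ⟨s, hs⟩ := exists_rep (flipR k H)
  have e : ∀ i : H, adAction k H (antipode (k := k) (sourceCounit k H y) * i) (adVal b) =
      antipode (k := k) (sourceCounit k H y) * adAction k H i (adVal b) := by
    intro i
    rw [antipode_source, adAction_mul]
    exact adVal_target_smul _ (i • b)
  rw [braidedAntipode_rep hs, Finset.mul_sum, Finset.sum_mul]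
  simpa [hs, T, map_sum, Finset.mul_sum, mul_assoc, e, antipode_mul_rev,
    antipode_antipode_source] using h

/-- Snake computation behind the antipode: contracting `X ⊗ X^*` against `x` while `X^*` is acted on
by `c_i` and `X` by `a_i` yields the action of `∑ a_i S(c_i)`, provided this element commutes
with `H_s`. -/
theorem canonicalElement_contract {M : Type u} [AddCommGroup M] [Module k M] [Module H M]
    [IsScalarTower k H M] [FiniteDimensional k M] {ι : Type*} (s : Finset ι) (a c : ι → H)
    (hc : ∀ y : H, sourceCounit k H y * (∑ i ∈ s, a i * antipode (k := k) (c i)) =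
      (∑ i ∈ s, a i * antipode (k := k) (c i)) * sourceCounit k H y)
    (x : M) (G : M ⊗[k] DualSpace k H M →ₗ[k] M)
    (hG : ∀ m f, G (m ⊗ₜ f) = ∑ i ∈ s, antipode (k := k) (TargetSpace.val k H
      (pairForm (c i • f) x (comul (R := k) (1 : H)))) • a i • m) :
    G (canonicalElement k H M) = (∑ i ∈ s, a i * antipode (k := k) (c i)) • x := by
  obtain ⟨r, hr⟩ := exists_rep (comul (R := k) (1 : H))
  have h1 : ∀ w, G w = ∑ i ∈ s, ∑ j ∈ r, antipode (k := k) (targetCounit k H j.2) • a i •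
      toEnd k H M w (antipode (k := k) (c i) • j.1 • x) := by
    intro w
    induction w using TensorProduct.induction_on with
    | zero => simp
    | add u v hu hv => simp only [map_add, LinearMap.add_apply, smul_add, hu, hv,
        Finset.sum_add_distrib]
    | tmul m f =>
      rw [hG]
      refine Finset.sum_congr rfl fun i _ => ?_
      rw [hr]
      simp only [map_sum, pairForm_tmul, map_smul, TargetSpace.val_mk, toEnd_tmul, Finset.sum_smul,
        DualSpace.smul_apply]
      refine Finset.sum_congr rfl fun j _ => ?_
      rw [smul_assoc, smul_comm (a i)
        (DualSpace.toDual k H M f (antipode (k := k) (c i) • j.1 • x)),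
        smul_comm (antipode (k := k) (targetCounit k H j.2))
        (DualSpace.toDual k H M f (antipode (k := k) (c i) • j.1 • x))]
  have h2 : ∑ j ∈ r, sbar (k := k) j.2 * j.1 = 1 := by
    have h3 := congrArg (TensorProduct.rid k H)
      ((congrArg _ (one_mul_comul (k := k) (1 : H))).trans (lTensor_counit_comul (R := k) (1 : H)))
    rw [hr] at h3
    simp only [sbar_rep hr]
    simpa [Finset.sum_mul, Finset.mul_sum, map_sum] using h3
  rw [h1, Finset.sum_comm]
  simp only [toEnd_canonical, LinearMap.id_apply, ← mul_smul, ← Finset.sum_smul]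
  congr 1
  calc _ = ∑ j ∈ r, antipode (k := k) (targetCounit k H j.2) *
        (∑ i ∈ s, a i * antipode (k := k) (c i)) * j.1 := by
        simp only [Finset.mul_sum, Finset.sum_mul, mul_assoc]
    _ = (∑ i ∈ s, a i * antipode (k := k) (c i)) * ∑ j ∈ r, sbar (k := k) j.2 * j.1 := by
        rw [Finset.mul_sum]
        refine Finset.sum_congr rfl fun j _ => ?_
        rw [antipode_target, hc, ← antipode_target, antipode_target_eq_sbar, mul_assoc]
    _ = _ := by rw [h2, mul_one]

/-- The composite
`B ⊗ X → B ⊗ X ⊗ X^* ⊗ X → X ⊗ B ⊗ X^* ⊗ X → X ⊗ X^* ⊗ X → X` which determines the antipode. -/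
noncomputable def antipodeAction (X : HMod k H) : adCentralizer k H ⊗ X ⟶ X :=
  adCentralizer k H ◁ ((λ_ X).inv ≫ (η_ X Xᘁ) ▷ X ≫ (α_ X Xᘁ X).hom) ≫
    (α_ (adCentralizer k H) X (Xᘁ ⊗ X)).inv ≫
      (β_ (adCentralizer k H) X).hom ▷ (Xᘁ ⊗ X) ≫ (α_ X (adCentralizer k H) (Xᘁ ⊗ X)).hom ≫
        X ◁ ((α_ (adCentralizer k H) Xᘁ X).inv ≫ canonicalAction Xᘁ ▷ X ≫ ε_ X Xᘁ) ≫ (ρ_ X).hom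

theorem antipodeAction_tm (X : HMod k H) (b : adCentralizer k H) (x : X) :
    lin (antipodeAction X) (tm b x) = braidedAntipode k (adVal b) • x := by
  obtain ⟨s, hs⟩ := exists_rep (flipR k H)
  let rest : adCentralizer k H ⊗ (X ⊗ (dual X ⊗ X)) ⟶ X :=
    (α_ (adCentralizer k H) X (dual X ⊗ X)).inv ≫
      (β_ (adCentralizer k H) X).hom ▷ (dual X ⊗ X) ≫
        (α_ X (adCentralizer k H) (dual X ⊗ X)).hom ≫
        X ◁ ((α_ (adCentralizer k H) (dual X) X).inv ≫ canonicalAction (dual X) ▷ X ≫ ev X) ≫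
          (ρ_ X).hom
  have hrest : ∀ (m : X) (f : dual X), lin rest (tm b (tm m (tm f x))) =
      ∑ i ∈ s, antipode (k := k) (TargetSpace.val k H (pairForm (adVal (i.2 • b) • f) x
        (comul (R := k) (1 : H)))) • i.1 • m := by
    intro m f
    simp only [rest, lin_comp, LinearMap.comp_apply, associator_tm, whiskerLeft_tm,
      associator_inv_tm, whiskerRight_tm, braiding_tm hs, tm_sum_left, map_sum,
      canonicalAction_tm, ev_tm, rightUnitor_tm]
    rfl
  let G : X ⊗[k] DualSpace k H X →ₗ[k] X :=
    linₖ rest ∘ₗ tmₗ _ _ b ∘ₗ linₖ (α_ X (dual X) X).hom ∘ₗ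
      (tmₗ (X ⊗ dual X) X).flip x ∘ₗ projₖ X (dual X)
  have h1 : lin (antipodeAction X) (tm b x) = G (canonicalElement k H X) := by
    have e : lin (coev X) (TargetSpace.mk k H 1) =
        projₖ X (dual X) (canonicalElement k H X) := by
      refine (lin_coev X _).trans ?_
      change TTensor.proj k H X (DualSpace k H X) (diagAction k H X (DualSpace k H X)
        (TargetSpace.val k H (TargetSpace.mk k H 1)) _) = _
      rw [TargetSpace.val_mk, target_one, ← TTensor.smul_proj, one_smul]
      rfl
    have e2 : lin (λ_ X).inv x = tm (TargetSpace.mk k H 1) x := rfl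
    change lin (_ ◁ ((λ_ X).inv ≫ coev X ▷ X ≫ (α_ X (dual X) X).hom) ≫ rest) (tm b x) = _
    simp only [lin_comp, LinearMap.comp_apply, whiskerLeft_tm, e2, whiskerRight_tm, e]
    rfl
  have hW : braidedAntipode k (adVal b) =
      ∑ i ∈ s, i.1 * antipode (k := k) (adVal (i.2 • b)) := by
    simp only [braidedAntipode_rep hs, adVal_smul]
  rw [h1, hW]
  refine canonicalElement_contract s (fun i => i.1) (fun i => adVal (i.2 • b)) ?_ x G ?_
  · intro y
    rw [← hW, source_mul_braidedAntipode]
  · intro m f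
    refine Eq.trans ?_ (hrest m f)
    change lin rest (tm b (lin (α_ X (dual X) X).hom (tm (tm m f) x))) = _
    exact congrArg (lin rest) (congrArg (tm b) (associator_tm X (dual X) X m f x))

end Antipode
end HMod
end WeakHopfAlgebra

/-! ### One-sided convolution inverses -/

namespace WeakHopfAlgebra
namespace HMod
section Convolution
variable {k H : Type u} [Field k] [Ring H] [Algebra k H] [Coalgebra k H] [WeakHopfAlgebra k H]
  [IsRegular k H] [FiniteDimensional k H]

theorem lin_whiskerLeft_add {M N P : HMod k H} (f g : N →ₗ[H] P) (w : (M ⊗ N : HMod k H)) :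
    lin (M ◁ ofLin (f + g)) w = lin (M ◁ ofLin f) w + lin (M ◁ ofLin g) w :=
  LinearMap.congr_fun (linearMap_ext_tm (f := linₖ (M ◁ ofLin (f + g)))
    (g := linₖ (M ◁ ofLin f) + linₖ (M ◁ ofLin g)) fun m n => by
      change lin (M ◁ _) (tm m n) = lin (M ◁ _) (tm m n) + lin (M ◁ _) (tm m n)
      simp only [whiskerLeft_tm]
      exact map_add (tmₗ M P m) _ _) w

theorem lin_whiskerLeft_smul {M N P : HMod k H} (c : k) (f : N →ₗ[H] P)
    (w : (M ⊗ N : HMod k H)) :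
    lin (M ◁ ofLin (c • f)) w = c • lin (M ◁ ofLin f) w :=
  LinearMap.congr_fun (linearMap_ext_tm (f := linₖ (M ◁ ofLin (c • f)))
    (g := c • linₖ (M ◁ ofLin f)) fun m n => by
      change lin (M ◁ _) (tm m n) = c • lin (M ◁ _) (tm m n)
      simp only [whiskerLeft_tm]
      exact map_smul (tmₗ M P m) _ _) w

/-- One-sided convolution inverses are two-sided, since the convolution algebra is
finite-dimensional. -/
theorem conv_mul_eq_one_symm {M N : HMod k H} [ComonObj M] [MonObj N] {f g : Conv M N}
    (h : f * g = 1) : g * f = 1 := by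
  -- the identification of convolution elements with linear maps
  let toConv : (M →ₗ[H] N) → Conv M N := fun p => ofLin p
  let toLin : Conv M N → (M →ₗ[H] N) := fun f => lin f
  have hmul : ∀ p m, toLin (f * toConv p) m =
      linₖ (MonObj.mul (X := N)) (lin (N ◁ ofLin p)
        (lin ((show M ⟶ N from f) ▷ M) (lin (ComonObj.comul (X := M)) m))) := fun _ _ => rfl
  let L : (M →ₗ[H] N) →ₗ[k] (M →ₗ[H] N) :=
    { toFun := fun p => toLin (f * toConv p)
      map_add' := fun p q => LinearMap.ext fun m => by
        rw [LinearMap.add_apply, hmul, hmul, hmul, lin_whiskerLeft_add, map_add]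
      map_smul' := fun c p => LinearMap.ext fun m => by
        rw [RingHom.id_apply, LinearMap.smul_apply, hmul, hmul, lin_whiskerLeft_smul, map_smul] }
  have : FiniteDimensional k (M →ₗ[H] N) := FiniteDimensional.of_injective
    (LinearMap.restrictScalarsₗ k H M N k) (LinearMap.restrictScalars_injective k)
  have hs : Function.Surjective L := fun p => ⟨toLin (g * toConv p), by
    change toLin (f * (g * toConv p)) = p
    rw [← _root_.mul_assoc, h, _root_.one_mul]
    rfl⟩
  have hi : L (toLin (g * f)) = L (toLin 1) := by
    change toLin (f * (g * f)) = toLin (f * 1)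
    rw [← _root_.mul_assoc, h, _root_.one_mul, _root_.mul_one]
  exact congrArg toConv (LinearMap.injective_iff_surjective.2 hs hi)

end Convolution
end HMod
end WeakHopfAlgebra

/-! ### The Hopf algebra structure -/

namespace WeakHopfAlgebra
namespace HMod
section Structure
variable {k H : Type u} [Field k] [Ring H] [Algebra k H] [Coalgebra k H] [WeakHopfAlgebra k H]
  [IsRegular k H] [FiniteDimensional k H]

/-- A morphism into `C_H(H_s)` is evaluated by letting it act on `1` in the regular module. -/
theorem adVal_eq_of_act {V : HMod k H} {t : V ⟶ adCentralizer k H}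
    {e : ∀ X : HMod k H, V ⊗ X ⟶ X} (h : ∀ X, t ▷ X ≫ canonicalAction X = e X) (v : V) :
    adVal (lin t v) = regularVal (lin (e (regular k H)) (tm v (regularOne k H))) := by
  rw [← h, lin_comp, LinearMap.comp_apply, whiskerRight_tm, canonicalAction_tm,
    regularVal_smul_one]

variable (k H) in
theorem exists_mul_act : ∃ m : adCentralizer k H ⊗ adCentralizer k H ⟶ adCentralizer k H,
    ∀ X, m ▷ X ≫ canonicalAction X =
      (α_ _ _ X).hom ≫ adCentralizer k H ◁ canonicalAction X ≫ canonicalAction X :=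
  isUniversalAction_canonicalAction.exists_act _ fun {P Q} f => by
    change (MonoidalCategory.tensorObj _ _) ◁ f ≫ (α_ _ _ Q).hom ≫ _ = ((α_ _ _ P).hom ≫ _) ≫ f
    rw [associator_naturality_right_assoc, ← whiskerLeft_comp_assoc, canonicalAction_naturality f,
      whiskerLeft_comp_assoc, canonicalAction_naturality f]
    simp only [Category.assoc]

theorem adVal_mul {m : adCentralizer k H ⊗ adCentralizer k H ⟶ adCentralizer k H}
    (hm : ∀ X, m ▷ X ≫ canonicalAction X =
      (α_ _ _ X).hom ≫ adCentralizer k H ◁ canonicalAction X ≫ canonicalAction X)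
    (a b : adCentralizer k H) : adVal (lin m (tm a b)) = adVal a * adVal b := by
  rw [adVal_eq_of_act hm]
  simp [associator_tm, map_smul]

variable (k H) in
theorem exists_one_act : ∃ u : 𝟙_ (HMod k H) ⟶ adCentralizer k H,
    ∀ X, u ▷ X ≫ canonicalAction X = (λ_ X).hom :=
  isUniversalAction_canonicalAction.exists_act _ fun f => leftUnitor_naturality f

theorem adVal_one {u : 𝟙_ (HMod k H) ⟶ adCentralizer k H}
    (hu : ∀ X, u ▷ X ≫ canonicalAction X = (λ_ X).hom) (z : (𝟙_ (HMod k H) : HMod k H)) :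
    adVal (lin u z) = unitVal z := by
  rw [adVal_eq_of_act hu, leftUnitor_tm, regularVal_smul_one]

theorem unitVal_counit (b : adCentralizer k H) :
    unitVal (lin ((ρ_ (adCentralizer k H)).inv ≫ canonicalAction (𝟙_ (HMod k H))) b) =
      targetCounit k H (adVal b) := by
  rw [lin_comp, LinearMap.comp_apply]
  change unitVal (lin (canonicalAction (𝟙_ (HMod k H))) (tm b (TargetSpace.mk k H 1))) = _
  rw [canonicalAction_tm]
  change targetCounit k H (adVal b * targetCounit k H 1) = _
  rw [target_one, mul_one]

variable [Quasitriangular k H]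

variable (k H) in
theorem exists_comul_act : ∃ d : adCentralizer k H ⟶ adCentralizer k H ⊗ adCentralizer k H,
    ∀ X Y, actVia₂ (canonicalAction X) (canonicalAction Y) d = canonicalAction (X ⊗ Y) := by
  obtain ⟨d, hd⟩ := (isUniversalAction_canonicalAction.tensor
    (isUniversalAction_canonicalAction (k := k) (H := H))).exists_act
      (fun P => canonicalAction (P.1 ⊗ P.2)) fun f => canonicalAction_naturality _
  exact ⟨d, fun X Y => hd (X, Y)⟩

theorem antipodeAction_naturality {X Y : HMod k H} (f : X ⟶ Y) :
    adCentralizer k H ◁ f ≫ antipodeAction Y = antipodeAction X ≫ f :=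
  hom_ext₂ fun b x => by simp [antipodeAction_tm]

variable (k H) in
theorem exists_antipode_act : ∃ S : adCentralizer k H ⟶ adCentralizer k H,
    ∀ X, S ▷ X ≫ canonicalAction X = antipodeAction X :=
  isUniversalAction_canonicalAction.exists_act _ antipodeAction_naturality

theorem adVal_antipode {S : adCentralizer k H ⟶ adCentralizer k H}
    (hS : ∀ X, S ▷ X ≫ canonicalAction X = antipodeAction X) (b : adCentralizer k H) :
    adVal (lin S b) = braidedAntipode k (adVal b) := by
  rw [adVal_eq_of_act hS, antipodeAction_tm, regularVal_smul_one]

/-- In terms of the values at `1 ⊗ 1`, the map `m (id ⊗ S_B)` is `x ⊗ y ↦ x S(y)`. -/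
theorem adVal_mul_antipode {m : adCentralizer k H ⊗ adCentralizer k H ⟶ adCentralizer k H}
    {S : adCentralizer k H ⟶ adCentralizer k H}
    (hm : ∀ a b : adCentralizer k H, adVal (lin m (tm a b)) = adVal a * adVal b)
    (hS : ∀ b : adCentralizer k H, adVal (lin S b) = braidedAntipode k (adVal b))
    (w : (adCentralizer k H ⊗ adCentralizer k H : HMod k H)) :
    adVal (lin m (lin (adCentralizer k H ◁ S) w)) =
      LinearMap.mul' k H ((antipode (k := k)).lTensor H (actOnOne w)) := by
  obtain ⟨s, hs⟩ := exists_rep (flipR k H)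
  refine LinearMap.congr_fun (linearMap_ext_tm
    (f := adVal ∘ₗ linₖ m ∘ₗ linₖ (adCentralizer k H ◁ S))
    (g := LinearMap.mul' k H ∘ₗ (antipode (k := k)).lTensor H ∘ₗ actOnOne) fun a b => ?_) w
  change adVal (lin m (lin (adCentralizer k H ◁ S) (tm a b))) =
    LinearMap.mul' k H ((antipode (k := k)).lTensor H (actOnOne (tm a b)))
  rw [whiskerLeft_tm, hm, hS, actOnOne_tm, braidedAntipode_rep hs, hs]
  simp [Finset.mul_sum, map_sum, mul_assoc]

/-- The axiom `m (id ⊗ S_B) Δ_B = u ε`, which reduces to `b₍₁₎ S(b₍₂₎) = ε_t(b)`. -/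
theorem comul_antipode_mul {m : adCentralizer k H ⊗ adCentralizer k H ⟶ adCentralizer k H}
    {S : adCentralizer k H ⟶ adCentralizer k H} {u : 𝟙_ (HMod k H) ⟶ adCentralizer k H}
    {d : adCentralizer k H ⟶ adCentralizer k H ⊗ adCentralizer k H}
    (hm : ∀ a b : adCentralizer k H, adVal (lin m (tm a b)) = adVal a * adVal b)
    (hS : ∀ b : adCentralizer k H, adVal (lin S b) = braidedAntipode k (adVal b))
    (hu : ∀ z, adVal (lin u z) = unitVal z)
    (hd : ∀ X Y, actVia₂ (canonicalAction X) (canonicalAction Y) d = canonicalAction (X ⊗ Y)) :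
    d ≫ adCentralizer k H ◁ S ≫ m =
      ((ρ_ (adCentralizer k H)).inv ≫ canonicalAction (𝟙_ (HMod k H))) ≫ u := by
  refine congrArg ofLin (LinearMap.ext fun b => adVal_injective ?_ :
    lin (d ≫ adCentralizer k H ◁ S ≫ m) = lin (_ ≫ u))
  rw [lin_comp _ u, LinearMap.comp_apply, hu, unitVal_counit, ← mul_antipode,
    ← actOnOne_comul (hd _ _), ← adVal_mul_antipode hm hS]
  rfl

/-- The Hopf algebra structure on `C_H(H_s)` whose structure maps have the prescribed actions. -/
theorem exists_hopfObj : ∃ h : HopfObj (adCentralizer k H),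
    (∀ X, h.mul ▷ X ≫ canonicalAction X =
      (α_ _ _ X).hom ≫ adCentralizer k H ◁ canonicalAction X ≫ canonicalAction X) ∧
    (∀ X, h.one ▷ X ≫ canonicalAction X = (λ_ X).hom) ∧
    (∀ X Y, actVia₂ (canonicalAction X) (canonicalAction Y) h.comul = canonicalAction (X ⊗ Y)) ∧
    h.counit = (ρ_ _).inv ≫ canonicalAction (𝟙_ (HMod k H)) ∧
    (∀ X, h.antipode ▷ X ≫ canonicalAction X = antipodeAction X) := by
  obtain ⟨m, hm⟩ := exists_mul_act k H
  obtain ⟨u, hu⟩ := exists_one_act k H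
  obtain ⟨d, hd⟩ := exists_comul_act k H
  obtain ⟨S, hS⟩ := exists_antipode_act k H
  let b := isSeparatingAction_canonicalAction.bimonObj hm hu hd
  have hr : d ≫ adCentralizer k H ◁ S ≫ m = b.counit ≫ u :=
    comul_antipode_mul (adVal_mul hm) (adVal_antipode hS) (adVal_one hu) hd
  have hl : d ≫ S ▷ adCentralizer k H ≫ m = b.counit ≫ u := by
    let f : Conv (adCentralizer k H) (adCentralizer k H) := 𝟙 (adCentralizer k H)
    let g : Conv (adCentralizer k H) (adCentralizer k H) := S
    have h1 : f * g = 1 := by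
      refine (Eq.trans ?_ hr : d ≫ 𝟙 _ ▷ _ ≫ _ ◁ S ≫ m = b.counit ≫ u)
      rw [id_whiskerRight, Category.id_comp]
    have h2 : d ≫ S ▷ _ ≫ _ ◁ 𝟙 _ ≫ m = b.counit ≫ u := conv_mul_eq_one_symm h1
    rwa [whiskerLeft_id, Category.id_comp] at h2
  exact ⟨{ b with antipode := S, antipode_left := hl, antipode_right := hr },
    hm, hu, hd, rfl, hS⟩

end Structure
end HMod
end WeakHopfAlgebra

theorem mainTheorem7 {k H : Type u} [Field k] [Ring H] [Algebra k H] [Coalgebra k H]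
    [FiniteDimensional k H] [WeakHopfAlgebra k H] [IsRegular k H]
    [Quasitriangular k H] :
    RepresentabilityAssumption (HMod k H) ∧
    ∃ (ρ : ModuleRepresentation (adCentralizer k H)) (_ : HopfObj (adCentralizer k H)),
      IsAutomorphismBraidedGroup ρ ∧
      (∀ (X : HMod k H) (b : adCentralizer k H) (x : X),
        lin (ρ.α X) (tm b x) = adVal b • x) ∧
      (∀ a b : adCentralizer k H,
        adVal (lin (MonObj.mul (X := adCentralizer k H)) (tm a b)) = adVal a * adVal b) ∧
      (∀ z : (𝟙_ (HMod k H) : HMod k H),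
        adVal (lin (MonObj.one (X := adCentralizer k H)) z) = unitVal z) ∧
      (∀ b : adCentralizer k H,
        TensorProduct.map adVal adVal (inclₖ (adCentralizer k H) (adCentralizer k H)
          (lin (ComonObj.comul (X := adCentralizer k H)) b)) = braidedComul k (adVal b)) ∧
      (∀ b : adCentralizer k H,
        unitVal (lin (ComonObj.counit (X := adCentralizer k H)) b) =
          targetCounit k H (adVal b)) ∧
      (∀ b : adCentralizer k H,
        adVal (lin (HopfObj.antipode (X := adCentralizer k H)) b) =
          braidedAntipode k (adVal b)) := by
  obtain ⟨h, hm, hu, hd, hε, hS⟩ := exists_hopfObj (k := k) (H := H)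
  refine ⟨⟨_, ⟨canonicalModuleRepresentation k H⟩⟩, canonicalModuleRepresentation k H, h,
    { mul_act := fun X => ?_, one_act := fun X => ?_, comul_act := fun X Y => ?_,
      counit_eq := ?_, antipode_act := fun X => ?_ },
    fun X b x => ?_, adVal_mul hm, adVal_one hu, comul_eq_braidedComul (hd _ _), fun b => ?_,
    adVal_antipode hS⟩
  · simp only [canonicalModuleRepresentation_α]
    exact hm X
  · simp only [canonicalModuleRepresentation_α]
    exact hu X
  · rw [canonicalModuleRepresentation_α]
    exact (congrArg (fun α => (theta₂ α _ _).app (X, Y))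
      universalAction_canonicalRepresentation).trans (hd X Y)
  · rw [canonicalModuleRepresentation_α]
    exact hε
  · simp only [canonicalModuleRepresentation_α]
    exact hS X
  · rw [canonicalModuleRepresentation_α, canonicalAction_tm]
  · rw [← unitVal_counit, ← hε]
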